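/- Fix $\pi_1\in(0,1)$, $\pi_2=1-\pi_1$, $r\ge 0$ and $\omega>r^2$. For a sequence of reals $\lambda_n$, the two-community stochastic block model on $n$ nodes is defined as follows: the true label vector $c\in\{-1,1\}^n$ gives label $1$ to the first $\lfloor n\pi_1\rfloor$ nodes and label $-1$ to the others; the adjacency matrix $A$ is a symmetric random $0/1$ matrix with independent entries on and below the diagonal, and for $i\neq j$, $\mathbb P(A_{ij}=1)=\frac{\lambda_n}{n}p_{ij}$, where $p_{ij}=1$ if $c_i=c_j=1$, $p_{ij}=\omega$ if $c_i=c_j=-1$, and $p_{ij}=r$ if $c_i\ne c_j$. The diagonal follows one of two conventions: either the same formula also holds for $i=j$, or $A_{ii}=0$ for all $i$. For an $n\times n$ matrix $B$ and $e\in\{-1,1\}^n$ put $O_{11}=\frac14(\mathbf 1+e)^TB(\mathbf 1+e)$, $O_{22}=\frac14(\mathbf 1-e)^TB(\mathbf 1-e)$, $O_{12}=\frac14(\mathbf 1+e)^TB(\mathbf 1-e)$, $O_1=O_{11}+O_{12}$, $O_2=O_{22}+O_{12}$, and let the Newman–Girvan modularity be, up to a constant factor, $Q_B(e)=O_{11}+O_{22}-\frac{O_1^2+O_2^2}{O_1+O_2}$.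 For a real $2\times n$ matrix $U$ let $\mathcal E_U$ be the set of $e\in\{-1,1\}^n$ for which $Ue$ is an extreme point of $U[-1,1]^n$. For a symmetric matrix $B$ let $U_B$ denote any $2\times n$ matrix whose rows are orthonormal eigenvectors of $B$ for its two largest eigenvalues, counted with multiplicity. Let $\|\cdot\|$ be the Euclidean norm of vectors and the spectral norm of matrices. Theorem. For every $\delta\in(0,1)$ there is a constant $M=M(r,\omega,\pi_1,\delta)>0$ such that, for each of the two conventions and every sequence $\lambda_n$ that grows at least as $\log n$ (that is, $\lambda_n\ge a\log n$ for some $a>0$ and all large $n$), for all sufficiently large $n$ the following two statements hold simultaneously with probability at least $1-n^{-\delta}$. (1) For every real $2\times n$ matrix $U_A$ (in particular every one computed from $A$), every choice of $U_{\mathbb E[A]}$, and every maximizer $e^*$ of $Q_A$ over $\mathcal E_{U_A}$, $$\frac1n\min\left(\|c-e^*\|^2,\ \|c+e^*\|^2\right)\le M\left(\lambda_n^{-1/2}+\|U_A-U_{\mathbb E[A]}\|\right).$$ (2) If the rows of $U_A$ are orthonormal eigenvectors of $A$ for its two largest eigenvalues, then for every maximizer $e^*$ of $Q_A$ over $\mathcal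 E_{U_A}$ the fraction of mis-clustered nodes, up to interchanging the two communities, is at most $M/\sqrt{\lambda_n}$. -/

import Mathlib

open MeasureTheory ProbabilityTheory Filter

noncomputable section

namespace SBM

/-- The number of nodes in community 1: `n π₁`, rounded down if it is not an integer. -/
def size₁ (π₁ : ℝ) (n : ℕ) : ℕ := ⌊π₁ * n⌋₊

/-- The true label vector `c ∈ {-1, 1}ⁿ`: the first `n π₁` nodes are in community 1 (label `1`),
the others in community 2 (label `-1`). -/
def trueLabel (π₁ : ℝ) (n : ℕ) : Fin n → ℝ :=
  fun i => if (i : ℕ) < size₁ π₁ n then 1 else -1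

/-- The probability of an edge between `i ≠ j`: the entry of `(lam / n) * !![1, r; r, ω]`
that belongs to the communities of `i` and `j`. -/
def edgeProb (π₁ r ω lam : ℝ) (n : ℕ) (i j : Fin n) : ℝ :=
  lam / n *
    (if (i : ℕ) < size₁ π₁ n then (if (j : ℕ) < size₁ π₁ n then 1 else r)
      else (if (j : ℕ) < size₁ π₁ n then r else ω))

/-- `A` is the adjacency matrix of a two-community stochastic block model: a symmetric random
`0/1` matrix whose entries on and below the diagonal are independent, with
`P (A i j = 1) = edgeProb i j` for `i ≠ j`. With `loops = true` this also holds on the diagonal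
(so that `E[A]` is exactly a two-by-two block matrix); with `loops = false` there are no
self-loops, `A i i = 0` almost surely. -/
structure IsAdjacency (π₁ r ω lam : ℝ) (loops : Bool) {n : ℕ} {Ω : Type*} [MeasurableSpace Ω]
    (μ : Measure Ω) (A : Ω → Matrix (Fin n) (Fin n) ℝ) : Prop where
  measurable : ∀ i j, Measurable fun x => A x i j
  zero_or_one : ∀ x i j, A x i j = 0 ∨ A x i j = 1
  symm : ∀ x i j, A x i j = A x j i
  indep : iIndepFun (fun (p : {p : Fin n × Fin n // p.2 ≤ p.1}) (x : Ω) => A x p.1.1 p.1.2) μ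
  prob : ∀ i j, μ.real {x | A x i j = 1} =
    if i = j ∧ loops = false then 0 else edgeProb π₁ r ω lam n i j

/-- The entrywise expectation `E[A]` of a random matrix. -/
def expectation {n : ℕ} {Ω : Type*} [MeasurableSpace Ω]
    (μ : Measure Ω) (A : Ω → Matrix (Fin n) (Fin n) ℝ) : Matrix (Fin n) (Fin n) ℝ :=
  Matrix.of fun i j => ∫ x, A x i j ∂μ

/-- The rows of the `2 × n` matrix `U` are two leading eigenvectors of the symmetric matrix `B`:
orthonormal eigenvectors that belong to the two largest eigenvalues, counted with multiplicity
(every eigenvector orthogonal to both rows has an eigenvalue which is at most that of each row). -/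
def IsLeading {n : ℕ} (B : Matrix (Fin n) (Fin n) ℝ) (U : Matrix (Fin 2) (Fin n) ℝ) : Prop :=
  (∀ k l, U k ⬝ᵥ U l = if k = l then 1 else 0) ∧
  ∃ ρ : Fin 2 → ℝ, (∀ k, B.mulVec (U k) = ρ k • U k) ∧
    ∀ (w : Fin n → ℝ) (ν : ℝ), w ≠ 0 → B.mulVec w = ν • w → (∀ k, U k ⬝ᵥ w = 0) →
      ∀ k, ν ≤ ρ k

open scoped Matrix.Norms.L2Operator in
/-- The spectral norm of a matrix. -/
def specNorm {m n : ℕ} (X : Matrix (Fin m) (Fin n) ℝ) : ℝ := ‖X‖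

/-- `O₁₁(e)`, twice the number of edges within community 1 of the labelling `e`. -/
def O₁₁ {n : ℕ} (A : Matrix (Fin n) (Fin n) ℝ) (e : Fin n → ℝ) : ℝ :=
  1 / 4 * ((1 + e) ⬝ᵥ A.mulVec (1 + e))

/-- `O₂₂(e)`, twice the number of edges within community 2 of the labelling `e`. -/
def O₂₂ {n : ℕ} (A : Matrix (Fin n) (Fin n) ℝ) (e : Fin n → ℝ) : ℝ :=
  1 / 4 * ((1 - e) ⬝ᵥ A.mulVec (1 - e))

/-- `O₁₂(e)`, the number of edges between the communities of the labelling `e`. -/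
def O₁₂ {n : ℕ} (A : Matrix (Fin n) (Fin n) ℝ) (e : Fin n → ℝ) : ℝ :=
  1 / 4 * ((1 + e) ⬝ᵥ A.mulVec (1 - e))

/-- The sum of the degrees in community 1. -/
def O₁ {n : ℕ} (A : Matrix (Fin n) (Fin n) ℝ) (e : Fin n → ℝ) : ℝ := O₁₁ A e + O₁₂ A e

/-- The sum of the degrees in community 2. -/
def O₂ {n : ℕ} (A : Matrix (Fin n) (Fin n) ℝ) (e : Fin n → ℝ) : ℝ := O₂₂ A e + O₁₂ A e

/-- The Newman–Girvan modularity (up to a factor that does not depend on `e`). -/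
def modularity {n : ℕ} (A : Matrix (Fin n) (Fin n) ℝ) (e : Fin n → ℝ) : ℝ :=
  O₁₁ A e + O₂₂ A e - (O₁ A e ^ 2 + O₂ A e ^ 2) / (O₁ A e + O₂ A e)

/-- The projected cube `U [-1, 1]ⁿ`. -/
def projCube {n : ℕ} (U : Matrix (Fin 2) (Fin n) ℝ) : Set (Fin 2 → ℝ) :=
  (fun x : Fin n → ℝ => U.mulVec x) '' Set.Icc (-1) 1

/-- The label vectors `e ∈ {-1, 1}ⁿ` that correspond to extreme points of `U [-1, 1]ⁿ`. -/
def extremeLabels {n : ℕ} (U : Matrix (Fin 2) (Fin n) ℝ) : Set (Fin n → ℝ) :=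
  {e | (∀ i, e i = 1 ∨ e i = -1) ∧ U.mulVec e ∈ (projCube U).extremePoints ℝ}

/-- `e` is an output of the algorithm: it maximizes the modularity of `A` over the label vectors
that correspond to extreme points of `U [-1, 1]ⁿ`. -/
def IsOutput {n : ℕ} (A : Matrix (Fin n) (Fin n) ℝ) (U : Matrix (Fin 2) (Fin n) ℝ)
    (e : Fin n → ℝ) : Prop :=
  e ∈ extremeLabels U ∧ ∀ e' ∈ extremeLabels U, modularity A e' ≤ modularity A e

/-- The squared Euclidean distance `‖c - e‖²`, where `c` is taken up to a global sign
(the two communities are interchangeable). -/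
def sqDist {n : ℕ} (c e : Fin n → ℝ) : ℝ :=
  min (∑ i, (c i - e i) ^ 2) (∑ i, (-c i - e i) ^ 2)

/-- The fraction of nodes that `e` mis-clusters, up to interchanging the two communities. -/
def misclustered {n : ℕ} (c e : Fin n → ℝ) : ℝ :=
  min ({i | e i ≠ c i}.ncard : ℝ) ({i | e i ≠ -c i}.ncard : ℝ) / n

end SBM

end

/-! ### Symmetric Bernoulli matrices: exponential moments. -/

namespace SBM

/-! Let P be the block matrix of edge probabilities (`blockMatrix`); E[A] differs from it at most on
the diagonal. Three facts about A - E[A] suffice, each with failure probability O(1/n), which is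
below n^(-δ) for large n because δ < 1.

Modularity: Q equals 2 (O₁₁ O₂₂ - O₁₂²) / (O₁ + O₂), whose numerator is a Gram determinant. For P it
is therefore a positive multiple, of order n λ, of the square of one linear functional, the
`contrast`: half the difference of the averages of e over the two communities
(`modularity_blockMatrix`). The contrast is 1 at c, and 1 - contrast² controls the distance to ±c
(`sqDist_trueLabel_le`). The first fact is that all sums of A - E[A] over squares s × s are O(n √λ),
by a union bound over the 2ⁿ sets s. Since Q is Lipschitz in these sums, Q_A and Q_P differ by a
relative error of order λ^(-1/2).

Extreme labels: a linear functional q ∘ U on the cube attains its maximum at an extreme label. If q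
∘ U is within ε of the contrast on label vectors, this label has contrast at least 1 - 2ε, and the
modularity maximizer is nearly as good (`sqDist_le_of_isOutput`). It remains to find q.

For (1), the leading eigenvectors V of E[A] are orthonormal and constant on the communities, so the
contrast is exactly q ∘ V with |q| = O(n^(-1/2)); passing from V to an arbitrary U costs O(‖U - V‖).

For (2), the indicators of the communities must almost lie in the span of the rows of U. No
two-sided bound ‖A - E[A]‖ = O(√λ) is needed. The rate comes from the second fact: A - P maps each
indicator to a vector of norm O(√(n λ)), by fourth moments and Chebyshev. The gap is one-sided: the
third eigenvalue of A is at most a small multiple of λ. It follows from the third fact, v · (A -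
E[A]) v ≤ ε λ |v|² for all v (`eventually_measureReal_quadForm_le`), valid for every a > 0. To prove
that, v is rounded to an integer vector z. Pairs with small |z i z j| are handled by a Bernstein
bound over all z; the remaining pairs form a graph that can be peeled vertex by vertex, because
degrees are O(λ) and small subgraphs are sparse. -/

/-- The index set of the independent entries of a symmetric matrix: on and below the diagonal. -/
abbrev LowerPair (n : ℕ) := {p : Fin n × Fin n // p.2 ≤ p.1}

/-- A random symmetric `0/1` matrix whose entries on and below the diagonal are independent,
with entrywise means at most `ρ`. -/
structure IsBernoulli {n : ℕ} {Ω : Type*} [MeasurableSpace Ω]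
    (μ : Measure Ω) (A : Ω → Matrix (Fin n) (Fin n) ℝ) (ρ : ℝ) : Prop where
  measurable : ∀ i j, Measurable fun x => A x i j
  zero_or_one : ∀ x i j, A x i j = 0 ∨ A x i j = 1
  symm : ∀ x i j, A x i j = A x j i
  indep : iIndepFun (fun (p : LowerPair n) (x : Ω) => A x p.1.1 p.1.2) μ
  mean_le : ∀ i j, expectation μ A i j ≤ ρ

variable {n : ℕ} {Ω : Type*} [MeasurableSpace Ω] {μ : Measure Ω}
  {A : Ω → Matrix (Fin n) (Fin n) ℝ} {ρ : ℝ}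

namespace IsBernoulli

lemma nonneg (h : IsBernoulli μ A ρ) (x : Ω) (i j : Fin n) : 0 ≤ A x i j := by
  rcases h.zero_or_one x i j with h | h <;> simp [h]

lemma le_one (h : IsBernoulli μ A ρ) (x : Ω) (i j : Fin n) : A x i j ≤ 1 := by
  rcases h.zero_or_one x i j with h | h <;> simp [h]

lemma mean_nonneg (h : IsBernoulli μ A ρ) (i j : Fin n) : 0 ≤ expectation μ A i j :=
  integral_nonneg fun x => h.nonneg x i j

lemma mean_symm (h : IsBernoulli μ A ρ) (i j : Fin n) :
    expectation μ A i j = expectation μ A j i := by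
  simp only [expectation, Matrix.of_apply]
  exact integral_congr_ae (ae_of_all _ fun x => h.symm x i j)

variable [IsProbabilityMeasure μ]

lemma integrable (h : IsBernoulli μ A ρ) (i j : Fin n) : Integrable (fun x => A x i j) μ :=
  Integrable.of_bound (h.measurable i j).aestronglyMeasurable 1
    (ae_of_all _ fun x => by
      rw [Real.norm_eq_abs, abs_of_nonneg (h.nonneg x i j)]; exact h.le_one x i j)

lemma mean_le_one (h : IsBernoulli μ A ρ) (i j : Fin n) : expectation μ A i j ≤ 1 := by
  simp only [expectation, Matrix.of_apply]
  calc ∫ x, A x i j ∂μ ≤ ∫ _, (1 : ℝ) ∂μ :=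
        integral_mono (h.integrable i j) (integrable_const _) fun x => h.le_one x i j
    _ = 1 := by simp

/-- On {0, 1} the exponential is affine, exp (c a) = 1 + a (exp c - 1), so only the mean enters;
then 1 + x ≤ exp x. -/
lemma integral_exp_mul (h : IsBernoulli μ A ρ) (i j : Fin n) (c : ℝ) :
    ∫ x, Real.exp (c * A x i j) ∂μ ≤ Real.exp (expectation μ A i j * (Real.exp c - 1)) := by
  have h1 : ∀ x, Real.exp (c * A x i j) = 1 + A x i j * (Real.exp c - 1) := fun x => by
    rcases h.zero_or_one x i j with h | h <;> simp [h]
  simp_rw [h1]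
  rw [integral_add (integrable_const _) ((h.integrable i j).mul_const _), integral_mul_const]
  simp only [integral_const, probReal_univ, smul_eq_mul, mul_one]
  have := Real.add_one_le_exp (expectation μ A i j * (Real.exp c - 1))
  simp only [expectation, Matrix.of_apply] at this ⊢
  linarith

omit [IsProbabilityMeasure μ] in
lemma measurable_sum (h : IsBernoulli μ A ρ) (c : LowerPair n → ℝ) :
    Measurable fun x => ∑ p, c p * A x p.1.1 p.1.2 :=
  Finset.measurable_sum _ fun p _ => (h.measurable p.1.1 p.1.2).const_mul _

omit [IsProbabilityMeasure μ] in
lemma abs_sum_le (h : IsBernoulli μ A ρ) (c : LowerPair n → ℝ) (x : Ω) :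
    |∑ p, c p * A x p.1.1 p.1.2| ≤ ∑ p, |c p| := by
  refine (Finset.abs_sum_le_sum_abs _ _).trans (Finset.sum_le_sum fun p _ => ?_)
  rw [abs_mul, abs_of_nonneg (h.nonneg x _ _)]
  exact mul_le_of_le_one_right (abs_nonneg _) (h.le_one x _ _)

/-- The exponential moment of a linear combination of the independent entries. -/
lemma integral_exp_sum (h : IsBernoulli μ A ρ) (c : LowerPair n → ℝ) :
    ∫ x, Real.exp (∑ p, c p * A x p.1.1 p.1.2) ∂μ ≤
      Real.exp (∑ p, expectation μ A p.1.1 p.1.2 * (Real.exp (c p) - 1)) := by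
  simp_rw [Real.exp_sum]
  rw [h.indep.integral_fun_prod_comp (f := fun p a => Real.exp (c p * a))
    (fun p => (h.measurable _ _).aemeasurable)
    (fun p => (by fun_prop : Measurable fun a : ℝ => Real.exp (c p * a)).aestronglyMeasurable)]
  exact Finset.prod_le_prod (fun p _ => integral_nonneg fun x => (Real.exp_pos _).le)
    fun p _ => h.integral_exp_mul _ _ _

lemma integrable_exp_sum (h : IsBernoulli μ A ρ) (c : LowerPair n → ℝ) (b : ℝ) :
    Integrable (fun x => Real.exp (∑ p, c p * A x p.1.1 p.1.2 - b)) μ := by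
  refine Integrable.of_bound
    (Real.measurable_exp.comp ((h.measurable_sum c).sub_const _)).aestronglyMeasurable
    (Real.exp (∑ p, |c p| - b)) (ae_of_all _ fun x => ?_)
  rw [Real.norm_eq_abs, Real.abs_exp, Real.exp_le_exp]
  linarith [le_of_abs_le (h.abs_sum_le c x)]

/-- Exponential moments of a centred linear combination with small coefficients. -/
lemma integral_exp_centered (h : IsBernoulli μ A ρ) (c : LowerPair n → ℝ)
    (hc : ∀ p, |c p| ≤ 1) :
    ∫ x, Real.exp (∑ p, c p * (A x p.1.1 p.1.2 - expectation μ A p.1.1 p.1.2)) ∂μ ≤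
      Real.exp (ρ * ∑ p, c p ^ 2) := by
  have h1 : ∀ x, Real.exp (∑ p, c p * (A x p.1.1 p.1.2 - expectation μ A p.1.1 p.1.2)) =
      Real.exp (∑ p, c p * A x p.1.1 p.1.2) *
        Real.exp (-∑ p, c p * expectation μ A p.1.1 p.1.2) := fun x => by
    rw [← Real.exp_add]; congr 1; simp only [mul_sub, Finset.sum_sub_distrib]; ring
  simp_rw [h1]
  rw [integral_mul_const]
  refine (mul_le_mul_of_nonneg_right (h.integral_exp_sum c) (Real.exp_pos _).le).trans ?_
  rw [← Real.exp_add, Real.exp_le_exp, Finset.mul_sum, ← sub_eq_add_neg,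
    ← Finset.sum_sub_distrib]
  refine Finset.sum_le_sum fun p _ => ?_
  -- Centring cancels the linear term, and exp c - 1 - c ≤ c² for |c| ≤ 1 leaves a variance bound.
  have h2 := le_of_abs_le (Real.abs_exp_sub_one_sub_id_le (hc p))
  have h3 := h.mean_nonneg p.1.1 p.1.2
  calc _ = expectation μ A p.1.1 p.1.2 * (Real.exp (c p) - 1 - c p) := by ring
    _ ≤ expectation μ A p.1.1 p.1.2 * c p ^ 2 := by gcongr
    _ ≤ _ := by gcongr; exact h.mean_le _ _

omit [IsProbabilityMeasure μ] in
/-- Markov's inequality for an exponential. -/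
lemma _root_.SBM.measureReal_le_exp [IsFiniteMeasure μ] {f : Ω → ℝ} {B : ℝ}
    (hf : Integrable (fun x => Real.exp (f x)) μ) (hB : ∫ x, Real.exp (f x) ∂μ ≤ Real.exp B)
    (t : ℝ) : μ.real {x | t ≤ f x} ≤ Real.exp (B - t) := by
  have h1 := measure_ge_le_exp_mul_mgf (μ := μ) (X := f) (t := 1) t zero_le_one (by simpa using hf)
  simp only [mgf, one_mul, neg_mul] at h1
  refine h1.trans ((mul_le_mul_of_nonneg_left hB (Real.exp_pos _).le).trans ?_)
  rw [← Real.exp_add]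
  exact le_of_eq (by congr 1; ring)

omit [IsProbabilityMeasure μ] in
/-- A linear form in the entries of a symmetric matrix, as one in its independent entries. -/
lemma _root_.SBM.sum_mul_eq_sum_lowerPair (w B : Fin n → Fin n → ℝ) (hB : ∀ i j, B i j = B j i) :
    ∑ i, ∑ j, w i j * B i j = ∑ p : LowerPair n,
      (w p.1.1 p.1.2 + if p.1.2 < p.1.1 then w p.1.2 p.1.1 else 0) * B p.1.1 p.1.2 := by
  have h1 : ∀ f : Fin n × Fin n → ℝ, ∑ p : LowerPair n, f p.1 =
      ∑ i, ∑ j, if j ≤ i then f (i, j) else 0 := fun f => by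
    rw [← Fintype.sum_prod_type' (f := fun i j => if j ≤ i then f (i, j) else 0),
      ← Finset.sum_filter]
    exact (Finset.sum_subtype _ (by simp) f).symm
  rw [h1 fun p => (w p.1 p.2 + if p.2 < p.1 then w p.2 p.1 else 0) * B p.1 p.2]
  have h2 : ∑ i, ∑ j, w i j * B i j = ∑ i, ∑ j, (if j ≤ i then w i j * B i j else 0) +
      ∑ i, ∑ j, (if j < i then w j i * B i j else 0) := by
    rw [Finset.sum_comm (f := fun i j => if j < i then w j i * B i j else 0),
      ← Finset.sum_add_distrib]
    refine Finset.sum_congr rfl fun i _ => ?_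
    rw [← Finset.sum_add_distrib]
    refine Finset.sum_congr rfl fun j _ => ?_
    rcases le_or_gt j i with hij | hij
    · simp [hij, not_lt.2 hij]
    · simp [hij, not_le.2 hij, hB i j]
  rw [h2, ← Finset.sum_add_distrib]
  refine Finset.sum_congr rfl fun i _ => ?_
  rw [← Finset.sum_add_distrib]
  refine Finset.sum_congr rfl fun j _ => ?_
  by_cases h3 : j < i
  · simp [h3, h3.le]; ring
  · by_cases h4 : j ≤ i <;> simp [h3, h4]

end IsBernoulli
end SBM

/-! ### Tail bounds for linear forms, and the cut norm. -/

namespace SBM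

variable {n : ℕ} {Ω : Type*} [MeasurableSpace Ω] {μ : Measure Ω}
  {A : Ω → Matrix (Fin n) (Fin n) ℝ} {ρ : ℝ} [IsProbabilityMeasure μ]

namespace IsBernoulli

lemma integrable_exp_centered (h : IsBernoulli μ A ρ) (c : LowerPair n → ℝ) :
    Integrable (fun x => Real.exp
      (∑ p, c p * (A x p.1.1 p.1.2 - expectation μ A p.1.1 p.1.2))) μ := by
  simpa [mul_sub, Finset.sum_sub_distrib] using
    h.integrable_exp_sum c (∑ p, c p * expectation μ A p.1.1 p.1.2)

/-- A Bernstein-type tail bound for linear forms in the centred matrix. -/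
lemma measureReal_centered_le (h : IsBernoulli μ A ρ) (hρ : 0 ≤ ρ) (w : Fin n → Fin n → ℝ)
    (hw : ∀ i j, |w i j| ≤ 1 / 2) (t : ℝ) :
    μ.real {x | t ≤ ∑ i, ∑ j, w i j * (A x i j - expectation μ A i j)} ≤
      Real.exp (2 * ρ * (∑ i, ∑ j, w i j ^ 2) - t) := by
  set c : LowerPair n → ℝ :=
    fun p => w p.1.1 p.1.2 + if p.1.2 < p.1.1 then w p.1.2 p.1.1 else 0 with hc
  have h1 : ∀ x, ∑ i, ∑ j, w i j * (A x i j - expectation μ A i j) =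
      ∑ p, c p * (A x p.1.1 p.1.2 - expectation μ A p.1.1 p.1.2) := fun x =>
    sum_mul_eq_sum_lowerPair w (fun i j => A x i j - expectation μ A i j)
      fun i j => by rw [h.symm x i j, h.mean_symm i j]
  simp_rw [h1]
  refine (measureReal_le_exp (h.integrable_exp_centered c)
    (h.integral_exp_centered c fun p => ?_) t).trans ?_
  -- An independent entry off the diagonal carries `w i j + w j i`: weights up to 1/2 keep this
  -- within [-1, 1], and (x + y)² ≤ 2 (x² + y²) produces the factor 2 in the exponent.
  · have h2 := abs_le.1 (hw p.1.1 p.1.2)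
    have h3 := abs_le.1 (hw p.1.2 p.1.1)
    simp only [hc]
    split_ifs <;> exact abs_le.2 ⟨by linarith, by linarith⟩
  · rw [Real.exp_le_exp]
    have h2 := sum_mul_eq_sum_lowerPair (fun i j => w i j ^ 2) (fun _ _ => 1) fun _ _ => rfl
    simp only [mul_one] at h2
    rw [h2, mul_comm 2 ρ, mul_assoc, Finset.mul_sum _ _ (2 : ℝ)]
    gcongr with p
    simp only [hc]
    split_ifs
    · nlinarith [sq_nonneg (w p.1.1 p.1.2 - w p.1.2 p.1.1)]
    · nlinarith [sq_nonneg (w p.1.1 p.1.2)]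

/-- A Chernoff bound for nonnegative linear forms in the matrix. -/
lemma measureReal_sum_le (h : IsBernoulli μ A ρ) (w : Fin n → Fin n → ℝ)
    {θ : ℝ} (hw0 : ∀ i j, 0 ≤ w i j) (hw : ∀ i j, w i j ≤ θ) (t : ℝ) :
    μ.real {x | t ≤ ∑ i, ∑ j, w i j * A x i j} ≤
      Real.exp (ρ * Real.exp (2 * θ) * (∑ i, ∑ j, w i j) - t) := by
  set c : LowerPair n → ℝ :=
    fun p => w p.1.1 p.1.2 + if p.1.2 < p.1.1 then w p.1.2 p.1.1 else 0 with hc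
  have h1 : ∀ x, ∑ i, ∑ j, w i j * A x i j = ∑ p, c p * A x p.1.1 p.1.2 := fun x =>
    sum_mul_eq_sum_lowerPair w (A x) (h.symm x)
  simp_rw [h1]
  have hc0 : ∀ p, 0 ≤ c p := fun p => by
    simp only [hc]; split_ifs <;> linarith [hw0 p.1.1 p.1.2, hw0 p.1.2 p.1.1]
  have hcθ : ∀ p, c p ≤ 2 * θ := fun p => by
    simp only [hc]
    split_ifs <;> linarith [hw0 p.1.1 p.1.2, hw p.1.1 p.1.2, hw p.1.2 p.1.1]
  refine (measureReal_le_exp (by simpa using h.integrable_exp_sum c 0)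
    (h.integral_exp_sum c) t).trans ?_
  have h2 := sum_mul_eq_sum_lowerPair w (fun _ _ => 1) fun _ _ => rfl
  simp only [mul_one] at h2
  rw [Real.exp_le_exp, h2, Finset.mul_sum]
  refine sub_le_sub_right (Finset.sum_le_sum fun p _ => ?_) t
  -- A linear bound that does not require small coefficients, so the tilt may be a large constant.
  have h3 : Real.exp (c p) - 1 ≤ Real.exp (2 * θ) * c p := by
    have h4 := Real.add_one_le_exp (-c p)
    have h5 : Real.exp (c p) * Real.exp (-c p) = 1 := by rw [← Real.exp_add]; simp
    have h6 : Real.exp (c p) - 1 ≤ Real.exp (c p) * c p := by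
      nlinarith [Real.exp_pos (c p)]
    exact h6.trans (mul_le_mul_of_nonneg_right (Real.exp_le_exp.2 (hcθ p)) (hc0 p))
  calc _ ≤ expectation μ A p.1.1 p.1.2 * (Real.exp (2 * θ) * c p) := by
        gcongr; exact h.mean_nonneg _ _
    _ ≤ ρ * (Real.exp (2 * θ) * c p) := by
        gcongr
        · exact mul_nonneg (Real.exp_pos _).le (hc0 p)
        · exact h.mean_le _ _
    _ = _ := by ring

/-- With high probability all the quadratic forms of the centred matrix at `0/1` vectors are
of order `n √lam`. -/
lemma measureReal_cut_le (h : IsBernoulli μ A ρ) {C lam : ℝ} (hlam : 1 ≤ lam)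
    (hC : 0 ≤ C) (hn : 0 < n) (hρ : ρ = C * lam / n) :
    μ.real {x | ∃ s : Finset (Fin n), (C + 4) * (n * √lam) ≤
        |∑ i ∈ s, ∑ j ∈ s, (A x i j - expectation μ A i j)|} ≤ 2 * Real.exp (-n) := by
  have hl : 0 < √lam := Real.sqrt_pos.2 (by linarith)
  have hl1 : 1 ≤ √lam := Real.one_le_sqrt.2 hlam
  have hn' : (0 : ℝ) < n := by exact_mod_cast hn
  have key : ∀ (s : Finset (Fin n)) (σ : ℝ), |σ| = 1 →
      μ.real {x | (C + 4) * (n * √lam) ≤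
        σ * ∑ i ∈ s, ∑ j ∈ s, (A x i j - expectation μ A i j)} ≤ Real.exp (-(2 * n)) := by
    intro s σ hσ
    have hσ2 : σ ^ 2 = 1 := by rw [← sq_abs, hσ]; norm_num
    -- At this tilt the variance term is at most C n / 2 and the threshold is (C + 4) n / 2; the
    -- remaining exp (-2 n) beats the 2ⁿ sets.
    set θ : ℝ := 1 / (2 * √lam) with hθ
    have hθ0 : 0 < θ := by positivity
    have hθ1 : θ ≤ 1 / 2 := by rw [hθ]; gcongr; linarith
    set w : Fin n → Fin n → ℝ := fun i j => if i ∈ s ∧ j ∈ s then σ * θ else 0 with hw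
    have h1 := h.measureReal_centered_le (by rw [hρ]; positivity) w (fun i j => by
      simp only [hw]; split_ifs
      · rw [abs_mul, hσ, one_mul, abs_of_pos hθ0]; exact hθ1
      · simp) (θ * ((C + 4) * (n * √lam)))
    have h2 : ∀ x, ∑ i, ∑ j, w i j * (A x i j - expectation μ A i j) =
        θ * (σ * ∑ i ∈ s, ∑ j ∈ s, (A x i j - expectation μ A i j)) := fun x => by
      rw [← Finset.sum_filter_add_sum_filter_not Finset.univ (· ∈ s),
        Finset.sum_eq_zero (s := Finset.univ.filter (· ∉ s))]
      · simp only [Finset.filter_univ_mem, add_zero, Finset.mul_sum]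
        refine Finset.sum_congr rfl fun i hi => ?_
        rw [← Finset.sum_filter_add_sum_filter_not Finset.univ (· ∈ s),
          Finset.sum_eq_zero (s := Finset.univ.filter (· ∉ s))]
        · simp only [Finset.filter_univ_mem, add_zero]
          refine Finset.sum_congr rfl fun j hj => ?_
          simp only [hw, hi, hj, and_self, if_true]; ring
        · intro j hj
          simp only [Finset.mem_filter] at hj
          simp [hw, hj.2]
      · intro i hi
        simp only [Finset.mem_filter] at hi
        simp [hw, hi.2]
    have h3 : ∑ i, ∑ j, w i j ^ 2 ≤ n ^ 2 * θ ^ 2 := by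
      calc ∑ i, ∑ j, w i j ^ 2 ≤ ∑ _i : Fin n, ∑ _j : Fin n, θ ^ 2 := by
            refine Finset.sum_le_sum fun i _ => Finset.sum_le_sum fun j _ => ?_
            simp only [hw]; split_ifs
            · rw [mul_pow, hσ2, one_mul]
            · simp [sq_nonneg]
        _ = n ^ 2 * θ ^ 2 := by simp; ring
    refine le_trans (measureReal_mono fun x hx => ?_) (h1.trans ?_)
    · simp only [Set.mem_ofPred_eq] at hx ⊢
      rw [h2]; gcongr
    · rw [Real.exp_le_exp]
      have h4 : 2 * ρ * (∑ i, ∑ j, w i j ^ 2) ≤ 2 * ρ * (n ^ 2 * θ ^ 2) := by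
        have : 0 ≤ ρ := by rw [hρ]; positivity
        gcongr
      have h5 : 2 * ρ * (n ^ 2 * θ ^ 2) = C * n / 2 := by
        rw [hρ, hθ, div_pow, mul_pow, Real.sq_sqrt (by linarith)]; field_simp
      have h6 : θ * ((C + 4) * (n * √lam)) = (C + 4) * n / 2 := by
        rw [hθ]; field_simp
      rw [h6]; linarith
  have hsub : {x | ∃ s : Finset (Fin n), (C + 4) * (n * √lam) ≤
        |∑ i ∈ s, ∑ j ∈ s, (A x i j - expectation μ A i j)|} ⊆
      ⋃ s ∈ (Finset.univ : Finset (Finset (Fin n))), ({x | (C + 4) * (n * √lam) ≤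
        1 * ∑ i ∈ s, ∑ j ∈ s, (A x i j - expectation μ A i j)} ∪
        {x | (C + 4) * (n * √lam) ≤
        -1 * ∑ i ∈ s, ∑ j ∈ s, (A x i j - expectation μ A i j)}) := by
    rintro x ⟨s, hs⟩
    simp only [Set.mem_iUnion]
    refine ⟨s, Finset.mem_univ _, ?_⟩
    rcases le_abs.1 hs with h | h
    · left; simpa using h
    · right; simpa using h
  refine (measureReal_mono hsub (measure_ne_top _ _)).trans ((measureReal_biUnion_finset_le _ _).trans ?_)
  calc _ ≤ ∑ _s : Finset (Fin n), 2 * Real.exp (-(2 * n)) := by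
        refine Finset.sum_le_sum fun s _ => (measureReal_union_le _ _).trans ?_
        linarith [key s 1 (by norm_num), key s (-1) (by norm_num)]
    _ = 2 * (2 ^ n * Real.exp (-(2 * n))) := by simp; ring
    _ ≤ 2 * (Real.exp n * Real.exp (-(2 * n))) := by
        gcongr
        rw [← Real.exp_one_pow]
        gcongr
        linarith [Real.add_one_le_exp 1]
    _ = 2 * Real.exp (-n) := by rw [← Real.exp_add]; congr 2; ring

end IsBernoulli
end SBM

/-! ### Deterministic tools: integer rounding and the peeling of sparse graphs. -/

namespace SBM

variable {n : ℕ}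

/-- A quadratic form without diagonal terms does not decrease under a suitable rounding
of the coordinates to integers. -/
lemma exists_int_round_quadForm_ge (B : Matrix (Fin n) (Fin n) ℝ) (hB : ∀ i, B i i = 0)
    (x : Fin n → ℝ) :
    ∃ z : Fin n → ℤ, (∀ i, |(z i : ℝ) - x i| ≤ 1) ∧
      x ⬝ᵥ B.mulVec x ≤ (fun i => (z i : ℝ)) ⬝ᵥ B.mulVec (fun i => (z i : ℝ)) := by
  have key : ∀ S : Finset (Fin n), ∃ y : Fin n → ℝ, (∀ i ∈ S, ∃ k : ℤ, y i = k) ∧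
      (∀ i, |y i - x i| ≤ 1) ∧ (∀ i ∉ S, y i = x i) ∧ x ⬝ᵥ B.mulVec x ≤ y ⬝ᵥ B.mulVec y := by
    intro S
    induction S using Finset.induction_on with
    | empty => exact ⟨x, by simp, by simp, by simp, le_rfl⟩
    | insert i S hi ih =>
      obtain ⟨y, h1, h2, h3, h4⟩ := ih
      -- With zero diagonal the form is affine in each single coordinate, so one of the two
      -- neighbouring integers, chosen by the sign of the slope, does not decrease it.
      have hstep : ∀ d : ℝ, (y + d • Pi.single i 1) ⬝ᵥ B.mulVec (y + d • Pi.single i 1) =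
          y ⬝ᵥ B.mulVec y + d * (Pi.single i 1 ⬝ᵥ B.mulVec y + y ⬝ᵥ B.mulVec (Pi.single i 1)) := by
        intro d
        have h5 : (Pi.single i 1 : Fin n → ℝ) ⬝ᵥ B.mulVec (Pi.single i 1) = 0 := by
          simp [Matrix.mulVec_single, hB]
        simp only [Matrix.mulVec_add, Matrix.mulVec_smul, dotProduct_add, add_dotProduct,
          smul_dotProduct, dotProduct_smul, h5, smul_eq_mul]
        ring
      have fin : ∀ (d : ℝ) (k : ℤ), y i + d = k → |d| ≤ 1 →
          0 ≤ d * (Pi.single i 1 ⬝ᵥ B.mulVec y + y ⬝ᵥ B.mulVec (Pi.single i 1)) →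
          ∃ y : Fin n → ℝ, (∀ j ∈ insert i S, ∃ k : ℤ, y j = k) ∧
            (∀ i, |y i - x i| ≤ 1) ∧ (∀ j ∉ insert i S, y j = x j) ∧
            x ⬝ᵥ B.mulVec x ≤ y ⬝ᵥ B.mulVec y := by
        intro d k hk hd hpos
        have hne : ∀ j, j ≠ i → (y + d • Pi.single i 1 : Fin n → ℝ) j = y j := fun j hj => by
          simp [hj]
        have heq : (y + d • Pi.single i 1 : Fin n → ℝ) i = y i + d := by simp
        refine ⟨y + d • Pi.single i 1, fun j hj => ?_, fun j => ?_, fun j hj => ?_, ?_⟩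
        · by_cases hji : j = i
          · exact ⟨k, by rw [hji, heq, hk]⟩
          · rw [hne j hji]; exact h1 j (Finset.mem_of_mem_insert_of_ne hj hji)
        · by_cases hji : j = i
          · rw [hji, heq, h3 i hi]; simpa using hd
          · rw [hne j hji]; exact h2 j
        · rw [Finset.mem_insert, not_or] at hj
          rw [hne j hj.1, h3 j hj.2]
        · rw [hstep]; linarith
      rcases le_total 0 (Pi.single i 1 ⬝ᵥ B.mulVec y + y ⬝ᵥ B.mulVec (Pi.single i 1)) with hs | hs
      · refine fin (⌊y i⌋ + 1 - y i) (⌊y i⌋ + 1) (by push_cast; ring) ?_ ?_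
        · rw [abs_of_nonneg (by linarith [Int.lt_floor_add_one (y i)])]
          linarith [Int.floor_le (y i)]
        · exact mul_nonneg (by linarith [Int.lt_floor_add_one (y i)]) hs
      · refine fin (⌊y i⌋ - y i) ⌊y i⌋ (by ring) ?_ ?_
        · rw [abs_of_nonpos (by linarith [Int.floor_le (y i)])]
          linarith [Int.lt_floor_add_one (y i)]
        · exact mul_nonneg_of_nonpos_of_nonpos (by linarith [Int.floor_le (y i)]) hs
  obtain ⟨y, h1, h2, -, h4⟩ := key Finset.univ
  choose z hz using fun i => h1 i (Finset.mem_univ i)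
  have hyz : y = fun i => (z i : ℝ) := funext hz
  exact ⟨z, fun i => by rw [← hz i]; exact h2 i, by rw [← hyz]; exact h4⟩

/-- If every nonempty vertex set of a weighted graph has a vertex of small inner degree,
then the quadratic form of the graph is controlled by this bound and the degrees. -/
lemma sum_mul_abs_le_of_degenerate {ι : Type*} [DecidableEq ι] (h : ι → ι → ℝ) (z : ι → ℝ)
    (h0 : ∀ i j, 0 ≤ h i j) (hsymm : ∀ i j, h i j = h j i) (hdiag : ∀ i, h i i = 0)
    {K θ : ℝ} (hθ : 0 < θ)
    (hK : ∀ S : Finset ι, S.Nonempty → ∃ v ∈ S, ∑ j ∈ S, h v j ≤ K) (S : Finset ι) :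
    ∑ i ∈ S, ∑ j ∈ S, h i j * (|z i| * |z j|) ≤
      ∑ i ∈ S, z i ^ 2 * (K * θ + (∑ j ∈ S, h i j) / θ) := by
  induction S using Finset.strongInduction with
  | H S ih =>
    rcases S.eq_empty_or_nonempty with rfl | hS
    · simp
    -- Peel off a vertex of small inner degree. By 2 |z v| |z i| ≤ θ z_v² + z_i² / θ, the removed
    -- vertex pays at most K θ z_v², once; the payments z_i² / θ of a vertex that stays add up, over
    -- the whole peeling, to at most its degree times z_i² / θ.
    obtain ⟨v, hv, hvK⟩ := hK S hS
    obtain ⟨T, hvT, rfl⟩ : ∃ T, v ∉ T ∧ S = insert v T :=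
      ⟨S.erase v, Finset.notMem_erase v S, (Finset.insert_erase hv).symm⟩
    have ihT := ih T (Finset.ssubset_insert hvT)
    simp only [Finset.sum_insert hvT, hdiag, zero_mul, zero_add] at hvK ⊢
    rw [Finset.sum_add_distrib]
    have e1 : ∑ i ∈ T, h i v * (|z i| * |z v|) = ∑ i ∈ T, h v i * (|z v| * |z i|) :=
      Finset.sum_congr rfl fun i _ => by rw [hsymm i v]; ring
    have e2 : ∑ i ∈ T, z i ^ 2 * (K * θ + (h i v + ∑ j ∈ T, h i j) / θ) =
        ∑ i ∈ T, z i ^ 2 * (K * θ + (∑ j ∈ T, h i j) / θ) + ∑ i ∈ T, h v i * (z i ^ 2 / θ) := by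
      rw [← Finset.sum_add_distrib]
      exact Finset.sum_congr rfl fun i _ => by rw [hsymm i v]; ring
    have e3 : ∑ i ∈ T, h v i * (|z v| * |z i|) + ∑ i ∈ T, h v i * (|z v| * |z i|) ≤
        (∑ i ∈ T, h v i) * (θ * z v ^ 2) + ∑ i ∈ T, h v i * (z i ^ 2 / θ) := by
      rw [Finset.sum_mul, ← Finset.sum_add_distrib, ← Finset.sum_add_distrib]
      refine Finset.sum_le_sum fun i _ => ?_
      have : 2 * (|z v| * |z i|) ≤ θ * z v ^ 2 + z i ^ 2 / θ := by
        rw [← sq_abs (z v), ← sq_abs (z i)]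
        have e : θ * |z v| ^ 2 + |z i| ^ 2 / θ - 2 * (|z v| * |z i|) =
            (θ * |z v| - |z i|) ^ 2 / θ := by field_simp; ring
        have : 0 ≤ (θ * |z v| - |z i|) ^ 2 / θ := by positivity
        linarith
      nlinarith [mul_le_mul_of_nonneg_left this (h0 v i)]
    have e4 : (∑ i ∈ T, h v i) * (θ * z v ^ 2) ≤ K * (θ * z v ^ 2) := by gcongr
    have e5 : 0 ≤ z v ^ 2 * ((∑ i ∈ T, h v i) / θ) :=
      mul_nonneg (sq_nonneg _) (div_nonneg (Finset.sum_nonneg fun i _ => h0 v i) hθ.le)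
    rw [e1, e2, mul_add]
    nlinarith

/-- The contribution of the heavy pairs, those with `|z i * z j| > T`, to the quadratic form of
a graph with bounded degrees and sparse small subgraphs. -/
lemma sum_heavy_le (A : Matrix (Fin n) (Fin n) ℝ) (hA0 : ∀ i j, 0 ≤ A i j)
    (hsymm : ∀ i j, A i j = A j i) (z : Fin n → ℝ) {R T Δ K s θ : ℝ}
    (hT : 0 < T) (hθ : 0 < θ) (hK : 0 ≤ K) (hΔ : 0 ≤ Δ) (hz : ∑ i, z i ^ 2 ≤ R)
    (hdeg : ∀ i, ∑ j, A i j ≤ Δ)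
    (hsparse : ∀ S : Finset (Fin n), (S.card : ℝ) ≤ s →
      ∑ i ∈ S, ∑ j ∈ S, A i j ≤ K * S.card)
    (hs : 2 * (R / T) * Δ ≤ K * s) :
    ∑ i, ∑ j, (if i ≠ j ∧ T < |z i * z j| then A i j else 0) * (|z i| * |z j|) ≤
      R * (K * θ + Δ / θ) := by
  set h : Fin n → Fin n → ℝ := fun i j => if i ≠ j ∧ T < |z i * z j| then A i j else 0 with hh
  have h0 : ∀ i j, 0 ≤ h i j := fun i j => by simp only [hh]; split_ifs <;> simp [hA0]
  have hle : ∀ i j, h i j ≤ A i j := fun i j => by simp only [hh]; split_ifs <;> simp [hA0]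
  -- Every heavy pair has an endpoint in `H`, which has at most R / T elements; this bounds the
  -- total heavy weight by 2 (R / T) Δ.
  set H : Finset (Fin n) := Finset.univ.filter fun i => T < z i ^ 2 with hH
  have hcard : (H.card : ℝ) ≤ R / T := by
    rw [le_div_iff₀ hT]
    calc (H.card : ℝ) * T = ∑ _i ∈ H, T := by simp
      _ ≤ ∑ i ∈ H, z i ^ 2 := Finset.sum_le_sum fun i hi => (Finset.mem_filter.1 hi).2.le
      _ ≤ ∑ i, z i ^ 2 := Finset.sum_le_sum_of_subset_of_nonneg (Finset.subset_univ _)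
          fun i _ _ => sq_nonneg _
      _ ≤ R := hz
  have hcover : ∀ i j, h i j ≤ (if i ∈ H then A i j else 0) + (if j ∈ H then A i j else 0) := by
    intro i j
    by_cases hij : i ≠ j ∧ T < |z i * z j|
    · have h1 : i ∈ H ∨ j ∈ H := by
        by_contra hcon
        simp only [hH, Finset.mem_filter, Finset.mem_univ, true_and, not_or, not_lt] at hcon
        have h2 := hij.2
        rw [abs_mul] at h2
        rw [← sq_abs (z i), ← sq_abs (z j)] at hcon
        nlinarith [sq_nonneg (|z i| - |z j|)]
      have h2 := hA0 i j
      rcases h1 with h1 | h1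
      · rw [if_pos h1]; refine (hle i j).trans ?_; split_ifs <;> linarith
      · rw [if_pos h1]; refine (hle i j).trans ?_; split_ifs <;> linarith
    · simp only [hh, if_neg hij]
      refine add_nonneg ?_ ?_ <;> split_ifs <;> simp [hA0]
  have htotal : ∑ i, ∑ j, h i j ≤ 2 * (R / T) * Δ := by
    have e1 : ∑ i, ∑ j, (if i ∈ H then A i j else 0) ≤ R / T * Δ := by
      calc ∑ i, ∑ j, (if i ∈ H then A i j else 0) = ∑ i ∈ H, ∑ j, A i j := by
            rw [← Finset.sum_filter_add_sum_filter_not Finset.univ (· ∈ H),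
              Finset.sum_eq_zero (s := Finset.univ.filter (· ∉ H))]
            · simp only [Finset.filter_univ_mem, add_zero]
              exact Finset.sum_congr rfl fun i hi => by simp [hi]
            · intro i hi
              simp [(Finset.mem_filter.1 hi).2]
        _ ≤ ∑ _i ∈ H, Δ := Finset.sum_le_sum fun i _ => hdeg i
        _ = H.card * Δ := by simp
        _ ≤ R / T * Δ := by gcongr
    have e2 : ∑ i, ∑ j, (if j ∈ H then A i j else 0) =
        ∑ i, ∑ j, (if i ∈ H then A i j else 0) := by
      rw [Finset.sum_comm]
      exact Finset.sum_congr rfl fun i _ => Finset.sum_congr rfl fun j _ => by rw [hsymm]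
    calc ∑ i, ∑ j, h i j ≤ ∑ i, ∑ j, ((if i ∈ H then A i j else 0) +
          (if j ∈ H then A i j else 0)) :=
          Finset.sum_le_sum fun i _ => Finset.sum_le_sum fun j _ => hcover i j
      _ ≤ _ := by
          simp only [Finset.sum_add_distrib]
          linarith
  have hsub : ∀ S : Finset (Fin n), ∑ i ∈ S, ∑ j ∈ S, h i j ≤ K * S.card := by
    intro S
    rcases le_or_gt (S.card : ℝ) s with hS | hS
    · exact (Finset.sum_le_sum fun i _ => Finset.sum_le_sum fun j _ => hle i j).trans
        (hsparse S hS)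
    -- For sets too large for the sparsity hypothesis, the total heavy weight is already at most K
    -- s.
    · calc ∑ i ∈ S, ∑ j ∈ S, h i j ≤ ∑ i, ∑ j, h i j := by
            refine (Finset.sum_le_sum fun i _ => Finset.sum_le_sum_of_subset_of_nonneg
              (Finset.subset_univ S) fun j _ _ => h0 i j).trans ?_
            exact Finset.sum_le_sum_of_subset_of_nonneg (Finset.subset_univ S)
              fun i _ _ => Finset.sum_nonneg fun j _ => h0 i j
        _ ≤ K * s := htotal.trans hs
        _ ≤ K * S.card := by gcongr
  have hdegen : ∀ S : Finset (Fin n), S.Nonempty → ∃ v ∈ S, ∑ j ∈ S, h v j ≤ K := by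
    intro S hS
    refine Finset.exists_le_of_sum_le hS ?_
    rw [Finset.sum_const, nsmul_eq_mul, mul_comm]
    exact hsub S
  refine (sum_mul_abs_le_of_degenerate h z h0 (fun i j => ?_) (fun i => by simp [hh]) hθ hdegen
    Finset.univ).trans ?_
  · simp only [hh, ne_comm (a := i), mul_comm (z i), hsymm i j]
  · calc ∑ i, z i ^ 2 * (K * θ + (∑ j, h i j) / θ) ≤ ∑ i, z i ^ 2 * (K * θ + Δ / θ) := by
          gcongr with i
          exact (Finset.sum_le_sum fun j _ => hle i j).trans (hdeg i)
      _ = (∑ i, z i ^ 2) * (K * θ + Δ / θ) := by rw [Finset.sum_mul]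
      _ ≤ _ := by gcongr

end SBM

/-! ### From integer vectors to a one-sided bound on the quadratic form. -/

namespace SBM

variable {n : ℕ}

lemma dotProduct_mulVec_eq_sum (B : Matrix (Fin n) (Fin n) ℝ) (x y : Fin n → ℝ) :
    x ⬝ᵥ B.mulVec y = ∑ i, ∑ j, x i * y j * B i j := by
  simp only [dotProduct, Matrix.mulVec, Finset.mul_sum]
  exact Finset.sum_congr rfl fun i _ => Finset.sum_congr rfl fun j _ => by ring

/-- A one-sided bound for a quadratic form: it suffices to control the light pairs at integer
vectors, the degrees, and the density of small subgraphs. -/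
lemma quadForm_sub_le (A E : Matrix (Fin n) (Fin n) ℝ) {ρ T Δ K s θ L : ℝ} (hn : 0 < n)
    (hA0 : ∀ i j, 0 ≤ A i j) (hA1 : ∀ i j, A i j ≤ 1) (hsymm : ∀ i j, A i j = A j i)
    (hE0 : ∀ i j, 0 ≤ E i j) (hE : ∀ i j, E i j ≤ ρ)
    (hT : 0 < T) (hθ : 0 < θ) (hK : 0 ≤ K) (hΔ : 0 ≤ Δ)
    (hdeg : ∀ i, ∑ j, A i j ≤ Δ)
    (hsparse : ∀ S : Finset (Fin n), (S.card : ℝ) ≤ s →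
      ∑ i ∈ S, ∑ j ∈ S, A i j ≤ K * S.card)
    (hs : 2 * (4 * n / T) * Δ ≤ K * s)
    (hlight : ∀ z : Fin n → ℤ, ∑ i, (z i : ℝ) ^ 2 ≤ 4 * n →
      ∑ i, ∑ j, (if i ≠ j ∧ |(z i : ℝ) * z j| ≤ T then (z i : ℝ) * z j else 0) *
        (A i j - E i j) ≤ L * n) (x : Fin n → ℝ) :
    x ⬝ᵥ (A - E).mulVec x ≤
      (L + 4 * (K * θ + Δ / θ) + 16 * ρ * n / T + 1) * (x ⬝ᵥ x) := by
  have hn' : (0 : ℝ) < n := by exact_mod_cast hn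
  have hρ : 0 ≤ ρ := (hE0 ⟨0, hn⟩ ⟨0, hn⟩).trans (hE _ _)
  -- Rounding needs a zero diagonal. The diagonal of `A - E` is at most 1 and accounts for the `+ 1`
  -- in the final constant.
  set W : Matrix (Fin n) (Fin n) ℝ := Matrix.of fun i j => if i = j then 0 else A i j - E i j
    with hW
  have hint : ∀ z : Fin n → ℤ, ∑ i, (z i : ℝ) ^ 2 ≤ 4 * n →
      (fun i => (z i : ℝ)) ⬝ᵥ W.mulVec (fun i => (z i : ℝ)) ≤
        (L + 4 * (K * θ + Δ / θ) + 16 * ρ * n / T) * n := by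
    intro z hz
    have h1 := hlight z hz
    have h2 := sum_heavy_le A hA0 hsymm (fun i => (z i : ℝ)) hT hθ hK hΔ hz hdeg hsparse hs
    -- The part of `E` on heavy pairs is small deterministically: |z i z j| > T gives |z i z j| ≤ (z
    -- i z j)² / T.
    have h3 : ∑ i, ∑ j, ((z i : ℝ) ^ 2 * (z j : ℝ) ^ 2) * (ρ / T) ≤ 16 * ρ * n / T * n := by
      simp_rw [← Finset.sum_mul, ← Finset.mul_sum]
      rw [← Finset.sum_mul]
      have : (∑ i, (z i : ℝ) ^ 2) * (∑ i, (z i : ℝ) ^ 2) ≤ (4 * n) * (4 * n) := by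
        have : 0 ≤ ∑ i, (z i : ℝ) ^ 2 := Finset.sum_nonneg fun i _ => sq_nonneg _
        gcongr
      calc _ ≤ ((4 * n) * (4 * n)) * (ρ / T) := by gcongr
        _ = _ := by ring
    have h4 : (fun i => (z i : ℝ)) ⬝ᵥ W.mulVec (fun i => (z i : ℝ)) ≤
        ∑ i, ∑ j, (if i ≠ j ∧ |(z i : ℝ) * z j| ≤ T then (z i : ℝ) * z j else 0) *
          (A i j - E i j) +
        ∑ i, ∑ j, (if i ≠ j ∧ T < |(z i : ℝ) * z j| then A i j else 0) *
          (|(z i : ℝ)| * |(z j : ℝ)|) +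
        ∑ i, ∑ j, ((z i : ℝ) ^ 2 * (z j : ℝ) ^ 2) * (ρ / T) := by
      rw [dotProduct_mulVec_eq_sum]
      simp only [← Finset.sum_add_distrib]
      refine Finset.sum_le_sum fun i _ => Finset.sum_le_sum fun j _ => ?_
      have hpos : 0 ≤ ((z i : ℝ) ^ 2 * (z j : ℝ) ^ 2) * (ρ / T) := by positivity
      rcases eq_or_ne i j with hij | hij
      · simp only [hW, Matrix.of_apply, hij, if_true, ne_eq, not_true, false_and, if_false]
        rw [hij] at hpos
        linarith
      rcases le_or_gt |(z i : ℝ) * z j| T with h | h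
      · simp only [hW, Matrix.of_apply, ne_eq, hij, not_false_eq_true, true_and, h,
          if_true, not_lt.2 h, if_false]
        linarith
      · simp only [hW, Matrix.of_apply, ne_eq, hij, not_false_eq_true, true_and, h,
          if_true, not_le.2 h, if_false]
        rw [← abs_mul]
        have e1 : (z i : ℝ) * z j * A i j ≤ A i j * |(z i : ℝ) * z j| := by
          rw [mul_comm]; exact mul_le_mul_of_nonneg_left (le_abs_self _) (hA0 i j)
        have e2 : -((z i : ℝ) * z j * E i j) ≤ |(z i : ℝ) * z j| * ρ := by
          calc -((z i : ℝ) * z j * E i j) = -((z i : ℝ) * z j) * E i j := by ring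
            _ ≤ |(z i : ℝ) * z j| * E i j :=
                mul_le_mul_of_nonneg_right (neg_le_abs _) (hE0 i j)
            _ ≤ _ := mul_le_mul_of_nonneg_left (hE i j) (abs_nonneg _)
        have e3 : |(z i : ℝ) * z j| * ρ ≤ ((z i : ℝ) ^ 2 * (z j : ℝ) ^ 2) * (ρ / T) := by
          rw [← mul_pow, ← sq_abs, ← mul_div_assoc, le_div_iff₀ hT]
          nlinarith [mul_nonneg (abs_nonneg ((z i : ℝ) * z j)) hρ]
        linarith [mul_sub ((z i : ℝ) * z j) (A i j) (E i j)]
    nlinarith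
  have hball : ∀ x : Fin n → ℝ, x ⬝ᵥ x ≤ n → x ⬝ᵥ (A - E).mulVec x ≤
      (L + 4 * (K * θ + Δ / θ) + 16 * ρ * n / T + 1) * n := by
    intro x hx
    obtain ⟨z, hz1, hz2⟩ := exists_int_round_quadForm_ge W (fun i => by simp [hW]) x
    have hx' : ∑ i, x i ^ 2 ≤ n := by simpa [dotProduct, sq] using hx
    -- From |z - x| ≤ 1 follows z² ≤ 2 x² + 2, hence the radius 4 n for the integer vectors.
    have h1 := hint z (by
      calc ∑ i, (z i : ℝ) ^ 2 ≤ ∑ i, (2 * x i ^ 2 + 2) := Finset.sum_le_sum fun i _ => by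
            have := abs_le.1 (hz1 i)
            nlinarith [sq_nonneg ((z i : ℝ) - 2 * x i)]
        _ = 2 * ∑ i, x i ^ 2 + 2 * n := by
            rw [Finset.sum_add_distrib, ← Finset.mul_sum]; simp; ring
        _ ≤ 4 * n := by linarith)
    have h2 : x ⬝ᵥ (A - E).mulVec x ≤ x ⬝ᵥ W.mulVec x + ∑ i, x i ^ 2 := by
      rw [dotProduct_mulVec_eq_sum, dotProduct_mulVec_eq_sum, ← Finset.sum_add_distrib]
      refine Finset.sum_le_sum fun i _ => ?_
      rw [← Finset.add_sum_erase _ _ (Finset.mem_univ i),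
        ← Finset.add_sum_erase (a := i) _ (fun j => x i * x j * W i j) (Finset.mem_univ i)]
      have e1 : ∑ j ∈ Finset.univ.erase i, x i * x j * (A - E) i j =
          ∑ j ∈ Finset.univ.erase i, x i * x j * W i j :=
        Finset.sum_congr rfl fun j hj => by
          simp [hW, (Finset.ne_of_mem_erase hj).symm]
      rw [e1]
      simp only [hW, Matrix.of_apply, if_true, Matrix.sub_apply]
      nlinarith [hA1 i i, hE0 i i, sq_nonneg (x i)]
    linarith
  rcases eq_or_ne x 0 with rfl | hx
  · simp
  have hx0 : 0 < x ⬝ᵥ x := by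
    refine lt_of_le_of_ne (Finset.sum_nonneg fun i _ => mul_self_nonneg _) fun h => hx ?_
    exact dotProduct_self_eq_zero.1 h.symm
  have h1 := hball (√(n / (x ⬝ᵥ x)) • x) (by
    rw [smul_dotProduct, dotProduct_smul, smul_eq_mul, smul_eq_mul, ← mul_assoc,
      Real.mul_self_sqrt (by positivity), div_mul_cancel₀ _ hx0.ne'])
  rw [Matrix.mulVec_smul, smul_dotProduct, dotProduct_smul, smul_eq_mul, smul_eq_mul, ← mul_assoc,
      Real.mul_self_sqrt (by positivity), div_mul_eq_mul_div, div_le_iff₀ hx0] at h1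
  nlinarith

end SBM

/-! ### Degrees, density of small subgraphs, and light pairs. -/

namespace SBM

variable {n : ℕ} {Ω : Type*} [MeasurableSpace Ω] {μ : Measure Ω}
  {A : Ω → Matrix (Fin n) (Fin n) ℝ} {ρ : ℝ} [IsProbabilityMeasure μ]

lemma sum_ite_mem_mul (S T : Finset (Fin n)) (c : ℝ) (B : Fin n → Fin n → ℝ) :
    ∑ i, ∑ j, (if i ∈ S ∧ j ∈ T then c else 0) * B i j = c * ∑ i ∈ S, ∑ j ∈ T, B i j := by
  have h1 : ∀ i j, (if i ∈ S ∧ j ∈ T then c else 0) * B i j =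
      if i ∈ S then (if j ∈ T then c * B i j else 0) else 0 := fun i j => by
    by_cases hi : i ∈ S <;> by_cases hj : j ∈ T <;> simp [hi, hj]
  simp_rw [h1, Finset.mul_sum]
  rw [← Finset.sum_filter_add_sum_filter_not Finset.univ (· ∈ S),
    Finset.sum_eq_zero (s := Finset.univ.filter (· ∉ S))]
  · simp only [Finset.filter_univ_mem, add_zero]
    refine Finset.sum_congr rfl fun i hi => ?_
    simp [hi]
  · intro i hi
    simp [(Finset.mem_filter.1 hi).2]

namespace IsBernoulli

/-- The tilt stays free: 1 is enough for the degrees, while the sparsity of small subgraphs needs a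
constant that depends on the growth of the average degree. -/
lemma measureReal_block_le (h : IsBernoulli μ A ρ) (S T : Finset (Fin n)) {θ : ℝ} (hθ : 0 < θ)
    (t : ℝ) : μ.real {x | t ≤ ∑ i ∈ S, ∑ j ∈ T, A x i j} ≤
      Real.exp (θ * (ρ * Real.exp (2 * θ) * (S.card * T.card) - t)) := by
  have h1 := h.measureReal_sum_le (fun i j => if i ∈ S ∧ j ∈ T then θ else 0) (θ := θ)
    (fun i j => by positivity) (fun i j => by split_ifs <;> linarith) (θ * t)
  have h2 := sum_ite_mem_mul S T θ fun _ _ => 1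
  simp only [mul_one, Finset.sum_const, nsmul_eq_mul] at h2
  have h3 : ∀ x, ∑ i, ∑ j, (if i ∈ S ∧ j ∈ T then θ else 0) * A x i j =
      θ * ∑ i ∈ S, ∑ j ∈ T, A x i j := fun x => sum_ite_mem_mul S T θ (A x)
  simp_rw [h2, h3] at h1
  refine le_trans (measureReal_mono fun x hx => ?_) (h1.trans (le_of_eq ?_))
  · simp only [Set.mem_ofPred_eq] at hx ⊢; gcongr
  · congr 1; ring

lemma measureReal_degree_le (h : IsBernoulli μ A ρ) (Δ : ℝ) :
    μ.real {x | ∃ i, Δ ≤ ∑ j, A x i j} ≤ n * Real.exp (ρ * n * Real.exp 2 - Δ) := by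
  have hsub : {x | ∃ i, Δ ≤ ∑ j, A x i j} ⊆
      ⋃ i : Fin n, {x | Δ ≤ ∑ i ∈ {i}, ∑ j, A x i j} := by
    rintro x ⟨i, hi⟩
    exact Set.mem_iUnion.2 ⟨i, by simpa using hi⟩
  refine (measureReal_mono hsub (measure_ne_top _ _)).trans ((measureReal_iUnion_fintype_le _).trans ?_)
  calc _ ≤ ∑ _i : Fin n, Real.exp (ρ * n * Real.exp 2 - Δ) := by
        refine Finset.sum_le_sum fun i _ =>
          (h.measureReal_block_le {i} Finset.univ one_pos Δ).trans (le_of_eq ?_)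
        simp only [Finset.card_singleton, Finset.card_univ, Fintype.card_fin, Nat.cast_one]
        congr 1; ring_nf
    _ = _ := by simp

/-- A given set of m nodes is dense with probability at most y^m, where y = exp (-θ K / 2); the sum
over nonempty sets is (1 + y)^n - 1, of order n y. The strict inequality in the event excludes the
empty set, for which y^0 = 1 would be useless. -/
lemma measureReal_dense_le (h : IsBernoulli μ A ρ) (hρ : 0 ≤ ρ) {s K θ : ℝ} (hθ : 0 < θ)
    (hs : ρ * Real.exp (2 * θ) * s ≤ K / 2) (hn : n * Real.exp (-(θ * K / 2)) ≤ 1) :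
    μ.real {x | ∃ S : Finset (Fin n), (S.card : ℝ) ≤ s ∧ K * S.card < ∑ i ∈ S, ∑ j ∈ S, A x i j} ≤
      2 * (n * Real.exp (-(θ * K / 2))) := by
  set y := Real.exp (-(θ * K / 2)) with hy
  have hsub : {x | ∃ S : Finset (Fin n), (S.card : ℝ) ≤ s ∧
      K * S.card < ∑ i ∈ S, ∑ j ∈ S, A x i j} ⊆
      ⋃ S ∈ (Finset.univ : Finset (Finset (Fin n))).erase ∅, {x | (S.card : ℝ) ≤ s ∧
        K * S.card ≤ ∑ i ∈ S, ∑ j ∈ S, A x i j} := by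
    rintro x ⟨S, hS, hSK⟩
    simp only [Set.mem_iUnion]
    refine ⟨S, ?_, hS, hSK.le⟩
    simp only [Finset.mem_erase, Finset.mem_univ, and_true]
    rintro rfl
    simp at hSK
  have hone : ∀ S : Finset (Fin n), μ.real {x | (S.card : ℝ) ≤ s ∧
        K * S.card ≤ ∑ i ∈ S, ∑ j ∈ S, A x i j} ≤ y ^ S.card := by
    intro S
    by_cases hS : (S.card : ℝ) ≤ s
    · simp only [hS, true_and]
      refine (h.measureReal_block_le S S hθ _).trans ?_
      rw [hy, ← Real.exp_nat_mul, Real.exp_le_exp]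
      have h1 : ρ * Real.exp (2 * θ) * S.card ≤ K / 2 := by
        refine le_trans ?_ hs; gcongr
      have h2 : (0 : ℝ) ≤ S.card := by positivity
      have h3 := mul_le_mul_of_nonneg_left h1 (mul_nonneg hθ.le h2)
      linarith
    · simp only [hS, false_and, Set.ofPred_false, measureReal_empty]
      positivity
  refine (measureReal_mono hsub (measure_ne_top _ _)).trans
    ((measureReal_biUnion_finset_le _ _).trans ?_)
  have hy0 : 0 < y := Real.exp_pos _
  calc _ ≤ ∑ S ∈ (Finset.univ : Finset (Finset (Fin n))).erase ∅, y ^ S.card :=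
        Finset.sum_le_sum fun S _ => hone S
    _ = (1 + y) ^ n - 1 := by
        have h1 := Finset.add_sum_erase (Finset.univ : Finset (Finset (Fin n)))
          (fun S => y ^ S.card) (Finset.mem_univ ∅)
        have h2 := Fintype.sum_pow_mul_eq_add_pow (Fin n) y 1
        simp only [one_pow, mul_one, Fintype.card_fin] at h2
        simp only [Finset.card_empty, pow_zero] at h1
        rw [h2, add_comm y] at h1
        linarith
    _ ≤ Real.exp (n * y) - 1 := by
        rw [Real.exp_nat_mul]
        gcongr
        linarith [Real.add_one_le_exp y]
    _ ≤ _ := by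
        have := le_of_abs_le (Real.abs_exp_sub_one_sub_id_le
          (x := n * y) (by rw [abs_of_nonneg (by positivity)]; exact hn))
        have h0 : 0 ≤ n * y := by positivity
        nlinarith

-- Comparison with the geometric series of ratio 1/2; subtracting its tail makes the induction
-- close. What matters is the bound 3, uniform in m.
omit [MeasurableSpace Ω] [IsProbabilityMeasure μ] in
lemma _root_.SBM.sum_exp_neg_sq_le (m : ℕ) :
    ∑ k ∈ Finset.Icc (-(m : ℤ)) m, Real.exp (-(k : ℝ) ^ 2) ≤ 3 - 2 * (1 / 2) ^ m := by
  induction m with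
  | zero => norm_num
  | succ m ih =>
    have h1 : Finset.Icc (-((m + 1 : ℕ) : ℤ)) ((m + 1 : ℕ) : ℤ) =
        insert ((m + 1 : ℕ) : ℤ) (insert (-((m + 1 : ℕ) : ℤ)) (Finset.Icc (-(m : ℤ)) m)) := by
      ext k; simp only [Finset.mem_insert, Finset.mem_Icc]; omega
    rw [h1, Finset.sum_insert, Finset.sum_insert]
    · have h2 : Real.exp (-((m : ℝ) + 1) ^ 2) ≤ (1 / 2) ^ (m + 1) := by
        have h3 : (1 / 2 : ℝ) ^ (m + 1) ≥ Real.exp (-1) ^ (m + 1) := by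
          gcongr
          rw [Real.exp_neg, ← one_div]
          gcongr
          linarith [Real.add_one_le_exp 1]
        refine le_trans ?_ h3
        rw [← Real.exp_nat_mul, Real.exp_le_exp]
        push_cast
        nlinarith [(Nat.cast_nonneg m : (0 : ℝ) ≤ m)]
      push_cast
      rw [neg_sq ((m : ℝ) + 1)]
      rw [pow_succ (1 / 2 : ℝ)] at h2 ⊢
      linarith
    · simp
    · simp; omega

/-- With high probability, the light pairs contribute little to the quadratic form at all
integer vectors of a given norm. -/
lemma measureReal_light_le (h : IsBernoulli μ A ρ) (hρ : 0 ≤ ρ) (hn : 0 < n) {T : ℝ}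
    (hT : 0 < T) (hρT : 8 * ρ * n ≤ T ^ 2) :
    μ.real {x | ∃ z : Fin n → ℤ, ∑ i, (z i : ℝ) ^ 2 ≤ 4 * n ∧
      16 * T * n < ∑ i, ∑ j, (if i ≠ j ∧ |(z i : ℝ) * z j| ≤ T then (z i : ℝ) * z j else 0) *
        (A x i j - expectation μ A i j)} ≤ Real.exp (-n) := by
  have hn' : (1 : ℝ) ≤ n := by exact_mod_cast hn
  set F : (Fin n → ℤ) → Ω → ℝ := fun z x =>
    ∑ i, ∑ j, (if i ≠ j ∧ |(z i : ℝ) * z j| ≤ T then (z i : ℝ) * z j else 0) *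
        (A x i j - expectation μ A i j) with hF
  have hone : ∀ z : Fin n → ℤ, ∑ i, (z i : ℝ) ^ 2 ≤ 4 * n →
      μ.real {x | 16 * T * n ≤ F z x} ≤ Real.exp (-(7 * n)) := by
    intro z hz
    set w : Fin n → Fin n → ℝ := fun i j =>
      1 / (2 * T) * (if i ≠ j ∧ |(z i : ℝ) * z j| ≤ T then (z i : ℝ) * z j else 0) with hw
    have h1 := h.measureReal_centered_le hρ w (fun i j => by
      simp only [hw]
      rw [abs_mul, abs_of_pos (by positivity : 0 < 1 / (2 * T))]
      split_ifs with hij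
      · calc 1 / (2 * T) * |(z i : ℝ) * z j| ≤ 1 / (2 * T) * T := by gcongr; exact hij.2
          _ = 1 / 2 := by field_simp
      · simp) (8 * n)
    have h2 : ∑ i, ∑ j, w i j ^ 2 ≤ (1 / (2 * T)) ^ 2 * (16 * n ^ 2) := by
      calc ∑ i, ∑ j, w i j ^ 2 ≤ ∑ i, ∑ j, (1 / (2 * T)) ^ 2 * ((z i : ℝ) ^ 2 * (z j : ℝ) ^ 2) := by
            refine Finset.sum_le_sum fun i _ => Finset.sum_le_sum fun j _ => ?_
            simp only [hw]
            rw [mul_pow, ← mul_pow (z i : ℝ)]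
            refine mul_le_mul_of_nonneg_left ?_ (sq_nonneg _)
            split_ifs
            · exact le_rfl
            · simpa using sq_nonneg ((z i : ℝ) * z j)
        _ = (1 / (2 * T)) ^ 2 * ((∑ i, (z i : ℝ) ^ 2) * (∑ i, (z i : ℝ) ^ 2)) := by
            simp only [← Finset.mul_sum, ← Finset.sum_mul]
        _ ≤ (1 / (2 * T)) ^ 2 * ((4 * n) * (4 * n)) := by
            have : 0 ≤ ∑ i, (z i : ℝ) ^ 2 := Finset.sum_nonneg fun i _ => sq_nonneg _
            gcongr
        _ = _ := by ring
    refine le_trans (measureReal_mono fun x hx => ?_) (h1.trans ?_)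
    · simp only [Set.mem_ofPred_eq] at hx ⊢
      have h3 : ∑ i, ∑ j, w i j * (A x i j - expectation μ A i j) = 1 / (2 * T) * F z x := by
        simp only [hF, hw, Finset.mul_sum, mul_assoc]
      rw [h3]
      calc (8 : ℝ) * n = 1 / (2 * T) * (16 * T * n) := by field_simp; norm_num
        _ ≤ _ := by gcongr
    · rw [Real.exp_le_exp]
      have h4 : 2 * ρ * (∑ i, ∑ j, w i j ^ 2) ≤ n := by
        calc 2 * ρ * (∑ i, ∑ j, w i j ^ 2) ≤ 2 * ρ * ((1 / (2 * T)) ^ 2 * (16 * n ^ 2)) := by gcongr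
          _ = (8 * ρ * n) / T ^ 2 * n := by field_simp; ring
          _ ≤ 1 * n := by gcongr; rw [div_le_one (by positivity)]; exact hρT
          _ = n := one_mul _
      linarith
  -- The box serves only to make the union finite; it contains every admissible z.
  set box : Finset (Fin n → ℤ) :=
    Fintype.piFinset fun _ => Finset.Icc (-((2 * n : ℕ) : ℤ)) ((2 * n : ℕ) : ℤ) with hbox
  have hsub : {x | ∃ z : Fin n → ℤ, ∑ i, (z i : ℝ) ^ 2 ≤ 4 * n ∧ 16 * T * n < F z x} ⊆
      ⋃ z ∈ box.filter fun z => ∑ i, (z i : ℝ) ^ 2 ≤ 4 * n, {x | 16 * T * n ≤ F z x} := by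
    rintro x ⟨z, hz, hzx⟩
    simp only [Set.mem_iUnion]
    refine ⟨z, ?_, hzx.le⟩
    rw [Finset.mem_filter]
    refine ⟨Fintype.mem_piFinset.2 fun i => ?_, hz⟩
    have h1 : (z i : ℝ) ^ 2 ≤ 4 * n :=
      (Finset.single_le_sum (f := fun i => (z i : ℝ) ^ 2) (fun i _ => sq_nonneg _)
        (Finset.mem_univ i)).trans hz
    have h2 : |(z i : ℝ)| ≤ 2 * n := by
      refine abs_le_of_sq_le_sq ?_ (by positivity)
      nlinarith
    have h3 := abs_le.1 h2
    rw [Finset.mem_Icc]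
    constructor
    · have : ((-((2 * n : ℕ) : ℤ) : ℤ) : ℝ) ≤ z i := by push_cast; exact h3.1
      exact_mod_cast this
    · have : ((z i : ℤ) : ℝ) ≤ (((2 * n : ℕ) : ℤ) : ℝ) := by push_cast; exact h3.2
      exact_mod_cast this
  refine (measureReal_mono hsub (measure_ne_top _ _)).trans
    ((measureReal_biUnion_finset_le _ _).trans ?_)
  -- Lattice points are counted with a Gaussian weight: for ∑ z_i² ≤ 4 n, exp (-7 n) is at most exp
  -- (-3 n) ∏ exp (-z_i²), and the sum of the weights factorizes into n one-dimensional sums, each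
  -- at most 3 ≤ exp 2.
  calc _ ≤ ∑ z ∈ box.filter fun z => ∑ i, (z i : ℝ) ^ 2 ≤ 4 * n,
        Real.exp (-(3 * n)) * ∏ i, Real.exp (-(z i : ℝ) ^ 2) := by
        refine Finset.sum_le_sum fun z hz => ?_
        have hz' := (Finset.mem_filter.1 hz).2
        refine (hone z hz').trans ?_
        rw [← Real.exp_sum, ← Real.exp_add, Real.exp_le_exp, Finset.sum_neg_distrib]
        linarith
    _ ≤ ∑ z ∈ box, Real.exp (-(3 * n)) * ∏ i, Real.exp (-(z i : ℝ) ^ 2) :=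
        Finset.sum_le_sum_of_subset_of_nonneg (Finset.filter_subset _ _)
          fun z _ _ => by positivity
    _ = Real.exp (-(3 * n)) *
        (∑ k ∈ Finset.Icc (-((2 * n : ℕ) : ℤ)) ((2 * n : ℕ) : ℤ), Real.exp (-(k : ℝ) ^ 2)) ^ n := by
        rw [← Finset.mul_sum, hbox, Finset.sum_prod_piFinset _ fun _ k => Real.exp (-((k : ℤ) : ℝ) ^ 2)]
        simp
    _ ≤ Real.exp (-(3 * n)) * Real.exp (2 * n) := by
        refine mul_le_mul_of_nonneg_left ?_ (Real.exp_pos _).le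
        rw [mul_comm 2 (n : ℝ), Real.exp_nat_mul]
        gcongr
        refine (sum_exp_neg_sq_le _).trans ?_
        have : (0 : ℝ) ≤ 2 * (1 / 2) ^ (2 * n) := by positivity
        linarith [Real.add_one_le_exp 2]
    _ = _ := by rw [← Real.exp_add]; congr 1; ring

end IsBernoulli
end SBM

/-! ### The upper end of the spectrum of the centred matrix. -/

namespace SBM

lemma eventually_const_le_of_log_le (a Λ : ℝ) (ha : 0 < a) :
    ∀ᶠ n : ℕ in atTop, ∀ lam : ℝ, a * Real.log n ≤ lam → Λ ≤ lam := by
  have h := ((Real.tendsto_log_atTop.comp tendsto_natCast_atTop_atTop).const_mul_atTop ha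
    ).eventually_ge_atTop Λ
  filter_upwards [h] with n hn lam hlam
  exact hn.trans hlam

lemma exp_neg_natCast_le {n : ℕ} (hn : 0 < n) : Real.exp (-n) ≤ 1 / n := by
  rw [Real.exp_neg, ← one_div]
  have : (0 : ℝ) < n := by exact_mod_cast hn
  gcongr
  linarith [Real.add_one_le_exp (n : ℝ)]

/-- Above the connectivity threshold, the top eigenvalue of the centred matrix is at most
a small multiple of the average degree. -/
lemma eventually_measureReal_quadForm_le {C a ε : ℝ} (hC : 0 < C) (ha : 0 < a) (hε : 0 < ε) :
    ∀ᶠ n : ℕ in atTop, ∀ lam : ℝ, a * Real.log n ≤ lam →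
      ∀ (Ω : Type*) [MeasurableSpace Ω] (μ : Measure Ω) [IsProbabilityMeasure μ]
        (A : Ω → Matrix (Fin n) (Fin n) ℝ), IsBernoulli μ A (C * lam / n) →
        μ.real {x | ∃ v : Fin n → ℝ,
          ε * lam * (v ⬝ᵥ v) < v ⬝ᵥ (A x - expectation μ A).mulVec v} ≤ 4 / n := by
  -- The summand 2 / a makes a given degree exceed `C' * lam` with probability at most n^(-2).
  set C' := C * Real.exp 2 + 2 / a with hC'
  have hC'0 : 0 < C' := by positivity
  -- The bound is a sum of four terms, each at most ε lam / 4. Heavy pairs: κ η = C' / η = ε / 32.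
  -- Light pairs: 16 τ = ε / 4. The mean on heavy pairs and the diagonal term 1 need `lam` large.
  set η := 32 * C' / ε with hη
  have hη0 : 0 < η := by positivity
  set κ := ε / (32 * η) with hκ
  have hκ0 : 0 < κ := by positivity
  set τ := ε / 64 with hτ
  have hτ0 : 0 < τ := by positivity
  -- With this tilt θ κ lam / 2 ≥ 2 log n, however small a is; the price is a smaller size σ n of
  -- the subgraphs that are controlled.
  set θ := 4 / (κ * a) with hθ
  have hθ0 : 0 < θ := by positivity
  set σ := κ / (2 * C * Real.exp (2 * θ)) with hσ
  have hσ0 : 0 < σ := by positivity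
  filter_upwards [eventually_const_le_of_log_le a 1 ha,
    eventually_const_le_of_log_le a (64 * C / (ε * τ)) ha,
    eventually_const_le_of_log_le a (4 / ε) ha,
    eventually_const_le_of_log_le a (8 * C / τ ^ 2) ha,
    eventually_const_le_of_log_le a (8 * C' / (τ * κ * σ)) ha,
    eventually_gt_atTop 0] with n h1 h2 h3 h4 h5 hn lam hlam Ω _ μ _ A hA
  replace h1 := h1 lam hlam
  replace h2 := h2 lam hlam
  replace h3 := h3 lam hlam
  replace h4 := h4 lam hlam
  replace h5 := h5 lam hlam
  rw [div_le_iff₀ (by positivity)] at h2 h3 h4 h5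
  have hn' : (0 : ℝ) < n := by exact_mod_cast hn
  have hl : 0 < lam := by linarith
  have hlog : ∀ b : ℝ, 2 / a * lam ≤ b → n * Real.exp (-b) ≤ 1 / n := by
    intro b hb
    have e1 : 2 * Real.log n ≤ b := by
      refine le_trans ?_ hb
      calc 2 * Real.log n = 2 / a * (a * Real.log n) := by field_simp
        _ ≤ _ := by gcongr
    calc n * Real.exp (-b) ≤ n * Real.exp (-(2 * Real.log n)) := by gcongr
      _ = 1 / n := by
        rw [two_mul, Real.exp_neg, Real.exp_add, Real.exp_log hn']; field_simp
  have hρ0 : 0 ≤ C * lam / n := by positivity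
  have hdeg := hA.measureReal_degree_le (C' * lam)
  have hdeg' : n * Real.exp (C * lam / n * n * Real.exp 2 - C' * lam) ≤ 1 / n := by
    rw [show C * lam / n * n * Real.exp 2 - C' * lam = -(2 / a * lam) by
      rw [hC']; field_simp; ring]
    exact hlog _ le_rfl
  have hdense' : n * Real.exp (-(θ * (κ * lam) / 2)) ≤ 1 / n := by
    refine hlog _ (le_of_eq ?_)
    rw [hθ]; field_simp; norm_num
  have hn1 : 1 / (n : ℝ) ≤ 1 := by
    rw [div_le_one hn']; exact_mod_cast hn
  have hdense := hA.measureReal_dense_le hρ0 (s := σ * n) (K := κ * lam) hθ0 (by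
    rw [hσ]; field_simp; exact le_rfl) (hdense'.trans hn1)
  have hlight := hA.measureReal_light_le hρ0 hn (T := τ * lam) (by positivity) (by
    rw [mul_pow, show 8 * (C * lam / n) * n = 8 * C * lam by field_simp]
    nlinarith)
  refine le_trans (measureReal_mono (fun x hx => ?_) (measure_ne_top _ _))
    ((measureReal_union_le _ _).trans ((add_le_add ((measureReal_union_le _ _).trans
      (add_le_add (hdeg.trans hdeg')
        (hdense.trans (mul_le_mul_of_nonneg_left hdense' zero_le_two))))
      (hlight.trans (exp_neg_natCast_le hn))).trans (le_of_eq (by ring))))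
  by_contra hcon
  simp only [Set.mem_union, Set.mem_ofPred_eq, not_or, not_exists, not_and, not_le, not_lt] at hcon
  obtain ⟨⟨hd, hs⟩, hli⟩ := hcon
  obtain ⟨v, hv⟩ := hx
  refine absurd hv (not_lt.2 ?_)
  refine (quadForm_sub_le (A x) (expectation μ A) (ρ := C * lam / n) (T := τ * lam)
    (Δ := C' * lam) (K := κ * lam) (s := σ * n) (θ := η) (L := 16 * (τ * lam)) hn
    (hA.nonneg x) (hA.le_one x) (hA.symm x) hA.mean_nonneg hA.mean_le (by positivity) hη0
    (by positivity) (by positivity) (fun i => (hd i).le) hs ?_ hli v).trans ?_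
  · calc 2 * (4 * n / (τ * lam)) * (C' * lam) = 8 * C' * (n / τ) := by field_simp; ring
      _ ≤ lam * (τ * κ * σ) * (n / τ) := by gcongr
      _ = _ := by field_simp
  · refine mul_le_mul_of_nonneg_right ?_ (Finset.sum_nonneg fun i _ => mul_self_nonneg _)
    have e1 : 16 * (τ * lam) = ε / 4 * lam := by rw [hτ]; ring
    have e2 : 4 * (κ * lam * η + C' * lam / η) = ε / 4 * lam := by
      have : C' / η = ε / 32 := by rw [hη]; field_simp
      have h' : κ * η = ε / 32 := by rw [hκ]; field_simp
      calc _ = 4 * (κ * η + C' / η) * lam := by ring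
        _ = _ := by rw [this, h']; ring
    have e3 : 16 * (C * lam / n) * n / (τ * lam) ≤ ε / 4 * lam := by
      rw [show 16 * (C * lam / n) * n / (τ * lam) = 16 * C / τ by field_simp,
        div_le_iff₀ hτ0]
      linarith
    linarith

end SBM

/-! ### Row sums over a community, by fourth moments. -/

namespace SBM

variable {n : ℕ} {Ω : Type*} [MeasurableSpace Ω] {μ : Measure Ω}
  {A : Ω → Matrix (Fin n) (Fin n) ℝ} {ρ : ℝ} [IsProbabilityMeasure μ]

namespace IsBernoulli

/-- The fourth moment of a centred sum of at most `n` independent entries. -/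
lemma integral_sum_pow_four_le {C lam : ℝ} (h : IsBernoulli μ A (C * lam / n)) (hC : 0 ≤ C)
    (hlam : 1 ≤ lam) (hn : 0 < n) (f : Finset (LowerPair n)) (hf : f.card ≤ n) :
    ∫ x, (∑ p ∈ f, (A x p.1.1 p.1.2 - expectation μ A p.1.1 p.1.2)) ^ 4 ∂μ ≤
      48 * Real.exp C * lam ^ 2 := by
  have hl : 0 < √lam := Real.sqrt_pos.2 (by linarith)
  have hl1 : 1 ≤ √lam := Real.one_le_sqrt.2 hlam
  have hn' : (0 : ℝ) < n := by exact_mod_cast hn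
  set y : Ω → ℝ := fun x => ∑ p ∈ f, (A x p.1.1 p.1.2 - expectation μ A p.1.1 p.1.2) with hy
  have hsum : ∀ (σ : ℝ) (x : Ω), σ * (1 / √lam * y x) =
      ∑ p, (if p ∈ f then σ * (1 / √lam) else 0) *
        (A x p.1.1 p.1.2 - expectation μ A p.1.1 p.1.2) := fun σ x => by
    simp only [hy, Finset.mul_sum, ite_mul, zero_mul, Finset.sum_ite_mem, Finset.univ_inter,
      mul_assoc]
  have hexp : ∀ σ : ℝ, |σ| = 1 → Integrable (fun x => Real.exp (σ * (1 / √lam * y x))) μ ∧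
      ∫ x, Real.exp (σ * (1 / √lam * y x)) ∂μ ≤ Real.exp C := by
    intro σ hσ
    simp_rw [hsum]
    refine ⟨h.integrable_exp_centered _, (h.integral_exp_centered _ fun p => ?_).trans ?_⟩
    · split_ifs
      · rw [abs_mul, hσ, one_mul, abs_of_pos (by positivity), div_le_one hl]; exact hl1
      · simp
    · rw [Real.exp_le_exp]
      have hσ2 : σ ^ 2 = 1 := by rw [← sq_abs, hσ]; norm_num
      simp only [ite_pow, ne_eq, OfNat.ofNat_ne_zero, not_false_eq_true, zero_pow,
        Finset.sum_ite_mem, Finset.univ_inter, Finset.sum_const, nsmul_eq_mul, mul_pow, hσ2,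
        div_pow, Real.sq_sqrt (by linarith : 0 ≤ lam), one_pow, one_mul]
      have hfn : (f.card : ℝ) ≤ n := by exact_mod_cast hf
      calc C * lam / n * (f.card * (1 / lam)) ≤ C * lam / n * (n * (1 / lam)) := by gcongr
        _ = C := by field_simp
  -- At the scale √lam the exponential moments are at most exp C, and u⁴ / 24 ≤ exp u + exp (-u)
  -- turns them into a fourth moment.
  have hpt : ∀ x, y x ^ 4 ≤ 24 * lam ^ 2 *
      (Real.exp (1 * (1 / √lam * y x)) + Real.exp (-1 * (1 / √lam * y x))) := by
    intro x
    have e1 : ∀ u : ℝ, u ^ 4 / 24 ≤ Real.exp u + Real.exp (-u) := fun u => by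
      have h1 := Real.pow_div_factorial_le_exp |u| (abs_nonneg u) 4
      have h2 : |u| ^ 4 = u ^ 4 := Even.pow_abs (by decide) u
      rw [h2] at h1
      norm_num [Nat.factorial] at h1
      rcases abs_cases u with ⟨hu, -⟩ | ⟨hu, -⟩ <;> rw [hu] at h1
      · linarith [Real.exp_pos (-u)]
      · linarith [Real.exp_pos u]
    have e2 := e1 (1 / √lam * y x)
    have e3 : (1 / √lam * y x) ^ 4 = y x ^ 4 / lam ^ 2 := by
      rw [mul_pow, div_pow, show √lam ^ 4 = (√lam ^ 2) ^ 2 by ring,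
        Real.sq_sqrt (by linarith : 0 ≤ lam)]; ring
    rw [e3, div_div, div_le_iff₀ (by positivity)] at e2
    rw [one_mul, neg_one_mul]
    linarith
  obtain ⟨i1, b1⟩ := hexp 1 (by norm_num)
  obtain ⟨i2, b2⟩ := hexp (-1) (by norm_num)
  calc ∫ x, y x ^ 4 ∂μ ≤ ∫ x, 24 * lam ^ 2 *
        (Real.exp (1 * (1 / √lam * y x)) + Real.exp (-1 * (1 / √lam * y x))) ∂μ :=
        integral_mono_of_nonneg (ae_of_all _ fun x => by positivity)
          ((i1.add i2).const_mul _) (ae_of_all _ hpt)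
    _ = 24 * lam ^ 2 * (∫ x, Real.exp (1 * (1 / √lam * y x)) ∂μ +
          ∫ x, Real.exp (-1 * (1 / √lam * y x)) ∂μ) := by
        rw [integral_const_mul, integral_add i1 i2]
    _ ≤ 24 * lam ^ 2 * (Real.exp C + Real.exp C) := by gcongr
    _ = _ := by ring

/-- The squares of centred sums over disjoint sets of independent entries concentrate. -/
lemma measureReal_sum_sq_le {C lam : ℝ} (h : IsBernoulli μ A (C * lam / n)) (hC : 0 ≤ C)
    (hlam : 1 ≤ lam) (hn : 0 < n) (f : Fin n → Finset (LowerPair n))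
    (hf : ∀ k, (f k).card ≤ n) (hdisj : ∀ k l, k ≠ l → Disjoint (f k) (f l)) :
    μ.real {x | (2 + 48 * Real.exp C) * (n * lam) ≤
      ∑ k, (∑ p ∈ f k, (A x p.1.1 p.1.2 - expectation μ A p.1.1 p.1.2)) ^ 2} ≤
      48 * Real.exp C / n := by
  have hn' : (0 : ℝ) < n := by exact_mod_cast hn
  have hl : 0 < lam := by linarith
  set D := 48 * Real.exp C with hD
  set Z : Fin n → Ω → ℝ := fun k x =>
    (∑ p ∈ f k, (A x p.1.1 p.1.2 - expectation μ A p.1.1 p.1.2)) ^ 2 with hZ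
  have hmeas : ∀ k, Measurable (Z k) := fun k =>
    (Finset.measurable_sum _ fun p _ => (h.measurable _ _).sub_const _).pow_const 2
  have hbound : ∀ k x, |Z k x| ≤ n ^ 2 := fun k x => by
    simp only [hZ]
    rw [abs_pow]
    gcongr
    calc |∑ p ∈ f k, (A x p.1.1 p.1.2 - expectation μ A p.1.1 p.1.2)|
        ≤ ∑ p ∈ f k, |A x p.1.1 p.1.2 - expectation μ A p.1.1 p.1.2| :=
          Finset.abs_sum_le_sum_abs _ _
      _ ≤ ∑ _p ∈ f k, (1 : ℝ) := by
          refine Finset.sum_le_sum fun p _ => abs_le.2 ⟨?_, ?_⟩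
          · linarith [h.nonneg x p.1.1 p.1.2, h.mean_le_one p.1.1 p.1.2]
          · linarith [h.le_one x p.1.1 p.1.2, h.mean_nonneg p.1.1 p.1.2]
      _ ≤ n := by simpa using hf k
  have hLp : ∀ k, MemLp (Z k) 2 μ := fun k =>
    MemLp.of_bound (hmeas k).aestronglyMeasurable (n ^ 2) (ae_of_all _ (hbound k))
  have hint : ∀ k, Integrable (Z k) μ := fun k => (hLp k).integrable (by norm_num)
  have hsq : ∀ k, ∫ x, Z k x ^ 2 ∂μ ≤ D * lam ^ 2 := fun k => by
    have := h.integral_sum_pow_four_le hC hlam hn (f k) (hf k)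
    simpa only [hZ, ← pow_mul] using this
  have hvar : ∀ k, variance (Z k) μ ≤ D * lam ^ 2 := fun k =>
    (variance_le_expectation_sq (hmeas k).aestronglyMeasurable).trans (by simpa using hsq k)
  have hmean : ∀ k, ∫ x, Z k x ∂μ ≤ (1 + D) * lam := fun k => by
    have hi : Integrable (fun x => Z k x ^ 2) μ := (hLp k).integrable_sq
    calc ∫ x, Z k x ∂μ ≤ ∫ x, (lam + Z k x ^ 2 / lam) ∂μ := by
          refine integral_mono (hint k) ((integrable_const _).add (hi.div_const _)) fun x => ?_
          have : lam + Z k x ^ 2 / lam - Z k x =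
              ((lam - Z k x / 2) ^ 2 + 3 / 4 * Z k x ^ 2) / lam := by field_simp; ring
          have : 0 ≤ ((lam - Z k x / 2) ^ 2 + 3 / 4 * Z k x ^ 2) / lam := by positivity
          simp only
          linarith
      _ = lam + (∫ x, Z k x ^ 2 ∂μ) / lam := by
          rw [integral_add (integrable_const _) (hi.div_const _), integral_div]; simp
      _ ≤ lam + D * lam ^ 2 / lam := by gcongr; exact hsq k
      _ = _ := by field_simp
  have hindep : Set.Pairwise ↑(Finset.univ : Finset (Fin n)) fun k l => IndepFun (Z k) (Z l) μ := by
    intro k _ l _ hkl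
    have h1 := h.indep.indepFun_finset (f k) (f l) (hdisj k l hkl)
      fun p => h.measurable p.1.1 p.1.2
    have h2 : ∀ k, Measurable fun v : f k → ℝ =>
        (∑ p : f k, (v p - expectation μ A p.1.1.1 p.1.1.2)) ^ 2 := fun k => by fun_prop
    have h3 := h1.comp (h2 k) (h2 l)
    have h4 : ∀ k, Z k = (fun v : f k → ℝ =>
        (∑ p : f k, (v p - expectation μ A p.1.1.1 p.1.1.2)) ^ 2) ∘
        (fun x (p : f k) => A x p.1.1.1 p.1.1.2) := fun k => by
      funext x
      simp only [hZ, Function.comp]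
      rw [← Finset.sum_coe_sort (f k)]
    rw [h4 k, h4 l]
    exact h3
  -- The fourth moments bound the variance of each square by D lam², so Chebyshev at distance n lam
  -- from the mean fails with probability at most D / n. Markov's inequality for the mean would give
  -- no decay in n.
  have hcheb := meas_ge_le_variance_div_sq (μ := μ) (X := ∑ k, Z k)
    (memLp_finsetSum' _ fun k _ => hLp k) (c := n * lam) (by positivity)
  rw [IndepFun.variance_sum (fun k _ => hLp k) hindep] at hcheb
  have hvs : (∑ k, variance (Z k) μ) / (n * lam) ^ 2 ≤ D / n := by
    calc (∑ k, variance (Z k) μ) / (n * lam) ^ 2 ≤ (∑ _k : Fin n, D * lam ^ 2) / (n * lam) ^ 2 := by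
          gcongr with k; exact hvar k
      _ = _ := by simp; field_simp
  have hes : ∫ x, (∑ k, Z k) x ∂μ ≤ n * ((1 + D) * lam) := by
    simp only [Finset.sum_apply]
    rw [integral_finsetSum _ fun k _ => hint k]
    calc _ ≤ ∑ _k : Fin n, (1 + D) * lam := Finset.sum_le_sum fun k _ => hmean k
      _ = _ := by simp
  refine (measureReal_mono (fun x hx => ?_)).trans
    (ENNReal.toReal_le_of_le_ofReal (by positivity) (hcheb.trans (ENNReal.ofReal_le_ofReal hvs)))
  simp only [Set.mem_ofPred_eq, Finset.sum_apply] at hx hes ⊢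
  refine le_trans ?_ (le_abs_self _)
  linarith

/-- With high probability, the row sums of the centred matrix over a given set of columns are of
order `√lam` in quadratic mean. -/
lemma measureReal_rowSum_le {C lam : ℝ} (h : IsBernoulli μ A (C * lam / n)) (hC : 0 ≤ C)
    (hlam : 1 ≤ lam) (hn : 0 < n) (B : Finset (Fin n)) :
    μ.real {x | 4 * (2 + 48 * Real.exp C) * (n * lam) ≤
      ∑ i, (∑ j ∈ B, (A x i j - expectation μ A i j)) ^ 2} ≤ 96 * Real.exp C / n := by
  -- Different rows share variables, by symmetry. The part of each row up to the diagonal and the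
  -- part beyond it give two families of pairwise disjoint sets of independent entries.
  set f : Fin n → Finset (LowerPair n) := fun i =>
    Finset.univ.filter fun p => p.1.1 = i ∧ p.1.2 ∈ B with hf
  set g : Fin n → Finset (LowerPair n) := fun i =>
    Finset.univ.filter fun p => p.1.2 = i ∧ p.1.1 ∈ B ∧ p.1.2 < p.1.1 with hg
  have hfc : ∀ k, (f k).card ≤ n := fun k => by
    calc (f k).card ≤ (Finset.univ : Finset (Fin n)).card := by
          refine Finset.card_le_card_of_injOn (fun p => p.1.2) (fun _ _ => Finset.mem_univ _) ?_
          intro p hp q hq hpq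
          simp only [hf, Finset.coe_filter, Finset.mem_univ, true_and, Set.mem_ofPred_eq] at hp hq
          exact Subtype.ext (Prod.ext (hp.1.trans hq.1.symm) hpq)
      _ = n := by simp
  have hgc : ∀ k, (g k).card ≤ n := fun k => by
    calc (g k).card ≤ (Finset.univ : Finset (Fin n)).card := by
          refine Finset.card_le_card_of_injOn (fun p => p.1.1) (fun _ _ => Finset.mem_univ _) ?_
          intro p hp q hq hpq
          simp only [hg, Finset.coe_filter, Finset.mem_univ, true_and, Set.mem_ofPred_eq] at hp hq
          exact Subtype.ext (Prod.ext hpq (hp.1.trans hq.1.symm))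
      _ = n := by simp
  have hfd : ∀ k l, k ≠ l → Disjoint (f k) (f l) := fun k l hkl =>
    Finset.disjoint_filter.2 fun p _ h1 h2 => hkl (h1.1.symm.trans h2.1)
  have hgd : ∀ k l, k ≠ l → Disjoint (g k) (g l) := fun k l hkl =>
    Finset.disjoint_filter.2 fun p _ h1 h2 => hkl (h1.1.symm.trans h2.1)
  have hsplit : ∀ x i, ∑ j ∈ B, (A x i j - expectation μ A i j) =
      ∑ p ∈ f i, (A x p.1.1 p.1.2 - expectation μ A p.1.1 p.1.2) +
      ∑ p ∈ g i, (A x p.1.1 p.1.2 - expectation μ A p.1.1 p.1.2) := by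
    intro x i
    have h1 := sum_ite_mem_mul {i} B 1 fun i j => A x i j - expectation μ A i j
    rw [sum_mul_eq_sum_lowerPair _ _ fun i j => by rw [h.symm x i j, h.mean_symm i j]] at h1
    rw [one_mul, Finset.sum_singleton] at h1
    rw [← h1, hf, hg, Finset.sum_filter, Finset.sum_filter, ← Finset.sum_add_distrib]
    refine Finset.sum_congr rfl fun p _ => ?_
    simp only [Finset.mem_singleton, add_mul, ite_mul, one_mul, zero_mul]
    congr 1
    by_cases h2 : p.1.2 < p.1.1 <;> simp [h2]
  have h1 := h.measureReal_sum_sq_le hC hlam hn f hfc hfd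
  have h2 := h.measureReal_sum_sq_le hC hlam hn g hgc hgd
  refine (measureReal_mono (fun x hx => ?_) (measure_ne_top _ _)).trans
    ((measureReal_union_le _ _).trans ((add_le_add h1 h2).trans (le_of_eq (by ring))))
  by_contra hcon
  simp only [Set.mem_union, Set.mem_ofPred_eq, not_or, not_le] at hcon hx
  have h3 : ∑ i, (∑ j ∈ B, (A x i j - expectation μ A i j)) ^ 2 ≤
      2 * ∑ i, (∑ p ∈ f i, (A x p.1.1 p.1.2 - expectation μ A p.1.1 p.1.2)) ^ 2 +
      2 * ∑ i, (∑ p ∈ g i, (A x p.1.1 p.1.2 - expectation μ A p.1.1 p.1.2)) ^ 2 := by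
    rw [Finset.mul_sum, Finset.mul_sum, ← Finset.sum_add_distrib]
    refine Finset.sum_le_sum fun i _ => ?_
    rw [hsplit]
    nlinarith [sq_nonneg (∑ p ∈ f i, (A x p.1.1 p.1.2 - expectation μ A p.1.1 p.1.2) -
      ∑ p ∈ g i, (A x p.1.1 p.1.2 - expectation μ A p.1.1 p.1.2))]
  linarith [hcon.1, hcon.2]

end IsBernoulli
end SBM

/-! ### The modularity is Lipschitz in the cut norm. -/

namespace SBM

variable {n : ℕ}

section Modularity

variable {B : Matrix (Fin n) (Fin n) ℝ} {e : Fin n → ℝ}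

lemma O₁₁_eq (he : ∀ i, e i = 1 ∨ e i = -1) :
    O₁₁ B e = ∑ i with e i = 1, ∑ j with e j = 1, B i j := by
  have h := sum_ite_mem_mul (Finset.univ.filter (e · = 1)) (Finset.univ.filter (e · = 1)) 4 B
  have h2 : 4 * O₁₁ B e = 4 * ∑ i with e i = 1, ∑ j with e j = 1, B i j := by
    rw [← h, O₁₁, dotProduct_mulVec_eq_sum, ← mul_assoc]
    norm_num
    refine Finset.sum_congr rfl fun i _ => Finset.sum_congr rfl fun j _ => ?_
    rcases he i with hi | hi <;> rcases he j with hj | hj <;> norm_num [hi, hj]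
  linarith

lemma O₂₂_eq (he : ∀ i, e i = 1 ∨ e i = -1) :
    O₂₂ B e = ∑ i with e i = -1, ∑ j with e j = -1, B i j := by
  have h := O₁₁_eq (B := B) (e := -e) fun i => by
    rcases he i with h | h <;> simp [h]
  simp only [Pi.neg_apply, neg_eq_iff_eq_neg] at h
  rw [← h, O₁₁, O₂₂, sub_eq_add_neg]

lemma O₁₂_eq (he : ∀ i, e i = 1 ∨ e i = -1) :
    O₁₂ B e = ∑ i with e i = 1, ∑ j with e j = -1, B i j := by
  have h := sum_ite_mem_mul (Finset.univ.filter (e · = 1)) (Finset.univ.filter (e · = -1)) 4 B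
  have h2 : 4 * O₁₂ B e = 4 * ∑ i with e i = 1, ∑ j with e j = -1, B i j := by
    rw [← h, O₁₂, dotProduct_mulVec_eq_sum, ← mul_assoc]
    norm_num
    refine Finset.sum_congr rfl fun i _ => Finset.sum_congr rfl fun j _ => ?_
    rcases he i with hi | hi <;> rcases he j with hj | hj <;> norm_num [hi, hj]
  linarith

lemma O₁₁_add_O₂₂_add (hB : ∀ i j, B i j = B j i) :
    O₁₁ B e + O₂₂ B e + 2 * O₁₂ B e = ∑ i, ∑ j, B i j := by
  have h1 : ∑ i, ∑ j, e i * B i j = ∑ i, ∑ j, e j * B i j := by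
    rw [Finset.sum_comm]
    exact Finset.sum_congr rfl fun i _ => Finset.sum_congr rfl fun j _ => by rw [hB]
  have h2 : ∀ i j, 1 / 4 * ((1 + e) i * (1 + e) j * B i j) + 1 / 4 * ((1 - e) i * (1 - e) j * B i j)
      + 2 * (1 / 4 * ((1 + e) i * (1 - e) j * B i j)) =
      B i j + 1 / 2 * (e i * B i j) - 1 / 2 * (e j * B i j) := fun i j => by
    simp only [Pi.add_apply, Pi.sub_apply, Pi.one_apply]; ring
  simp only [O₁₁, O₂₂, O₁₂, dotProduct_mulVec_eq_sum, Finset.mul_sum]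
  rw [← Finset.sum_add_distrib, ← Finset.sum_add_distrib]
  simp only [← Finset.sum_add_distrib, h2]
  have h3 : ∀ w : Fin n → Fin n → ℝ, ∑ i, ∑ j, 1 / 2 * w i j = 1 / 2 * ∑ i, ∑ j, w i j :=
    fun w => by rw [Finset.mul_sum]; exact Finset.sum_congr rfl fun i _ => Finset.mul_sum _ _ _ |>.symm
  simp only [Finset.sum_sub_distrib, Finset.sum_add_distrib]
  rw [h3, h3, h1]
  ring

/-- Expand O₁² + O₂² = (O₁ + O₂)² - 2 O₁ O₂. This form shows the Lipschitz dependence on the block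
sums. If the total is 0, the quotients read as 0 and the identity becomes O₁₁ + O₂₂ = -2 O₁₂. -/
lemma modularity_eq (h11 : 0 ≤ O₁₁ B e) (h22 : 0 ≤ O₂₂ B e) (h12 : 0 ≤ O₁₂ B e) :
    modularity B e = 2 * (O₁ B e * O₂ B e / (O₁ B e + O₂ B e) - O₁₂ B e) := by
  simp only [modularity, O₁, O₂]
  rcases eq_or_ne (O₁₁ B e + O₁₂ B e + (O₂₂ B e + O₁₂ B e)) 0 with h | h
  · rw [h]; simp; linarith
  · field_simp; ring

/-- The partial derivatives of x y / (x + y) are y² / (x + y)² and x² / (x + y)², both at most 1;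
the proof changes one variable at a time with the corresponding difference quotient. -/
lemma abs_mul_div_add_sub_le {x y x' y' : ℝ} (hx : 0 ≤ x) (hy : 0 ≤ y) (hx' : 0 ≤ x')
    (hy' : 0 ≤ y') : |x * y / (x + y) - x' * y' / (x' + y')| ≤ |x - x'| + |y - y'| := by
  have key : ∀ {x y x' : ℝ}, 0 ≤ x → 0 ≤ y → 0 ≤ x' →
      |x * y / (x + y) - x' * y / (x' + y)| ≤ |x - x'| := by
    intro x y x' hx hy hx'
    rcases hy.eq_or_lt with rfl | hy
    · simp
    have h1 : x * y / (x + y) - x' * y / (x' + y) =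
        (x - x') * (y ^ 2 / ((x + y) * (x' + y))) := by
      have h2 : x + y ≠ 0 := by positivity
      have h3 : x' + y ≠ 0 := by positivity
      field_simp; ring
    rw [h1, abs_mul]
    refine mul_le_of_le_one_right (abs_nonneg _) ?_
    rw [abs_of_nonneg (by positivity), div_le_one (by positivity)]
    nlinarith [mul_nonneg hx hx', mul_nonneg hx hy.le, mul_nonneg hx' hy.le]
  have h1 := key (y := y) hx hy hx'
  have h2 := key (y := x') hy hx' hy'
  rw [mul_comm y, add_comm y, mul_comm y', add_comm y'] at h2
  calc _ = |(x * y / (x + y) - x' * y / (x' + y)) +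
        (x' * y / (x' + y) - x' * y' / (x' + y'))| := by congr 1; ring
    _ ≤ _ := (abs_add_le _ _).trans (add_le_add h1 h2)

/-- The modularity is Lipschitz in the matrix with respect to the cut norm. -/
lemma abs_modularity_sub_le {A : Matrix (Fin n) (Fin n) ℝ} (hA : ∀ i j, A i j = A j i)
    (hB : ∀ i j, B i j = B j i) (hA0 : ∀ i j, 0 ≤ A i j) (hB0 : ∀ i j, 0 ≤ B i j)
    (he : ∀ i, e i = 1 ∨ e i = -1) {η : ℝ}
    (hη : ∀ s : Finset (Fin n), |∑ i ∈ s, ∑ j ∈ s, (A i j - B i j)| ≤ η) :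
    |modularity A e - modularity B e| ≤ 13 * η := by
  have pos : ∀ {B : Matrix (Fin n) (Fin n) ℝ}, (∀ i j, 0 ≤ B i j) →
      0 ≤ O₁₁ B e ∧ 0 ≤ O₂₂ B e ∧ 0 ≤ O₁₂ B e := fun h => by
    rw [O₁₁_eq he, O₂₂_eq he, O₁₂_eq he]
    refine ⟨?_, ?_, ?_⟩ <;>
      exact Finset.sum_nonneg fun i _ => Finset.sum_nonneg fun j _ => h i j
  obtain ⟨a11, a22, a12⟩ := pos hA0
  obtain ⟨b11, b22, b12⟩ := pos hB0
  have d11 : |O₁₁ A e - O₁₁ B e| ≤ η := by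
    rw [O₁₁_eq he, O₁₁_eq he, ← Finset.sum_sub_distrib]
    simpa only [Finset.sum_sub_distrib] using hη (Finset.univ.filter (e · = 1))
  have d22 : |O₂₂ A e - O₂₂ B e| ≤ η := by
    rw [O₂₂_eq he, O₂₂_eq he, ← Finset.sum_sub_distrib]
    simpa only [Finset.sum_sub_distrib] using hη (Finset.univ.filter (e · = -1))
  -- Only squares s × s are controlled, so O₁₂ is recovered from the total, with error 3η/2. Then O₁
  -- and O₂ have error 5η/2, and 2 (5/2 + 5/2 + 3/2) = 13.
  have d : |(O₁₁ A e + O₂₂ A e + 2 * O₁₂ A e) - (O₁₁ B e + O₂₂ B e + 2 * O₁₂ B e)| ≤ η := by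
    rw [O₁₁_add_O₂₂_add hA, O₁₁_add_O₂₂_add hB, ← Finset.sum_sub_distrib]
    simpa only [Finset.sum_sub_distrib] using hη Finset.univ
  rw [abs_le] at d11 d22 d
  have d12 : |O₁₂ A e - O₁₂ B e| ≤ 3 / 2 * η := abs_le.2 ⟨by linarith, by linarith⟩
  rw [abs_le] at d12
  have d1 : |O₁ A e - O₁ B e| ≤ 5 / 2 * η := by
    rw [O₁, O₁]; exact abs_le.2 ⟨by linarith, by linarith⟩
  have d2 : |O₂ A e - O₂ B e| ≤ 5 / 2 * η := by
    rw [O₂, O₂]; exact abs_le.2 ⟨by linarith, by linarith⟩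
  have hη0 : 0 ≤ η := by linarith
  rw [modularity_eq a11 a22 a12, modularity_eq b11 b22 b12]
  have h1 := abs_mul_div_add_sub_le (add_nonneg a11 a12) (add_nonneg a22 a12)
    (add_nonneg b11 b12) (add_nonneg b22 b12)
  have h2 := abs_le.1 (h1.trans (add_le_add d1 d2))
  simp only [O₁, O₂] at h2 ⊢
  exact abs_le.2 ⟨by linarith [h2.1], by linarith [h2.2]⟩

end Modularity
end SBM

/-! ### The block matrix, the contrast, and the distance to the true labels. -/

namespace SBM

variable {n : ℕ}

/-- The nodes of community 1. -/
noncomputable def comm₁ (π₁ : ℝ) (n : ℕ) : Finset (Fin n) := Finset.univ.filter fun i => (i : ℕ) < size₁ π₁ n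

/-- The nodes of community 2. -/
noncomputable def comm₂ (π₁ : ℝ) (n : ℕ) : Finset (Fin n) := Finset.univ.filter fun i => ¬(i : ℕ) < size₁ π₁ n

/-- The matrix of edge probabilities, which is block constant. -/
noncomputable def blockMatrix (π₁ r ω lam : ℝ) (n : ℕ) : Matrix (Fin n) (Fin n) ℝ :=
  Matrix.of (edgeProb π₁ r ω lam n)

lemma sum_comm₁_add_sum_comm₂ (π₁ : ℝ) (f : Fin n → ℝ) :
    ∑ i ∈ comm₁ π₁ n, f i + ∑ i ∈ comm₂ π₁ n, f i = ∑ i, f i :=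
  Finset.sum_filter_add_sum_filter_not _ _ _

lemma card_comm₁_add_card_comm₂ (π₁ : ℝ) :
    ((comm₁ π₁ n).card : ℝ) + (comm₂ π₁ n).card = n := by
  have := sum_comm₁_add_sum_comm₂ (n := n) π₁ fun _ => 1
  simpa using this

lemma edgeProb_nonneg {π₁ r ω lam : ℝ} (hr : 0 ≤ r) (hω : 0 ≤ ω) (hlam : 0 ≤ lam) (i j : Fin n) :
    0 ≤ edgeProb π₁ r ω lam n i j := by
  simp only [edgeProb]
  refine mul_nonneg (by positivity) ?_
  split_ifs <;> first | assumption | norm_num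

lemma edgeProb_le {π₁ r ω lam : ℝ} (hr : 0 ≤ r) (hω : 0 ≤ ω) (hlam : 0 ≤ lam) (i j : Fin n) :
    edgeProb π₁ r ω lam n i j ≤ (1 + r + ω) * lam / n := by
  simp only [edgeProb]
  rw [mul_comm (1 + r + ω), mul_div_right_comm]
  gcongr
  split_ifs <;> linarith

lemma edgeProb_symm (π₁ r ω lam : ℝ) (i j : Fin n) :
    edgeProb π₁ r ω lam n i j = edgeProb π₁ r ω lam n j i := by
  simp only [edgeProb]
  split_ifs <;> rfl

lemma blockMatrix_mulVec (π₁ r ω lam : ℝ) (v : Fin n → ℝ) (i : Fin n) :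
    (blockMatrix π₁ r ω lam n).mulVec v i = lam / n * (if (i : ℕ) < size₁ π₁ n then
      ∑ j ∈ comm₁ π₁ n, v j + r * ∑ j ∈ comm₂ π₁ n, v j
      else r * ∑ j ∈ comm₁ π₁ n, v j + ω * ∑ j ∈ comm₂ π₁ n, v j) := by
  simp only [blockMatrix, Matrix.mulVec, dotProduct, Matrix.of_apply, edgeProb]
  rw [← sum_comm₁_add_sum_comm₂ π₁]
  have h1 : ∀ j ∈ comm₁ π₁ n, (j : ℕ) < size₁ π₁ n := fun j hj => (Finset.mem_filter.1 hj).2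
  have h2 : ∀ j ∈ comm₂ π₁ n, ¬(j : ℕ) < size₁ π₁ n := fun j hj => (Finset.mem_filter.1 hj).2
  by_cases hi : (i : ℕ) < size₁ π₁ n
  · rw [if_pos hi, mul_add, Finset.mul_sum, Finset.mul_sum, Finset.mul_sum]
    congr 1
    · exact Finset.sum_congr rfl fun j hj => by rw [if_pos hi, if_pos (h1 j hj)]; ring
    · exact Finset.sum_congr rfl fun j hj => by rw [if_pos hi, if_neg (h2 j hj)]; ring
  · rw [if_neg hi, mul_add, Finset.mul_sum, Finset.mul_sum, Finset.mul_sum, Finset.mul_sum]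
    congr 1
    · exact Finset.sum_congr rfl fun j hj => by rw [if_neg hi, if_pos (h1 j hj)]; ring
    · exact Finset.sum_congr rfl fun j hj => by rw [if_neg hi, if_neg (h2 j hj)]; ring

lemma dotProduct_blockMatrix_mulVec (π₁ r ω lam : ℝ) (u v : Fin n → ℝ) :
    u ⬝ᵥ (blockMatrix π₁ r ω lam n).mulVec v = lam / n *
      ((∑ i ∈ comm₁ π₁ n, u i) * (∑ i ∈ comm₁ π₁ n, v i) +
        r * ((∑ i ∈ comm₁ π₁ n, u i) * (∑ i ∈ comm₂ π₁ n, v i) +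
          (∑ i ∈ comm₂ π₁ n, u i) * (∑ i ∈ comm₁ π₁ n, v i)) +
        ω * ((∑ i ∈ comm₂ π₁ n, u i) * (∑ i ∈ comm₂ π₁ n, v i))) := by
  rw [dotProduct, ← sum_comm₁_add_sum_comm₂ π₁]
  have h1 : ∀ j ∈ comm₁ π₁ n, (j : ℕ) < size₁ π₁ n := fun j hj => (Finset.mem_filter.1 hj).2
  have h2 : ∀ j ∈ comm₂ π₁ n, ¬(j : ℕ) < size₁ π₁ n := fun j hj => (Finset.mem_filter.1 hj).2
  have e1 : ∑ j ∈ comm₁ π₁ n, u j * (blockMatrix π₁ r ω lam n).mulVec v j =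
      (∑ j ∈ comm₁ π₁ n, u j) *
        (lam / n * (∑ j ∈ comm₁ π₁ n, v j + r * ∑ j ∈ comm₂ π₁ n, v j)) := by
    rw [Finset.sum_mul]
    exact Finset.sum_congr rfl fun j hj => by rw [blockMatrix_mulVec, if_pos (h1 j hj)]
  have e2 : ∑ j ∈ comm₂ π₁ n, u j * (blockMatrix π₁ r ω lam n).mulVec v j =
      (∑ j ∈ comm₂ π₁ n, u j) *
        (lam / n * (r * ∑ j ∈ comm₁ π₁ n, v j + ω * ∑ j ∈ comm₂ π₁ n, v j)) := by
    rw [Finset.sum_mul]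
    exact Finset.sum_congr rfl fun j hj => by rw [blockMatrix_mulVec, if_neg (h2 j hj)]
  rw [e1, e2]
  ring

/-- The contrast functional that separates the two communities, normalized to `1` at the
true labels. -/
noncomputable def contrast (π₁ : ℝ) (n : ℕ) (e : Fin n → ℝ) : ℝ :=
  ((∑ i ∈ comm₁ π₁ n, e i) / (comm₁ π₁ n).card - (∑ i ∈ comm₂ π₁ n, e i) / (comm₂ π₁ n).card) / 2

/-- The modularity of the block matrix is proportional to the square of the contrast. -/
lemma modularity_blockMatrix {π₁ r ω lam : ℝ} (hr : 0 ≤ r) (hω : r ^ 2 < ω) (hlam : 0 < lam)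
    (h1 : 0 < ((comm₁ π₁ n).card : ℝ)) (h2 : 0 < ((comm₂ π₁ n).card : ℝ)) (e : Fin n → ℝ) :
    modularity (blockMatrix π₁ r ω lam n) e =
      2 * (lam / n * ((comm₁ π₁ n).card ^ 2 * (comm₂ π₁ n).card ^ 2 * (ω - r ^ 2) /
        ((comm₁ π₁ n).card ^ 2 + 2 * r * (comm₁ π₁ n).card * (comm₂ π₁ n).card +
          ω * (comm₂ π₁ n).card ^ 2))) * contrast π₁ n e ^ 2 := by
  have hn : (0 : ℝ) < n := by
    rw [← card_comm₁_add_card_comm₂ π₁]; positivity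
  have hω' : 0 < ω := lt_of_le_of_lt (sq_nonneg r) hω
  have e1 : ∑ i ∈ comm₁ π₁ n, (1 + e) i = (comm₁ π₁ n).card + ∑ i ∈ comm₁ π₁ n, e i := by
    simp [Finset.sum_add_distrib]
  have e2 : ∑ i ∈ comm₂ π₁ n, (1 + e) i = (comm₂ π₁ n).card + ∑ i ∈ comm₂ π₁ n, e i := by
    simp [Finset.sum_add_distrib]
  have e3 : ∑ i ∈ comm₁ π₁ n, (1 - e) i = (comm₁ π₁ n).card - ∑ i ∈ comm₁ π₁ n, e i := by
    simp [Finset.sum_sub_distrib]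
  have e4 : ∑ i ∈ comm₂ π₁ n, (1 - e) i = (comm₂ π₁ n).card - ∑ i ∈ comm₂ π₁ n, e i := by
    simp [Finset.sum_sub_distrib]
  -- Behind the computation: Q = 2 (O₁₁ O₂₂ - O₁₂²) / (O₁ + O₂). The numerator is the Gram
  -- determinant of the community sums of (1 ± e) / 2 under (lam / n) !![1, r; r, ω], equal to (lam
  -- / n)² (ω - r²) (X Y contrast)², and the denominator does not depend on e.
  simp only [modularity, O₁, O₂, O₁₁, O₂₂, O₁₂, dotProduct_blockMatrix_mulVec, e1, e2, e3, e4,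
    contrast]
  generalize ((comm₁ π₁ n).card : ℝ) = X at *
  generalize ((comm₂ π₁ n).card : ℝ) = Y at *
  generalize ∑ i ∈ comm₁ π₁ n, e i = p
  generalize ∑ i ∈ comm₂ π₁ n, e i = q
  have hD : 0 < X ^ 2 + 2 * r * X * Y + ω * Y ^ 2 := by positivity
  have hl : 0 < lam / n := by positivity
  generalize lam / (n : ℝ) = t at *
  have hsum : 1 / 4 * (t * ((X + p) * (X + p) + r * ((X + p) * (Y + q) + (Y + q) * (X + p)) +
      ω * ((Y + q) * (Y + q)))) + 1 / 4 * (t * ((X + p) * (X - p) + r * ((X + p) * (Y - q) +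
      (Y + q) * (X - p)) + ω * ((Y + q) * (Y - q)))) +
      (1 / 4 * (t * ((X - p) * (X - p) + r * ((X - p) * (Y - q) + (Y - q) * (X - p)) +
      ω * ((Y - q) * (Y - q)))) + 1 / 4 * (t * ((X + p) * (X - p) + r * ((X + p) * (Y - q) +
      (Y + q) * (X - p)) + ω * ((Y + q) * (Y - q))))) =
      t * (X ^ 2 + 2 * r * X * Y + ω * Y ^ 2) := by ring
  rw [hsum]
  field_simp
  ring

lemma abs_sum_le_card {e : Fin n → ℝ} (he : ∀ i, |e i| ≤ 1) (s : Finset (Fin n)) :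
    |∑ i ∈ s, e i| ≤ s.card :=
  (Finset.abs_sum_le_sum_abs _ _).trans ((Finset.sum_le_sum fun i _ => he i).trans (by simp))

lemma sqDist_trueLabel (π₁ : ℝ) {e : Fin n → ℝ} (he : ∀ i, e i = 1 ∨ e i = -1) :
    sqDist (trueLabel π₁ n) e =
      2 * (n - |∑ i ∈ comm₁ π₁ n, e i - ∑ i ∈ comm₂ π₁ n, e i|) := by
  have he2 : ∀ i, e i ^ 2 = 1 := fun i => by rcases he i with h | h <;> simp [h]
  have h1 : ∀ j ∈ comm₁ π₁ n, (j : ℕ) < size₁ π₁ n := fun j hj => (Finset.mem_filter.1 hj).2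
  have h2 : ∀ j ∈ comm₂ π₁ n, ¬(j : ℕ) < size₁ π₁ n := fun j hj => (Finset.mem_filter.1 hj).2
  have key : ∀ σ : ℝ, σ ^ 2 = 1 → ∑ i, (σ * trueLabel π₁ n i - e i) ^ 2 =
      2 * (n - σ * (∑ i ∈ comm₁ π₁ n, e i - ∑ i ∈ comm₂ π₁ n, e i)) := by
    intro σ hσ
    rw [← sum_comm₁_add_sum_comm₂ π₁, ← card_comm₁_add_card_comm₂ π₁]
    have a1 : ∑ i ∈ comm₁ π₁ n, (σ * trueLabel π₁ n i - e i) ^ 2 =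
        2 * (comm₁ π₁ n).card - 2 * σ * ∑ i ∈ comm₁ π₁ n, e i := by
      rw [Finset.sum_congr rfl (g := fun i => 2 - 2 * σ * e i), Finset.sum_sub_distrib,
        ← Finset.mul_sum]
      · simp; ring
      · intro i hi
        simp only [trueLabel, if_pos (h1 i hi)]
        linear_combination hσ + he2 i
    have a2 : ∑ i ∈ comm₂ π₁ n, (σ * trueLabel π₁ n i - e i) ^ 2 =
        2 * (comm₂ π₁ n).card + 2 * σ * ∑ i ∈ comm₂ π₁ n, e i := by
      rw [Finset.sum_congr rfl (g := fun i => 2 + 2 * σ * e i), Finset.sum_add_distrib,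
        ← Finset.mul_sum]
      · simp; ring
      · intro i hi
        simp only [trueLabel, if_neg (h2 i hi)]
        linear_combination hσ + he2 i
    rw [a1, a2]; ring
  have k1 := key 1 (by norm_num)
  have k2 := key (-1) (by norm_num)
  simp only [one_mul, neg_one_mul, sub_neg_eq_add] at k1 k2
  rw [sqDist, k1, k2]
  rcases le_total 0 (∑ i ∈ comm₁ π₁ n, e i - ∑ i ∈ comm₂ π₁ n, e i) with h | h
  · rw [abs_of_nonneg h, min_eq_left (by linarith)]
  · rw [abs_of_nonpos h, min_eq_right (by linarith), sub_neg_eq_add]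

/-- Up to a global sign the contrast lies in [0, 1]. Each community's share of the error in n is at
most its error relative to its own size, which gives 4 (1 - contrast), and contrast² ≤ contrast. -/
lemma sqDist_trueLabel_le {π₁ : ℝ} (h1 : 0 < ((comm₁ π₁ n).card : ℝ))
    (h2 : 0 < ((comm₂ π₁ n).card : ℝ)) {e : Fin n → ℝ} (he : ∀ i, e i = 1 ∨ e i = -1) :
    1 / (n : ℝ) * sqDist (trueLabel π₁ n) e ≤ 4 * (1 - contrast π₁ n e ^ 2) := by
  have hn := card_comm₁_add_card_comm₂ (n := n) π₁
  have he1 : ∀ i, |e i| ≤ 1 := fun i => by rcases he i with h | h <;> simp [h]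
  have hp := abs_le.1 (abs_sum_le_card he1 (comm₁ π₁ n))
  have hq := abs_le.1 (abs_sum_le_card he1 (comm₂ π₁ n))
  rw [sqDist_trueLabel π₁ he, contrast, ← hn]
  generalize ((comm₁ π₁ n).card : ℝ) = X at *
  generalize ((comm₂ π₁ n).card : ℝ) = Y at *
  generalize ∑ i ∈ comm₁ π₁ n, e i = p at *
  generalize ∑ i ∈ comm₂ π₁ n, e i = q at *
  have key : ∀ p q : ℝ, -X ≤ p → p ≤ X → -Y ≤ q → q ≤ Y → 0 ≤ (p / X - q / Y) / 2 →
      1 / (X + Y) * (2 * (X + Y - (p - q))) ≤ 4 * (1 - ((p / X - q / Y) / 2) ^ 2) := by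
    intro p q a1 a2 b1 b2 h0
    have c1 : p / X ≤ 1 := (div_le_one h1).2 a2
    have c2 : -1 ≤ q / Y := by rw [le_div_iff₀ h2]; linarith
    have d1 : (X - p) / (X + Y) ≤ 1 - p / X := by
      rw [div_le_iff₀ (by linarith)]
      have : p / X * X = p := by field_simp
      nlinarith
    have d2 : (Y + q) / (X + Y) ≤ 1 + q / Y := by
      rw [div_le_iff₀ (by linarith)]
      have : q / Y * Y = q := by field_simp
      nlinarith
    have d3 : 1 / (X + Y) * (2 * (X + Y - (p - q))) =
        2 * ((X - p) / (X + Y) + (Y + q) / (X + Y)) := by ring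
    rw [d3]
    nlinarith
  rcases le_total 0 ((p / X - q / Y) / 2) with h | h
  · have := key p q hp.1 hp.2 hq.1 hq.2 h
    refine le_trans ?_ this
    have : 0 < 1 / (X + Y) := by positivity
    gcongr
    exact le_abs_self _
  · have := key (-p) (-q) (by linarith [hp.2]) (by linarith [hp.1]) (by linarith [hq.2])
      (by linarith [hq.1]) (by rw [neg_div, neg_div]; linarith)
    have e1 : ((-p / X - -q / Y) / 2) ^ 2 = ((p / X - q / Y) / 2) ^ 2 := by ring
    rw [e1] at this
    refine le_trans ?_ this
    have : 0 < 1 / (X + Y) := by positivity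
    gcongr
    linarith [neg_le_abs (p - q)]

/-- Each wrong label contributes 2² = 4 to the squared distance. -/
lemma misclustered_trueLabel (π₁ : ℝ) {e : Fin n → ℝ} (he : ∀ i, e i = 1 ∨ e i = -1) :
    misclustered (trueLabel π₁ n) e = 1 / 4 * (1 / (n : ℝ) * sqDist (trueLabel π₁ n) e) := by
  have key : ∀ c : Fin n → ℝ, (∀ i, c i = 1 ∨ c i = -1) →
      ({i | e i ≠ c i}.ncard : ℝ) = 1 / 4 * ∑ i, (c i - e i) ^ 2 := by
    intro c hc
    rw [Set.ncard_eq_toFinset_card', Set.toFinset_ofPred, Finset.card_filter, Finset.mul_sum]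
    push_cast
    refine Finset.sum_congr rfl fun i _ => ?_
    rcases he i with h | h <;> rcases hc i with h' | h' <;> norm_num [h, h']
  have hc : ∀ i, trueLabel π₁ n i = 1 ∨ trueLabel π₁ n i = -1 := fun i => by
    simp only [trueLabel]; split_ifs <;> simp
  have k1 := key _ hc
  have k2 := key (fun i => -trueLabel π₁ n i) fun i => by
    rcases hc i with h | h <;> simp [h]
  rw [misclustered, sqDist, k1, k2, ← mul_min_of_nonneg _ _ (by norm_num : (0 : ℝ) ≤ 1 / 4)]
  ring

lemma contrast_trueLabel {π₁ : ℝ} (h1 : 0 < ((comm₁ π₁ n).card : ℝ))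
    (h2 : 0 < ((comm₂ π₁ n).card : ℝ)) : contrast π₁ n (trueLabel π₁ n) = 1 := by
  have e1 : ∑ i ∈ comm₁ π₁ n, trueLabel π₁ n i = (comm₁ π₁ n).card := by
    rw [Finset.sum_congr rfl (g := fun _ => 1)]
    · simp
    · intro i hi; simp [trueLabel, (Finset.mem_filter.1 hi).2]
  have e2 : ∑ i ∈ comm₂ π₁ n, trueLabel π₁ n i = -(comm₂ π₁ n).card := by
    rw [Finset.sum_congr rfl (g := fun _ => -1)]
    · simp
    · intro i hi; rw [trueLabel, if_neg (Finset.mem_filter.1 hi).2]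
  rw [contrast, e1, e2]
  field_simp
  norm_num

end SBM

/-! ### Extreme labels and stability of the modularity maximizer. -/

namespace SBM

variable {n : ℕ}

/-- Every linear functional on the projected cube is maximized at an extreme label vector. -/
lemma exists_extremeLabels_ge (U : Matrix (Fin 2) (Fin n) ℝ) (q : Fin 2 → ℝ) :
    ∃ e ∈ extremeLabels U, ∀ x ∈ Set.Icc (-1 : Fin n → ℝ) 1,
      q ⬝ᵥ U.mulVec x ≤ q ⬝ᵥ U.mulVec e := by
  have hcont : Continuous fun x : Fin n → ℝ => U.mulVec x := by fun_prop
  have hQ : IsCompact (Set.Icc (-1 : Fin n → ℝ) 1) := isCompact_Icc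
  have hK : IsCompact (projCube U) := hQ.image hcont
  have hne : (projCube U).Nonempty :=
    ⟨U.mulVec 0, 0, Set.mem_Icc.2 ⟨fun i => by simp, fun i => by simp⟩, rfl⟩
  let l : StrongDual ℝ (Fin 2 → ℝ) :=
    LinearMap.toContinuousLinearMap (dotProductBilin ℝ ℝ q)
  have hl : ∀ y, l y = q ⬝ᵥ y := fun y => rfl
  have hexp : IsExposed ℝ (projCube U) (l.toExposed (projCube U)) :=
    ContinuousLinearMap.toExposed.isExposed
  obtain ⟨y₀, hy₀, hmax⟩ := hK.exists_isMaxOn hne l.continuous.continuousOn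
  obtain ⟨y, hy⟩ := (hexp.isCompact hK).extremePoints_nonempty ⟨y₀, hy₀, fun z hz => hmax hz⟩
  have hyK : y ∈ (projCube U).extremePoints ℝ :=
    hexp.isExtreme.extremePoints_subset_extremePoints hy
  -- `y` is an extreme point of the face where q is maximal, hence of the projected cube. Its fibre
  -- is then a face of the cube, whose extreme points are vertices, that is, label vectors.
  have hfib : IsExtreme ℝ (Set.Icc (-1 : Fin n → ℝ) 1)
      (Set.Icc (-1) 1 ∩ (fun x => U.mulVec x) ⁻¹' {y}) := by
    refine ⟨Set.inter_subset_left, fun x₁ h₁ x₂ h₂ x hx hseg => ⟨h₁, ?_⟩⟩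
    obtain ⟨a, b, ha, hb, hab, rfl⟩ := hseg
    refine hyK.2 ⟨x₁, h₁, rfl⟩ ⟨x₂, h₂, rfl⟩ ⟨a, b, ha, hb, hab, ?_⟩
    have := hx.2
    simp only [Set.mem_preimage, Set.mem_singleton_iff, Matrix.mulVec_add,
      Matrix.mulVec_smul] at this
    exact this
  have hfc : IsCompact (Set.Icc (-1 : Fin n → ℝ) 1 ∩ (fun x => U.mulVec x) ⁻¹' {y}) :=
    hQ.inter_right (isClosed_singleton.preimage hcont)
  obtain ⟨x₀, hx₀, hx₀y⟩ := hyK.1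
  obtain ⟨e, he⟩ := hfc.extremePoints_nonempty ⟨x₀, hx₀, hx₀y⟩
  have heU : U.mulVec e = y := he.1.2
  have heQ := hfib.extremePoints_subset_extremePoints he
  rw [← Set.pi_univ_Icc, extremePoints_pi] at heQ
  refine ⟨e, ⟨fun i => ?_, heU ▸ hyK⟩, fun x hx => ?_⟩
  · have h := heQ i (Set.mem_univ i)
    simp only [Pi.neg_apply, Pi.one_apply] at h
    rw [Set.extremePoints_Icc (by norm_num)] at h
    rcases h with h | h
    · exact Or.inr h
    · exact Or.inl h
  · rw [heU]
    exact hy.1.2 _ ⟨x, hx, rfl⟩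

lemma mem_Icc_of_eq_one_or {e : Fin n → ℝ} (he : ∀ i, e i = 1 ∨ e i = -1) :
    e ∈ Set.Icc (-1 : Fin n → ℝ) 1 :=
  Set.mem_Icc.2 ⟨fun i => by rcases he i with h | h <;> simp [h],
    fun i => by rcases he i with h | h <;> simp [h]⟩

/-- The modularity maximizer over the extreme labels is close to the truth if the modularity is
close to its mean and the contrast is nearly a function of the projection. -/
lemma sqDist_le_of_isOutput {π₁ r ω lam : ℝ} (hr : 0 ≤ r) (hω : r ^ 2 < ω) (hlam : 0 < lam)
    {A : Matrix (Fin n) (Fin n) ℝ} (hA : ∀ i j, A i j = A j i) (hA0 : ∀ i j, 0 ≤ A i j)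
    (h1 : 0 < ((comm₁ π₁ n).card : ℝ)) (h2 : 0 < ((comm₂ π₁ n).card : ℝ)) {η κ : ℝ} (hκ : 0 < κ)
    (hη : ∀ s : Finset (Fin n),
      |∑ i ∈ s, ∑ j ∈ s, (A i j - blockMatrix π₁ r ω lam n i j)| ≤ η)
    (hκle : κ ≤ lam / n * ((comm₁ π₁ n).card ^ 2 * (comm₂ π₁ n).card ^ 2 * (ω - r ^ 2) /
        ((comm₁ π₁ n).card ^ 2 + 2 * r * (comm₁ π₁ n).card * (comm₂ π₁ n).card +
          ω * (comm₂ π₁ n).card ^ 2)))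
    {U : Matrix (Fin 2) (Fin n) ℝ} {e : Fin n → ℝ} (hout : IsOutput A U e) (q : Fin 2 → ℝ) {ε : ℝ}
    (hq : ∀ f : Fin n → ℝ, (∀ i, f i = 1 ∨ f i = -1) →
      |q ⬝ᵥ U.mulVec f - contrast π₁ n f| ≤ ε) :
    1 / (n : ℝ) * sqDist (trueLabel π₁ n) e ≤ 16 * ε + 52 * (η / κ) := by
  -- The true labels need not be extreme. The competitor `f` is extreme and does at least as well in
  -- q ∘ U, so its contrast is at least 1 - 2ε.
  obtain ⟨f, hf, hfmax⟩ := exists_extremeLabels_ge U q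
  have hc : ∀ i, trueLabel π₁ n i = 1 ∨ trueLabel π₁ n i = -1 := fun i => by
    simp only [trueLabel]; split_ifs <;> simp
  have hω' : 0 ≤ ω := (sq_nonneg r).trans hω.le
  have a1 := abs_le.1 (hq f hf.1)
  have a2 := abs_le.1 (hq _ hc)
  have a3 := hfmax _ (mem_Icc_of_eq_one_or hc)
  rw [contrast_trueLabel h1 h2] at a2
  have a4 : 1 - 2 * ε ≤ contrast π₁ n f := by linarith
  have hPs : ∀ i j, blockMatrix π₁ r ω lam n i j = blockMatrix π₁ r ω lam n j i :=
    fun i j => edgeProb_symm _ _ _ _ i j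
  have hP0 : ∀ i j, 0 ≤ blockMatrix π₁ r ω lam n i j :=
    fun i j => edgeProb_nonneg hr hω' hlam.le i j
  have b1 := abs_le.1 (abs_modularity_sub_le hA hPs hA0 hP0 hout.1.1 hη)
  have b2 := abs_le.1 (abs_modularity_sub_le hA hPs hA0 hP0 hf.1 hη)
  have b3 := hout.2 f hf
  rw [modularity_blockMatrix hr hω hlam h1 h2] at b1 b2
  set κ' := lam / n * ((comm₁ π₁ n).card ^ 2 * (comm₂ π₁ n).card ^ 2 * (ω - r ^ 2) /
        ((comm₁ π₁ n).card ^ 2 + 2 * r * (comm₁ π₁ n).card * (comm₂ π₁ n).card +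
          ω * (comm₂ π₁ n).card ^ 2)) with hκ'
  have hη0 : 0 ≤ η := (abs_nonneg _).trans (hη ∅)
  have b4 : contrast π₁ n f ^ 2 - 13 * (η / κ) ≤ contrast π₁ n e ^ 2 := by
    have c1 : κ' * (contrast π₁ n f ^ 2 - contrast π₁ n e ^ 2) ≤ 13 * η := by nlinarith
    have c2 : contrast π₁ n f ^ 2 - contrast π₁ n e ^ 2 ≤ 13 * η / κ' := by
      rw [le_div_iff₀ (hκ.trans_le hκle)]; linarith
    have c3 : 13 * η / κ' ≤ 13 * η / κ := by gcongr
    have c4 : 13 * η / κ = 13 * (η / κ) := mul_div_assoc _ _ _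
    linarith
  have b5 := sqDist_trueLabel_le h1 h2 hout.1.1
  -- contrast² ≥ 2 contrast - 1 ≥ 1 - 4ε at `f`; the factor 4 of `sqDist_trueLabel_le` then gives 16
  -- ε and 52 η / κ.
  nlinarith [sq_nonneg (contrast π₁ n f - 1)]

end SBM

/-! ### Variational bounds for the eigenvalues after the leading ones. -/

namespace SBM

variable {n : ℕ}

lemma dotProduct_self_nonneg (x : Fin n → ℝ) : 0 ≤ x ⬝ᵥ x :=
  Finset.sum_nonneg fun _ _ => mul_self_nonneg _

lemma dotProduct_self_pos {x : Fin n → ℝ} (hx : x ≠ 0) : 0 < x ⬝ᵥ x :=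
  (dotProduct_self_nonneg x).lt_of_ne fun h => hx (dotProduct_self_eq_zero.1 h.symm)

lemma exists_ne_zero_mulVec_eq_zero {m p : ℕ} (hmp : m < p) (M : Matrix (Fin m) (Fin p) ℝ) :
    ∃ x ≠ 0, M.mulVec x = 0 := by
  have h : LinearMap.ker M.mulVecLin ≠ ⊥ := LinearMap.ker_ne_bot_of_finrank_lt (by simpa using hmp)
  obtain ⟨x, hx, hx0⟩ := Submodule.exists_mem_ne_zero_of_ne_bot h
  exact ⟨x, hx0, by simpa using hx⟩

lemma dotProduct_mulVec_comm_of_symm {B : Matrix (Fin n) (Fin n) ℝ} (hB : ∀ i j, B i j = B j i)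
    (x y : Fin n → ℝ) : x ⬝ᵥ B.mulVec y = y ⬝ᵥ B.mulVec x := by
  rw [dotProduct_mulVec_eq_sum, dotProduct_mulVec_eq_sum, Finset.sum_comm]
  exact Finset.sum_congr rfl fun i _ => Finset.sum_congr rfl fun j _ => by rw [hB]; ring

/-- On the orthogonal complement of two eigenvectors of a symmetric matrix, the quadratic form
is bounded by an eigenvalue with an eigenvector in the complement. -/
lemma exists_eigenvector_orthogonal (hn : 2 < n) {B : Matrix (Fin n) (Fin n) ℝ}
    (hB : ∀ i j, B i j = B j i) {U : Matrix (Fin 2) (Fin n) ℝ} {ρ : Fin 2 → ℝ}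
    (hρ : ∀ k, B.mulVec (U k) = ρ k • U k) :
    ∃ (ν : ℝ) (w : Fin n → ℝ), w ≠ 0 ∧ (∀ k, U k ⬝ᵥ w = 0) ∧ B.mulVec w = ν • w ∧
      ∀ x, (∀ k, U k ⬝ᵥ x = 0) → x ⬝ᵥ B.mulVec x ≤ ν * (x ⬝ᵥ x) := by
  set S : Set (Fin n → ℝ) := {x | x ⬝ᵥ x = 1 ∧ ∀ k, U k ⬝ᵥ x = 0} with hS
  have hscale : ∀ x : Fin n → ℝ, x ≠ 0 → (∀ k, U k ⬝ᵥ x = 0) → (1 / √(x ⬝ᵥ x)) • x ∈ S := by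
    intro x hx hU
    have hx0 := dotProduct_self_pos hx
    refine ⟨?_, fun k => by rw [dotProduct_smul, hU k, smul_zero]⟩
    rw [smul_dotProduct, dotProduct_smul, smul_eq_mul, smul_eq_mul, ← mul_assoc, div_mul_div_comm,
      Real.mul_self_sqrt hx0.le]
    field_simp
  have hne : S.Nonempty := by
    obtain ⟨x, hx, hx0⟩ := exists_ne_zero_mulVec_eq_zero hn U
    exact ⟨_, hscale x hx fun k => congrFun hx0 k⟩
  have hcompact : IsCompact S := by
    refine Metric.isCompact_of_isClosed_isBounded ?_ ?_
    · have h1 : IsClosed {x : Fin n → ℝ | x ⬝ᵥ x = 1} :=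
        isClosed_eq (by unfold dotProduct; fun_prop) continuous_const
      have h2 : IsClosed {x : Fin n → ℝ | ∀ k, U k ⬝ᵥ x = 0} := by
        simp only [Set.ofPred_forall]
        exact isClosed_iInter fun k => isClosed_eq (by unfold dotProduct; fun_prop) continuous_const
      exact h1.inter h2
    · refine (Metric.isBounded_closedBall (x := (0 : Fin n → ℝ)) (r := 1)).subset fun x hx => ?_
      rw [mem_closedBall_zero_iff, pi_norm_le_iff_of_nonneg zero_le_one]
      intro i
      rw [Real.norm_eq_abs]
      refine abs_le_of_sq_le_sq ?_ zero_le_one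
      rw [one_pow, ← hx.1, dotProduct, sq]
      exact Finset.single_le_sum (f := fun i => x i * x i) (fun i _ => mul_self_nonneg _)
        (Finset.mem_univ i)
  obtain ⟨w, hw, hmax⟩ := hcompact.exists_isMaxOn hne
    (f := fun x => x ⬝ᵥ B.mulVec x) (by unfold dotProduct Matrix.mulVec dotProduct; fun_prop)
  set ν := w ⬝ᵥ B.mulVec w with hν
  have hle : ∀ x, (∀ k, U k ⬝ᵥ x = 0) → x ⬝ᵥ B.mulVec x ≤ ν * (x ⬝ᵥ x) := by
    intro x hx
    rcases eq_or_ne x 0 with rfl | hx0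
    · simp
    have h1 : ((1 / √(x ⬝ᵥ x)) • x) ⬝ᵥ B.mulVec ((1 / √(x ⬝ᵥ x)) • x) ≤ ν :=
      hmax (hscale x hx0 hx)
    have h2 := dotProduct_self_pos hx0
    rw [Matrix.mulVec_smul, smul_dotProduct, dotProduct_smul, smul_eq_mul, smul_eq_mul,
      ← mul_assoc, div_mul_div_comm, Real.mul_self_sqrt h2.le, one_mul, one_div,
      inv_mul_le_iff₀ h2] at h1
    linarith
  have hw0 : w ≠ 0 := by
    rintro rfl
    have := hw.1
    simp at this
  refine ⟨ν, w, hw0, hw.2, ?_, hle⟩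
  -- First-order condition at the maximum of the Rayleigh quotient: a quadratic in t that is
  -- nonnegative everywhere and vanishes at 0 has no linear term. The residual itself is an
  -- admissible y, so it is zero.
  have horth : ∀ y, (∀ k, U k ⬝ᵥ y = 0) → y ⬝ᵥ (B.mulVec w - ν • w) = 0 := by
    intro y hy
    have h1 : ∀ t : ℝ, 0 ≤ (ν * (y ⬝ᵥ y) - y ⬝ᵥ B.mulVec y) * (t * t) +
        (-2 * (y ⬝ᵥ (B.mulVec w - ν • w))) * t + 0 := by
      intro t
      have h2 := hle (w + t • y) fun k => by
        rw [dotProduct_add, dotProduct_smul, hw.2 k, hy k]; simp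
      have h3 := hw.1
      simp only [Matrix.mulVec_add, Matrix.mulVec_smul, dotProduct_add, add_dotProduct,
        smul_dotProduct, dotProduct_smul, smul_eq_mul, dotProduct_comm w y,
        dotProduct_mulVec_comm_of_symm hB w y, h3] at h2
      simp only [dotProduct_sub, dotProduct_smul, smul_eq_mul]
      rw [← hν] at h2
      linarith
    have h2 := discrim_le_zero h1
    rw [discrim] at h2
    nlinarith [sq_nonneg (y ⬝ᵥ (B.mulVec w - ν • w))]
  have h1 := horth (B.mulVec w - ν • w) fun k => by
    rw [dotProduct_sub, dotProduct_smul, hw.2 k, dotProduct_mulVec_comm_of_symm hB, hρ k,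
      dotProduct_smul, dotProduct_comm, hw.2 k]
    simp
  exact sub_eq_zero.1 (dotProduct_self_eq_zero.1 h1)

lemma dotProduct_blockMatrix_mulVec_eq_zero (π₁ r ω lam : ℝ) {u : Fin n → ℝ}
    (h1 : ∑ i ∈ comm₁ π₁ n, u i = 0) (h2 : ∑ i ∈ comm₂ π₁ n, u i = 0) :
    u ⬝ᵥ (blockMatrix π₁ r ω lam n).mulVec u = 0 := by
  rw [dotProduct_blockMatrix_mulVec, h1, h2]; simp

/-- The third eigenvalue of a perturbed block matrix is bounded by the perturbation. -/
lemma quadForm_le_of_isLeading {π₁ r ω lam ε : ℝ} (hn : 2 < n) {A : Matrix (Fin n) (Fin n) ℝ}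
    (hA : ∀ i j, A i j = A j i) {U : Matrix (Fin 2) (Fin n) ℝ} (hU : IsLeading A U)
    (hε : ∀ v : Fin n → ℝ, v ⬝ᵥ (A - blockMatrix π₁ r ω lam n).mulVec v ≤ ε * (v ⬝ᵥ v))
    {x : Fin n → ℝ} (hx : ∀ k, U k ⬝ᵥ x = 0) : x ⬝ᵥ A.mulVec x ≤ ε * (x ⬝ᵥ x) := by
  obtain ⟨horth, ρ, hρ, htop⟩ := hU
  obtain ⟨ν, w, hw0, hw, hAw, hν⟩ := exists_eigenvector_orthogonal hn hA hρ
  have hνρ : ∀ k, ν ≤ ρ k := htop w ν hw0 hAw hw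
  refine (hν x hx).trans (mul_le_mul_of_nonneg_right ?_ (dotProduct_self_nonneg x))
  have hw2 := dotProduct_self_pos hw0
  -- Among the combinations of the two rows and `w`, two linear conditions leave a nonzero `u` with
  -- zero sum over each community. There the form of the block matrix vanishes, while that of `A` is
  -- at least ν |u|².
  obtain ⟨t, ht0, ht⟩ := exists_ne_zero_mulVec_eq_zero (by norm_num : 2 < 3)
    (!![∑ i ∈ comm₁ π₁ n, U 0 i, ∑ i ∈ comm₁ π₁ n, U 1 i, ∑ i ∈ comm₁ π₁ n, w i;
      ∑ i ∈ comm₂ π₁ n, U 0 i, ∑ i ∈ comm₂ π₁ n, U 1 i, ∑ i ∈ comm₂ π₁ n, w i])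
  set u : Fin n → ℝ := t 0 • U 0 + t 1 • U 1 + t 2 • w with hu
  have ht1 := congrFun ht 0
  have ht2 := congrFun ht 1
  simp [Matrix.mulVec, dotProduct, Fin.sum_univ_three] at ht1 ht2
  have hu1 : ∑ i ∈ comm₁ π₁ n, u i = 0 := by
    simp only [hu, Pi.add_apply, Pi.smul_apply, smul_eq_mul, Finset.sum_add_distrib,
      ← Finset.mul_sum]
    linarith
  have hu2 : ∑ i ∈ comm₂ π₁ n, u i = 0 := by
    simp only [hu, Pi.add_apply, Pi.smul_apply, smul_eq_mul, Finset.sum_add_distrib,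
      ← Finset.mul_sum]
    linarith
  have h00 : U 0 ⬝ᵥ U 0 = 1 := by simpa using horth 0 0
  have h11 : U 1 ⬝ᵥ U 1 = 1 := by simpa using horth 1 1
  have h01 : U 0 ⬝ᵥ U 1 = 0 := by simpa using horth 0 1
  have h10 : U 1 ⬝ᵥ U 0 = 0 := by simpa using horth 1 0
  have hw' : ∀ k, w ⬝ᵥ U k = 0 := fun k => by rw [dotProduct_comm, hw k]
  have huu : u ⬝ᵥ u = t 0 ^ 2 + t 1 ^ 2 + t 2 ^ 2 * (w ⬝ᵥ w) := by
    simp only [hu, dotProduct_add, add_dotProduct, smul_dotProduct, dotProduct_smul, smul_eq_mul,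
      h00, h11, h01, h10, hw, hw']
    ring
  have huA : u ⬝ᵥ A.mulVec u = ρ 0 * t 0 ^ 2 + ρ 1 * t 1 ^ 2 + ν * (t 2 ^ 2 * (w ⬝ᵥ w)) := by
    simp only [hu, Matrix.mulVec_add, Matrix.mulVec_smul, hρ, hAw, dotProduct_add, add_dotProduct,
      smul_dotProduct, dotProduct_smul, smul_eq_mul, h00, h11, h01, h10, hw, hw']
    ring
  have hpos : 0 < u ⬝ᵥ u := by
    rw [huu]
    have : t 0 ≠ 0 ∨ t 1 ≠ 0 ∨ t 2 ≠ 0 := by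
      by_contra! hcon
      exact ht0 (funext fun i => by fin_cases i <;> simp [hcon])
    rcases this with h | h | h <;> positivity
  have h1 := hε u
  rw [Matrix.sub_mulVec, dotProduct_sub, dotProduct_blockMatrix_mulVec_eq_zero π₁ r ω lam hu1 hu2,
    sub_zero] at h1
  have h2 : ν * (u ⬝ᵥ u) ≤ u ⬝ᵥ A.mulVec u := by
    rw [huu, huA]
    nlinarith [mul_le_mul_of_nonneg_right (hνρ 0) (sq_nonneg (t 0)),
      mul_le_mul_of_nonneg_right (hνρ 1) (sq_nonneg (t 1))]
  exact le_of_mul_le_mul_right (h2.trans h1) hpos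

/-- The quadratic form of a matrix is at most each leading eigenvalue on vectors orthogonal to
the other leading eigenvector. -/
lemma quadForm_le_of_orthogonal (hn : 2 < n) {B : Matrix (Fin n) (Fin n) ℝ}
    (hB : ∀ i j, B i j = B j i) {U : Matrix (Fin 2) (Fin n) ℝ} {ρ : Fin 2 → ℝ}
    (horth : ∀ k l, U k ⬝ᵥ U l = if k = l then 1 else 0)
    (hρ : ∀ k, B.mulVec (U k) = ρ k • U k)
    (htop : ∀ (w : Fin n → ℝ) (ν : ℝ), w ≠ 0 → B.mulVec w = ν • w → (∀ k, U k ⬝ᵥ w = 0) →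
      ∀ k, ν ≤ ρ k)
    {k l : Fin 2} (hkl : k ≠ l) {u : Fin n → ℝ} (hu : U l ⬝ᵥ u = 0) :
    u ⬝ᵥ B.mulVec u ≤ ρ k * (u ⬝ᵥ u) := by
  obtain ⟨ν, w, hw0, hw, hBw, hν⟩ := exists_eigenvector_orthogonal hn hB hρ
  have hνρ : ν ≤ ρ k := htop w ν hw0 hBw hw k
  set t := U k ⬝ᵥ u with ht
  set x := u - t • U k with hx
  have hUkk : U k ⬝ᵥ U k = 1 := by simpa using horth k k
  have hUlk : U l ⬝ᵥ U k = 0 := by simpa [hkl.symm] using horth l k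
  have hxk : U k ⬝ᵥ x = 0 := by
    rw [hx, dotProduct_sub, dotProduct_smul, hUkk, ← ht]; simp
  have hxl : U l ⬝ᵥ x = 0 := by
    rw [hx, dotProduct_sub, dotProduct_smul, hUlk, hu]; simp
  have hxU : ∀ m, U m ⬝ᵥ x = 0 := fun m => by
    have : m = k ∨ m = l := by omega
    rcases this with rfl | rfl <;> assumption
  have hxk' : x ⬝ᵥ U k = 0 := by rw [dotProduct_comm, hxk]
  have hux : u = t • U k + x := by rw [hx]; abel
  have e1 : u ⬝ᵥ u = t ^ 2 + x ⬝ᵥ x := by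
    rw [hux]
    simp only [dotProduct_add, add_dotProduct, smul_dotProduct, dotProduct_smul, smul_eq_mul,
      hUkk, hxk, hxk']
    ring
  have e2 : u ⬝ᵥ B.mulVec u = ρ k * t ^ 2 + x ⬝ᵥ B.mulVec x := by
    rw [hux]
    simp only [Matrix.mulVec_add, Matrix.mulVec_smul, hρ, dotProduct_add, add_dotProduct,
      smul_dotProduct, dotProduct_smul, smul_eq_mul, hUkk, hxk',
      dotProduct_mulVec_comm_of_symm hB (U k) x]
    ring
  rw [e1, e2]
  nlinarith [hν x hxU, mul_le_mul_of_nonneg_right hνρ (dotProduct_self_nonneg x)]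

end SBM

/-! ### Leading eigenvectors of the expected matrix. -/

namespace SBM

variable {n : ℕ}

lemma sq_dotProduct_le (x y : Fin n → ℝ) : (x ⬝ᵥ y) ^ 2 ≤ (x ⬝ᵥ x) * (y ⬝ᵥ y) := by
  have := Finset.sum_mul_sq_le_sq_mul_sq Finset.univ x y
  simpa only [dotProduct, sq] using this

open scoped Matrix.Norms.L2Operator in
lemma specNorm_nonneg {m : ℕ} (X : Matrix (Fin m) (Fin n) ℝ) : 0 ≤ specNorm X := norm_nonneg _

open scoped Matrix.Norms.L2Operator in
lemma dotProduct_mulVec_self_le_specNorm {m : ℕ} (X : Matrix (Fin m) (Fin n) ℝ) (v : Fin n → ℝ) :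
    X.mulVec v ⬝ᵥ X.mulVec v ≤ specNorm X ^ 2 * (v ⬝ᵥ v) := by
  have h := Matrix.l2_opNorm_mulVec X (WithLp.toLp 2 v)
  have h2 := pow_le_pow_left₀ (norm_nonneg _) h 2
  rw [mul_pow, EuclideanSpace.norm_sq_eq, EuclideanSpace.norm_sq_eq] at h2
  simpa [dotProduct, ← sq, specNorm] using h2

/-- The smaller eigenvalue of !![1, r; r, ω] is at least its determinant divided by its trace. -/
lemma quadratic_lower_bound {r ω : ℝ} (hω : r ^ 2 < ω) (x y : ℝ) :
    (ω - r ^ 2) / (1 + ω) * (x ^ 2 + y ^ 2) ≤ x ^ 2 + 2 * r * (x * y) + ω * y ^ 2 := by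
  have h0 : 0 < ω := (sq_nonneg r).trans_lt hω
  rw [div_mul_eq_mul_div, div_le_iff₀ (by linarith)]
  have h1 : 0 ≤ (1 + r ^ 2) * ((x ^ 2 + 2 * r * (x * y) + ω * y ^ 2) * (1 + ω) -
      (ω - r ^ 2) * (x ^ 2 + y ^ 2)) := by
    have : (1 + r ^ 2) * ((x ^ 2 + 2 * r * (x * y) + ω * y ^ 2) * (1 + ω) -
      (ω - r ^ 2) * (x ^ 2 + y ^ 2)) =
      ((1 + r ^ 2) * x + r * (1 + ω) * y) ^ 2 + ((ω - r ^ 2) * y) ^ 2 := by ring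
    rw [this]; positivity
  have h2 := nonneg_of_mul_nonneg_right h1 (by positivity)
  linarith

/-- The leading eigenvectors of the expected matrix are constant on the communities. -/
lemma exists_block_constant_of_isLeading {π₁ r ω lam C : ℝ} (hn : 2 < n) (hω : r ^ 2 < ω)
    (hlam : 0 < lam) {d : Fin n → ℝ} {V : Matrix (Fin 2) (Fin n) ℝ} (hd0 : ∀ i, 0 ≤ d i)
    (hdC : ∀ i, d i ≤ C * lam / n)
    (hd : ∀ i j : Fin n, ((i : ℕ) < size₁ π₁ n ↔ (j : ℕ) < size₁ π₁ n) → d i = d j)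
    (h1 : C < (ω - r ^ 2) / (1 + ω) * (comm₁ π₁ n).card)
    (h2 : C < (ω - r ^ 2) / (1 + ω) * (comm₂ π₁ n).card)
    (hV : IsLeading (blockMatrix π₁ r ω lam n - Matrix.diagonal d) V) :
    ∃ α β : Fin 2 → ℝ, ∀ k, V k = fun i : Fin n => if (i : ℕ) < size₁ π₁ n then α k else β k := by
  obtain ⟨horth, ρ, hρ, htop⟩ := hV
  have hn' : (0 : ℝ) < n := by exact_mod_cast (by omega : 0 < n)
  have hω0 : 0 < ω := (sq_nonneg r).trans_lt hω
  set c₀ := (ω - r ^ 2) / (1 + ω) with hc₀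
  have hc₀pos : 0 < c₀ := div_pos (by linarith) (by linarith)
  have hC0 : 0 ≤ C := by
    have h3 := (hd0 ⟨0, by omega⟩).trans (hdC _)
    rw [mul_div_assoc] at h3
    exact nonneg_of_mul_nonneg_left h3 (by positivity)
  have hX : 0 < ((comm₁ π₁ n).card : ℝ) := by
    by_contra hcon
    nlinarith
  have hY : 0 < ((comm₂ π₁ n).card : ℝ) := by
    by_contra hcon
    nlinarith
  have hsymm : ∀ i j, (blockMatrix π₁ r ω lam n - Matrix.diagonal d) i j =
      (blockMatrix π₁ r ω lam n - Matrix.diagonal d) j i := fun i j => by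
    simp only [Matrix.sub_apply, blockMatrix, Matrix.of_apply, edgeProb_symm π₁ r ω lam i j,
      Matrix.diagonal_apply]
    by_cases hij : i = j
    · simp [hij]
    · simp [hij, Ne.symm hij]
  -- On block-constant vectors the block matrix gains a factor of the community size over the
  -- diagonal correction, hence the conditions on `C`.
  have hquad : ∀ a b : ℝ, (a ≠ 0 ∨ b ≠ 0) →
      0 < (fun i : Fin n => if (i : ℕ) < size₁ π₁ n then a else b) ⬝ᵥ
        (blockMatrix π₁ r ω lam n - Matrix.diagonal d).mulVec
        (fun i : Fin n => if (i : ℕ) < size₁ π₁ n then a else b) := by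
    intro a b hab
    set u : Fin n → ℝ := fun i => if (i : ℕ) < size₁ π₁ n then a else b with hu
    have u1 : ∀ i ∈ comm₁ π₁ n, u i = a := fun i hi => by
      simp only [hu, if_pos (Finset.mem_filter.1 hi).2]
    have u2 : ∀ i ∈ comm₂ π₁ n, u i = b := fun i hi => by
      simp only [hu, if_neg (Finset.mem_filter.1 hi).2]
    have s1 : ∑ i ∈ comm₁ π₁ n, u i = (comm₁ π₁ n).card * a := by
      rw [Finset.sum_congr rfl u1]; simp
    have s2 : ∑ i ∈ comm₂ π₁ n, u i = (comm₂ π₁ n).card * b := by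
      rw [Finset.sum_congr rfl u2]; simp
    have hD : u ⬝ᵥ (Matrix.diagonal d).mulVec u ≤
        C * lam / n * ((comm₁ π₁ n).card * a ^ 2 + (comm₂ π₁ n).card * b ^ 2) := by
      have e1 : ∑ i ∈ comm₁ π₁ n, u i * (d i * u i) ≤
          C * lam / n * ((comm₁ π₁ n).card * a ^ 2) := by
        calc _ ≤ ∑ i ∈ comm₁ π₁ n, C * lam / n * a ^ 2 := by
              refine Finset.sum_le_sum fun i hi => ?_
              rw [u1 i hi]
              nlinarith [mul_le_mul_of_nonneg_right (hdC i) (sq_nonneg a)]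
          _ = _ := by simp; ring
      have e2 : ∑ i ∈ comm₂ π₁ n, u i * (d i * u i) ≤
          C * lam / n * ((comm₂ π₁ n).card * b ^ 2) := by
        calc _ ≤ ∑ i ∈ comm₂ π₁ n, C * lam / n * b ^ 2 := by
              refine Finset.sum_le_sum fun i hi => ?_
              rw [u2 i hi]
              nlinarith [mul_le_mul_of_nonneg_right (hdC i) (sq_nonneg b)]
          _ = _ := by simp; ring
      rw [dotProduct, ← sum_comm₁_add_sum_comm₂ π₁]
      simp only [Matrix.mulVec_diagonal]
      linarith
    rw [Matrix.sub_mulVec, dotProduct_sub, dotProduct_blockMatrix_mulVec, s1, s2]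
    have hq := quadratic_lower_bound hω ((comm₁ π₁ n).card * a) ((comm₂ π₁ n).card * b)
    rw [← hc₀] at hq
    have hl : 0 < lam / n := by positivity
    have hmain : C * ((comm₁ π₁ n).card * a ^ 2 + (comm₂ π₁ n).card * b ^ 2) <
        c₀ * (((comm₁ π₁ n).card * a) ^ 2 + ((comm₂ π₁ n).card * b) ^ 2) := by
      have m1 : ∀ z w : ℝ, 0 < z → C < c₀ * z → w ≠ 0 → C * (z * w ^ 2) < c₀ * (z * w) ^ 2 := by
        intro z w hz hCz hw
        have : 0 < z * w ^ 2 := by positivity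
        nlinarith
      have m2 : ∀ z w : ℝ, 0 < z → C < c₀ * z → C * (z * w ^ 2) ≤ c₀ * (z * w) ^ 2 := by
        intro z w hz hCz
        have : 0 ≤ z * w ^ 2 := by positivity
        nlinarith
      rcases hab with h | h
      · linarith [m1 _ a hX h1 h, m2 _ b hY h2]
      · linarith [m2 _ a hX h1, m1 _ b hY h2 h]
    have h3 : C * lam / n * ((comm₁ π₁ n).card * a ^ 2 + (comm₂ π₁ n).card * b ^ 2) =
        lam / n * (C * ((comm₁ π₁ n).card * a ^ 2 + (comm₂ π₁ n).card * b ^ 2)) := by ring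
    rw [h3] at hD
    have h4 := mul_lt_mul_of_pos_left (hmain.trans_le hq) hl
    nlinarith
  -- The block-constant vectors form a plane, so a nonzero one is orthogonal to the other row; the
  -- form is positive there and at most ρ k |u|².
  have hρpos : ∀ k, 0 < ρ k := by
    intro k
    obtain ⟨l, hkl⟩ := exists_ne k
    obtain ⟨t, ht0, ht⟩ := exists_ne_zero_mulVec_eq_zero (by norm_num : 1 < 2)
      !![∑ i ∈ comm₁ π₁ n, V l i, ∑ i ∈ comm₂ π₁ n, V l i]
    have ht1 := congrFun ht 0
    simp [Matrix.mulVec, dotProduct, Fin.sum_univ_two] at ht1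
    have ht2 : t 0 ≠ 0 ∨ t 1 ≠ 0 := by
      by_contra! hcon
      exact ht0 (funext fun i => by fin_cases i <;> simp [hcon])
    have h3 := hquad (t 0) (t 1) ht2
    have h4 := quadForm_le_of_orthogonal hn hsymm horth hρ htop hkl.symm
      (u := fun i : Fin n => if (i : ℕ) < size₁ π₁ n then t 0 else t 1) (by
        rw [dotProduct, ← sum_comm₁_add_sum_comm₂ π₁, ← ht1, Finset.sum_mul, Finset.sum_mul]
        congr 1
        · exact Finset.sum_congr rfl fun i hi => by rw [if_pos (Finset.mem_filter.1 hi).2]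
        · exact Finset.sum_congr rfl fun i hi => by rw [if_neg (Finset.mem_filter.1 hi).2])
    by_contra hcon
    exact absurd (h3.trans_le h4) (not_lt.2
      (mul_nonpos_of_nonpos_of_nonneg (not_lt.1 hcon) (dotProduct_self_nonneg _)))
  -- Rows of the block matrix within a community coincide, so the two eigenvector equations differ
  -- only by (ρ k + d j) (V k i - V k j) = 0.
  have hconst : ∀ k (i j : Fin n), ((i : ℕ) < size₁ π₁ n ↔ (j : ℕ) < size₁ π₁ n) →
      V k i = V k j := by
    intro k i j hij
    have h3 := congrFun (hρ k) i
    have h4 := congrFun (hρ k) j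
    simp only [Matrix.sub_mulVec, Pi.sub_apply, blockMatrix_mulVec, Matrix.mulVec_diagonal,
      Pi.smul_apply, smul_eq_mul, hij, hd i j hij] at h3 h4
    have h5 : (ρ k + d j) * (V k i - V k j) = 0 := by linarith
    rcases mul_eq_zero.1 h5 with h | h
    · linarith [hρpos k, hd0 j]
    · linarith
  obtain ⟨i₁, hi₁⟩ := Finset.card_pos.1 (by exact_mod_cast hX : 0 < (comm₁ π₁ n).card)
  obtain ⟨i₂, hi₂⟩ := Finset.card_pos.1 (by exact_mod_cast hY : 0 < (comm₂ π₁ n).card)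
  refine ⟨fun k => V k i₁, fun k => V k i₂, fun k => funext fun i => ?_⟩
  split_ifs with h
  · exact hconst k i i₁ (by simp [h, (Finset.mem_filter.1 hi₁).2])
  · exact hconst k i i₂ (by simpa [h] using (Finset.mem_filter.1 hi₂).2)

/-- The contrast is a function of the projection by block-constant orthonormal rows, and nearly
one of any nearby projection. -/
lemma exists_dotProduct_near_contrast {π₁ c : ℝ} (hn : 0 < n) (hc : 0 < c)
    (h1 : c * n ≤ (comm₁ π₁ n).card) (h2 : c * n ≤ (comm₂ π₁ n).card)
    {V : Matrix (Fin 2) (Fin n) ℝ} (horth : ∀ k l, V k ⬝ᵥ V l = if k = l then 1 else 0)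
    {α β : Fin 2 → ℝ} (hV : ∀ k, V k = fun i : Fin n => if (i : ℕ) < size₁ π₁ n then α k else β k)
    (U : Matrix (Fin 2) (Fin n) ℝ) :
    ∃ q : Fin 2 → ℝ, ∀ f : Fin n → ℝ, (∀ i, f i = 1 ∨ f i = -1) →
      |q ⬝ᵥ U.mulVec f - contrast π₁ n f| ≤ 1 / √(2 * c) * specNorm (U - V) := by
  have hn' : (0 : ℝ) < n := by exact_mod_cast hn
  have hX : 0 < ((comm₁ π₁ n).card : ℝ) := lt_of_lt_of_le (by positivity) h1
  have hY : 0 < ((comm₂ π₁ n).card : ℝ) := lt_of_lt_of_le (by positivity) h2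
  have hVf : ∀ k (f : Fin n → ℝ), V k ⬝ᵥ f =
      α k * ∑ i ∈ comm₁ π₁ n, f i + β k * ∑ i ∈ comm₂ π₁ n, f i := by
    intro k f
    rw [hV k, dotProduct, ← sum_comm₁_add_sum_comm₂ π₁, Finset.mul_sum, Finset.mul_sum]
    congr 1
    · exact Finset.sum_congr rfl fun i hi => by rw [if_pos (Finset.mem_filter.1 hi).2]
    · exact Finset.sum_congr rfl fun i hi => by rw [if_neg (Finset.mem_filter.1 hi).2]
  have hVV : ∀ k l, α k * α l * (comm₁ π₁ n).card + β k * β l * (comm₂ π₁ n).card =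
      if k = l then 1 else 0 := by
    intro k l
    rw [← horth k l, hVf]
    have e1 : ∑ i ∈ comm₁ π₁ n, V l i = (comm₁ π₁ n).card * α l := by
      rw [Finset.sum_congr rfl (g := fun _ => α l)]
      · simp
      · intro i hi; simp only [hV l, if_pos (Finset.mem_filter.1 hi).2]
    have e2 : ∑ i ∈ comm₂ π₁ n, V l i = (comm₂ π₁ n).card * β l := by
      rw [Finset.sum_congr rfl (g := fun _ => β l)]
      · simp
      · intro i hi; simp only [hV l, if_neg (Finset.mem_filter.1 hi).2]
    rw [e1, e2]; ring
  have hcontr : ∀ f, contrast π₁ n f = ((∑ i ∈ comm₁ π₁ n, f i) / (comm₁ π₁ n).card -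
    (∑ i ∈ comm₂ π₁ n, f i) / (comm₂ π₁ n).card) / 2 := fun f => rfl
  generalize ((comm₁ π₁ n).card : ℝ) = X at *
  generalize ((comm₂ π₁ n).card : ℝ) = Y at *
  have hsq : √X ^ 2 = X := Real.sq_sqrt hX.le
  have hsq' : √Y ^ 2 = Y := Real.sq_sqrt hY.le
  have hsX : 0 < √X := Real.sqrt_pos.2 hX
  have hsY : 0 < √Y := Real.sqrt_pos.2 hY
  -- Scaled by √X and √Y, the values of the two rows form an orthogonal matrix; orthonormality of
  -- its columns is what inverts the projection.
  have hmat : !![√X * α 0, √Y * β 0; √X * α 1, √Y * β 1] *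
      !![√X * α 0, √X * α 1; √Y * β 0, √Y * β 1] = (1 : Matrix (Fin 2) (Fin 2) ℝ) := by
    have a00 := hVV 0 0
    have a01 := hVV 0 1
    have a11 := hVV 1 1
    simp at a00 a01 a11
    ext i j
    fin_cases i <;> fin_cases j <;> simp [Matrix.mul_apply, Fin.sum_univ_two]
    · linear_combination a00 + α 0 * α 0 * hsq + β 0 * β 0 * hsq'
    · linear_combination a01 + α 0 * α 1 * hsq + β 0 * β 1 * hsq'
    · linear_combination a01 + α 0 * α 1 * hsq + β 0 * β 1 * hsq'
    · linear_combination a11 + α 1 * α 1 * hsq + β 1 * β 1 * hsq'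
  have hmat' := mul_eq_one_comm.1 hmat
  have b00 : (α 0 ^ 2 + α 1 ^ 2) * X = 1 := by
    have := congrFun (congrFun hmat' 0) 0
    simp [Matrix.mul_apply, Fin.sum_univ_two] at this
    rw [← hsq]; linarith
  have b11 : (β 0 ^ 2 + β 1 ^ 2) * Y = 1 := by
    have := congrFun (congrFun hmat' 1) 1
    simp [Matrix.mul_apply, Fin.sum_univ_two] at this
    rw [← hsq']; linarith
  have b01 : α 0 * β 0 + α 1 * β 1 = 0 := by
    have := congrFun (congrFun hmat' 0) 1
    simp [Matrix.mul_apply, Fin.sum_univ_two] at this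
    have h3 : (√X * √Y) * (α 0 * β 0 + α 1 * β 1) = 0 := by linarith
    exact (mul_eq_zero.1 h3).resolve_left (by positivity)
  have b00' : α 0 ^ 2 + α 1 ^ 2 = 1 / X := by field_simp; linarith
  have b11' : β 0 ^ 2 + β 1 ^ 2 = 1 / Y := by field_simp; linarith
  -- Half the coordinates, in the basis `V`, of the vector with values 1 / X and -1 / Y, which
  -- represents twice the contrast.
  set q : Fin 2 → ℝ := fun k => (α k - β k) / 2 with hq
  have hqV : ∀ f, q ⬝ᵥ V.mulVec f = contrast π₁ n f := by
    intro f
    rw [hcontr]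
    have e1 : ∀ k, V.mulVec f k = V k ⬝ᵥ f := fun k => rfl
    simp only [dotProduct, Fin.sum_univ_two, hq]
    rw [e1, e1, hVf, hVf, div_eq_mul_one_div _ X, div_eq_mul_one_div _ Y, ← b00', ← b11']
    linear_combination (1 / 2) * (∑ i ∈ comm₂ π₁ n, f i - ∑ i ∈ comm₁ π₁ n, f i) * b01
  have hqq : q ⬝ᵥ q = (1 / X + 1 / Y) / 4 := by
    simp only [dotProduct, Fin.sum_univ_two, hq]
    rw [← b00', ← b11']
    linear_combination (-1 / 2) * b01
  refine ⟨q, fun f hf => ?_⟩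
  have hff : f ⬝ᵥ f = n := by
    have : ∀ i, f i * f i = 1 := fun i => by rcases hf i with h | h <;> simp [h]
    simp [dotProduct, this]
  rw [← hqV, ← dotProduct_sub, ← Matrix.sub_mulVec]
  have hs0 := specNorm_nonneg (U - V)
  refine abs_le_of_sq_le_sq ?_ (by positivity)
  have hc2 : √(2 * c) ^ 2 = 2 * c := Real.sq_sqrt (by positivity)
  calc (q ⬝ᵥ (U - V).mulVec f) ^ 2 ≤ (q ⬝ᵥ q) * ((U - V).mulVec f ⬝ᵥ (U - V).mulVec f) :=
        sq_dotProduct_le _ _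
    _ ≤ ((1 / (c * n) + 1 / (c * n)) / 4) * (specNorm (U - V) ^ 2 * n) := by
        rw [hqq]
        have := dotProduct_mulVec_self_le_specNorm (U - V) f
        rw [hff] at this
        have h3 := dotProduct_self_nonneg ((U - V).mulVec f)
        gcongr
    _ = (1 / √(2 * c) * specNorm (U - V)) ^ 2 := by
        rw [mul_pow, div_pow, hc2]; field_simp; ring

end SBM

/-! ### A one-sided Davis–Kahan argument for the observed eigenvectors. -/

namespace SBM

variable {n : ℕ}

lemma two_mul_dotProduct_le {t : ℝ} (ht : 0 < t) (a g : Fin n → ℝ) :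
    2 * (a ⬝ᵥ g) ≤ t * (a ⬝ᵥ a) + (g ⬝ᵥ g) / t := by
  have h := dotProduct_self_nonneg (t • a - g)
  simp only [dotProduct_sub, sub_dotProduct, smul_dotProduct, dotProduct_smul, smul_eq_mul,
    dotProduct_comm g a] at h
  have e : t * (a ⬝ᵥ a) + (g ⬝ᵥ g) / t - 2 * (a ⬝ᵥ g) =
      (t * (t * (a ⬝ᵥ a) - a ⬝ᵥ g) - (t * (a ⬝ᵥ g) - g ⬝ᵥ g)) / t := by field_simp; ring
  have := div_nonneg h ht.le
  linarith

/-- A one-sided Davis–Kahan estimate: the components of the community indicators orthogonal to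
the leading eigenvectors are small. -/
lemma dotProduct_self_orthogonal_le {π₁ r ω lam c S : ℝ} (hω : r ^ 2 < ω) (hlam : 0 < lam)
    (hn : 0 < n) (hc : 0 < c) (h1 : c * n ≤ (comm₁ π₁ n).card) (h2 : c * n ≤ (comm₂ π₁ n).card)
    {A : Matrix (Fin n) (Fin n) ℝ} {u₁ u₂ a b : Fin n → ℝ}
    (hu₁ : u₁ = fun i => if i ∈ comm₁ π₁ n then 1 else 0)
    (hu₂ : u₂ = fun i => if i ∈ comm₂ π₁ n then 1 else 0)
    (haa : a ⬝ᵥ u₁ = a ⬝ᵥ a) (hab : a ⬝ᵥ u₂ = a ⬝ᵥ b) (hba : b ⬝ᵥ u₁ = a ⬝ᵥ b)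
    (hbb : b ⬝ᵥ u₂ = b ⬝ᵥ b)
    (haA : a ⬝ᵥ A.mulVec u₁ = a ⬝ᵥ A.mulVec a) (hbA : b ⬝ᵥ A.mulVec u₂ = b ⬝ᵥ A.mulVec b)
    (ha : a ⬝ᵥ A.mulVec a ≤ (ω - r ^ 2) / (1 + ω) * c / 2 * lam * (a ⬝ᵥ a))
    (hb : b ⬝ᵥ A.mulVec b ≤ (ω - r ^ 2) / (1 + ω) * c / 2 * lam * (b ⬝ᵥ b))
    (hS₁ : (A - blockMatrix π₁ r ω lam n).mulVec u₁ ⬝ᵥ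
      (A - blockMatrix π₁ r ω lam n).mulVec u₁ ≤ S * (n * lam))
    (hS₂ : (A - blockMatrix π₁ r ω lam n).mulVec u₂ ⬝ᵥ
      (A - blockMatrix π₁ r ω lam n).mulVec u₂ ≤ S * (n * lam)) :
    a ⬝ᵥ a + b ⬝ᵥ b ≤ 8 * S * n / (((ω - r ^ 2) / (1 + ω)) ^ 2 * c ^ 2 * lam) := by
  have hn' : (0 : ℝ) < n := by exact_mod_cast hn
  have hX : 0 < ((comm₁ π₁ n).card : ℝ) := lt_of_lt_of_le (by positivity) h1
  have hY : 0 < ((comm₂ π₁ n).card : ℝ) := lt_of_lt_of_le (by positivity) h2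
  have hω0 : 0 < ω := (sq_nonneg r).trans_lt hω
  have hdisj : ∀ i, i ∈ comm₁ π₁ n → i ∉ comm₂ π₁ n := fun i hi hi' =>
    (Finset.mem_filter.1 hi').2 (Finset.mem_filter.1 hi).2
  have s11 : ∑ i ∈ comm₁ π₁ n, u₁ i = (comm₁ π₁ n).card := by
    rw [Finset.sum_congr rfl (g := fun _ => 1) fun i hi => by simp [hu₁, hi]]; simp
  have s12 : ∑ i ∈ comm₁ π₁ n, u₂ i = 0 :=
    Finset.sum_eq_zero fun i hi => by simp [hu₂, hdisj i hi]
  have s21 : ∑ i ∈ comm₂ π₁ n, u₁ i = 0 :=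
    Finset.sum_eq_zero fun i hi => by
      have h : i ∉ comm₁ π₁ n := fun h => hdisj i h hi
      simp [hu₁, h]
  have s22 : ∑ i ∈ comm₂ π₁ n, u₂ i = (comm₂ π₁ n).card := by
    rw [Finset.sum_congr rfl (g := fun _ => 1) fun i hi => by simp [hu₂, hi]]; simp
  have hdot1 : ∀ v : Fin n → ℝ, v ⬝ᵥ u₁ = ∑ i ∈ comm₁ π₁ n, v i := fun v => by
    simp [dotProduct, hu₁]
  have hdot2 : ∀ v : Fin n → ℝ, v ⬝ᵥ u₂ = ∑ i ∈ comm₂ π₁ n, v i := fun v => by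
    simp [dotProduct, hu₂]
  have hP1 : a ⬝ᵥ (blockMatrix π₁ r ω lam n).mulVec u₁ =
      (comm₁ π₁ n).card * (lam / n * (a ⬝ᵥ a + r * (a ⬝ᵥ b))) := by
    rw [dotProduct_blockMatrix_mulVec, s11, s21, ← hdot1, ← hdot2, haa, hab]; ring
  have hP2 : b ⬝ᵥ (blockMatrix π₁ r ω lam n).mulVec u₂ =
      (comm₂ π₁ n).card * (lam / n * (r * (a ⬝ᵥ b) + ω * (b ⬝ᵥ b))) := by
    rw [dotProduct_blockMatrix_mulVec, s12, s22, ← hdot1, ← hdot2, hba, hbb]; ring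
  set c₀ := (ω - r ^ 2) / (1 + ω) with hc₀
  have hc₀pos : 0 < c₀ := div_pos (by linarith) (by linarith)
  have hquad : c₀ * (a ⬝ᵥ a + b ⬝ᵥ b) ≤ a ⬝ᵥ a + 2 * r * (a ⬝ᵥ b) + ω * (b ⬝ᵥ b) := by
    simp only [dotProduct, Finset.mul_sum, ← Finset.sum_add_distrib]
    refine Finset.sum_le_sum fun i _ => ?_
    have := quadratic_lower_bound hω (a i) (b i)
    rw [← hc₀] at this
    nlinarith
  set g₁ := (A - blockMatrix π₁ r ω lam n).mulVec u₁ with hg₁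
  set g₂ := (A - blockMatrix π₁ r ω lam n).mulVec u₂ with hg₂
  -- Divided by the community sizes and added, the left sides of `k1` and `k2` give lam / n times
  -- the form of !![1, r; r, ω] at (a, b), which `hquad` bounds below.
  have k1 : (comm₁ π₁ n).card * (lam / n * (a ⬝ᵥ a + r * (a ⬝ᵥ b))) =
      a ⬝ᵥ A.mulVec a - a ⬝ᵥ g₁ := by
    rw [← hP1, hg₁, Matrix.sub_mulVec, dotProduct_sub, haA]; ring
  have k2 : (comm₂ π₁ n).card * (lam / n * (r * (a ⬝ᵥ b) + ω * (b ⬝ᵥ b))) =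
      b ⬝ᵥ A.mulVec b - b ⬝ᵥ g₂ := by
    rw [← hP2, hg₂, Matrix.sub_mulVec, dotProduct_sub, hbA]; ring
  -- The bound assumed on the form of `A` costs t |v|², and Young's inequality with weight t costs t
  -- |v|² / 2 more. Together they use three quarters of the lower bound; the last quarter yields the
  -- estimate.
  set t := c₀ * c * lam / 2 with ht
  have ht0 : 0 < t := by positivity
  have ha0 := dotProduct_self_nonneg a
  have hb0 := dotProduct_self_nonneg b
  have bound : ∀ (v g : Fin n → ℝ) (X z : ℝ), c * n ≤ X → X * z = v ⬝ᵥ A.mulVec v - v ⬝ᵥ g →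
      v ⬝ᵥ A.mulVec v ≤ c₀ * c / 2 * lam * (v ⬝ᵥ v) → g ⬝ᵥ g ≤ S * (n * lam) →
      z ≤ 3 / 4 * c₀ * (lam / n) * (v ⬝ᵥ v) + S * lam / (2 * t * c) := by
    intro v g X z hX hz hv hg
    have e1 := two_mul_dotProduct_le ht0 (-v) g
    rw [neg_dotProduct, neg_dotProduct_neg] at e1
    have e2 : g ⬝ᵥ g / t ≤ S * (n * lam) / t := by gcongr
    have hv0 := dotProduct_self_nonneg v
    have e3 : X * z ≤ 3 / 2 * t * (v ⬝ᵥ v) + S * (n * lam) / t / 2 := by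
      have e4 : c₀ * c / 2 * lam * (v ⬝ᵥ v) = t * (v ⬝ᵥ v) := by rw [ht]; ring
      linarith
    have hXpos : 0 < X := lt_of_lt_of_le (by positivity) hX
    have hSn : 0 ≤ S * (n * lam) := (dotProduct_self_nonneg g).trans hg
    have e5 : 0 ≤ 3 / 2 * t * (v ⬝ᵥ v) + S * (n * lam) / t / 2 := by positivity
    calc z ≤ (3 / 2 * t * (v ⬝ᵥ v) + S * (n * lam) / t / 2) / X := by
          rw [le_div_iff₀ hXpos]; linarith
      _ ≤ (3 / 2 * t * (v ⬝ᵥ v) + S * (n * lam) / t / 2) / (c * n) := by gcongr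
      _ = _ := by rw [ht]; field_simp; ring
  have m1 := bound a g₁ _ _ h1 k1 ha hS₁
  have m2 := bound b g₂ _ _ h2 k2 hb hS₂
  have hl : 0 < lam / n := by positivity
  have m3 := mul_le_mul_of_nonneg_left hquad hl.le
  have m4 : c₀ * (lam / n) / 4 * (a ⬝ᵥ a + b ⬝ᵥ b) ≤ 2 * (S * lam / (2 * t * c)) := by linarith
  have m5 : 2 * (S * lam / (2 * t * c)) = c₀ * (lam / n) / 4 *
      (8 * S * n / (c₀ ^ 2 * c ^ 2 * lam)) := by
    rw [ht]; field_simp; ring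
  rw [m5] at m4
  exact le_of_mul_le_mul_left m4 (by positivity)

/-- The contrast is nearly a function of the projection on the leading eigenvectors of a matrix
close to the block matrix. -/
lemma exists_dotProduct_near_contrast_of_isLeading {π₁ r ω lam c S : ℝ} (hω : r ^ 2 < ω)
    (hlam : 0 < lam) (hn : 2 < n) (hc : 0 < c) (h1 : c * n ≤ (comm₁ π₁ n).card)
    (h2 : c * n ≤ (comm₂ π₁ n).card) {A : Matrix (Fin n) (Fin n) ℝ} (hA : ∀ i j, A i j = A j i)
    {U : Matrix (Fin 2) (Fin n) ℝ} (hU : IsLeading A U)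
    (hquad : ∀ v : Fin n → ℝ, v ⬝ᵥ (A - blockMatrix π₁ r ω lam n).mulVec v ≤
      (ω - r ^ 2) / (1 + ω) * c / 2 * lam * (v ⬝ᵥ v))
    (hS₁ : ∑ i, (∑ j ∈ comm₁ π₁ n, (A i j - blockMatrix π₁ r ω lam n i j)) ^ 2 ≤ S * (n * lam))
    (hS₂ : ∑ i, (∑ j ∈ comm₂ π₁ n, (A i j - blockMatrix π₁ r ω lam n i j)) ^ 2 ≤ S * (n * lam)) :
    ∃ q : Fin 2 → ℝ, ∀ f : Fin n → ℝ, (∀ i, f i = 1 ∨ f i = -1) →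
      |q ⬝ᵥ U.mulVec f - contrast π₁ n f| ≤
        2 * √S / ((ω - r ^ 2) / (1 + ω) * c ^ 2) / √lam := by
  have hn' : (0 : ℝ) < n := by exact_mod_cast (by omega : 0 < n)
  have hX : 0 < ((comm₁ π₁ n).card : ℝ) := lt_of_lt_of_le (by positivity) h1
  have hY : 0 < ((comm₂ π₁ n).card : ℝ) := lt_of_lt_of_le (by positivity) h2
  have hω0 : 0 < ω := (sq_nonneg r).trans_lt hω
  have hthird := fun x hx => quadForm_le_of_isLeading (x := x) hn hA hU hquad hx
  obtain ⟨horth, ρ, hρ, -⟩ := hU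
  have h00 : U 0 ⬝ᵥ U 0 = 1 := by simpa using horth 0 0
  have h11 : U 1 ⬝ᵥ U 1 = 1 := by simpa using horth 1 1
  have h01 : U 0 ⬝ᵥ U 1 = 0 := by simpa using horth 0 1
  have h10 : U 1 ⬝ᵥ U 0 = 0 := by simpa using horth 1 0
  -- Orthogonal projection onto the complement of the rows; the rows are eigenvectors, so `A`
  -- respects the splitting and the cross terms vanish.
  set N : (Fin n → ℝ) → (Fin n → ℝ) := fun v => v - (U 0 ⬝ᵥ v) • U 0 - (U 1 ⬝ᵥ v) • U 1 with hN
  have hNU : ∀ v k, U k ⬝ᵥ N v = 0 := by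
    intro v k
    fin_cases k <;> simp [hN, dotProduct_sub, h00, h11, h01, h10]
  have hNU' : ∀ v k, N v ⬝ᵥ U k = 0 := fun v k => by rw [dotProduct_comm, hNU]
  have hNN : ∀ v w, N v ⬝ᵥ N w = N v ⬝ᵥ w := by
    intro v w
    change N v ⬝ᵥ (w - (U 0 ⬝ᵥ w) • U 0 - (U 1 ⬝ᵥ w) • U 1) = _
    rw [dotProduct_sub, dotProduct_sub, dotProduct_smul, dotProduct_smul, hNU', hNU']
    simp
  have hNA : ∀ v, N v ⬝ᵥ A.mulVec (N v) = N v ⬝ᵥ A.mulVec v := by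
    intro v
    have e : A.mulVec (N v) = A.mulVec v - (U 0 ⬝ᵥ v) • ρ 0 • U 0 - (U 1 ⬝ᵥ v) • ρ 1 • U 1 := by
      simp only [hN, Matrix.mulVec_sub, Matrix.mulVec_smul, hρ]
    rw [e, dotProduct_sub, dotProduct_sub]
    simp only [dotProduct_smul, hNU', smul_zero, sub_zero]
  set u₁ : Fin n → ℝ := fun i => if i ∈ comm₁ π₁ n then 1 else 0 with hu₁
  set u₂ : Fin n → ℝ := fun i => if i ∈ comm₂ π₁ n then 1 else 0 with hu₂
  have g1 : (A - blockMatrix π₁ r ω lam n).mulVec u₁ ⬝ᵥ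
      (A - blockMatrix π₁ r ω lam n).mulVec u₁ ≤ S * (n * lam) := by
    refine le_trans (le_of_eq ?_) hS₁
    simp [dotProduct, Matrix.mulVec, hu₁, sq]
  have g2 : (A - blockMatrix π₁ r ω lam n).mulVec u₂ ⬝ᵥ
      (A - blockMatrix π₁ r ω lam n).mulVec u₂ ≤ S * (n * lam) := by
    refine le_trans (le_of_eq ?_) hS₂
    simp [dotProduct, Matrix.mulVec, hu₂, sq]
  have hS0 : 0 ≤ S := by
    have := (dotProduct_self_nonneg _).trans g1
    exact nonneg_of_mul_nonneg_left this (by positivity)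
  have hR := dotProduct_self_orthogonal_le hω hlam (by omega) hc h1 h2 (A := A) hu₁ hu₂
    (a := N u₁) (b := N u₂) (hNN _ _).symm (hNN _ _).symm
    (by rw [dotProduct_comm (N u₁), hNN]) (hNN _ _).symm (hNA _).symm (hNA _).symm
    (hthird _ (hNU _)) (hthird _ (hNU _)) g1 g2
  set c₀ := (ω - r ^ 2) / (1 + ω) with hc₀
  have hc₀pos : 0 < c₀ := div_pos (by linarith) (by linarith)
  set X := ((comm₁ π₁ n).card : ℝ) with hXdef
  set Y := ((comm₂ π₁ n).card : ℝ) with hYdef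
  set w : Fin n → ℝ := (1 / X) • u₁ - (1 / Y) • u₂ with hw
  have hNw : N w = (1 / X) • N u₁ - (1 / Y) • N u₂ := by
    simp only [hN, hw, dotProduct_sub, dotProduct_smul, smul_sub, sub_smul, smul_smul, smul_eq_mul]
    abel
  -- `w` represents twice the contrast and its coordinates along the rows give q, so the error is
  -- exactly the orthogonal remainder `N w` paired with f.
  refine ⟨fun k => (U k ⬝ᵥ w) / 2, fun f hf => ?_⟩
  have hff : f ⬝ᵥ f = n := by
    have : ∀ i, f i * f i = 1 := fun i => by rcases hf i with h | h <;> simp [h]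
    simp [dotProduct, this]
  have hcontr : contrast π₁ n f = w ⬝ᵥ f / 2 := by
    have e1 : u₁ ⬝ᵥ f = ∑ i ∈ comm₁ π₁ n, f i := by simp [dotProduct, hu₁]
    have e2 : u₂ ⬝ᵥ f = ∑ i ∈ comm₂ π₁ n, f i := by simp [dotProduct, hu₂]
    rw [hw, sub_dotProduct, smul_dotProduct, smul_dotProduct, e1, e2, contrast, smul_eq_mul,
      smul_eq_mul, ← hXdef, ← hYdef]
    ring
  have hdiff : (fun k => (U k ⬝ᵥ w) / 2) ⬝ᵥ U.mulVec f - contrast π₁ n f = -(N w ⬝ᵥ f / 2) := by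
    have e1 : ∀ k, U.mulVec f k = U k ⬝ᵥ f := fun k => rfl
    have e2 : N w ⬝ᵥ f = w ⬝ᵥ f - (U 0 ⬝ᵥ w) * (U 0 ⬝ᵥ f) - (U 1 ⬝ᵥ w) * (U 1 ⬝ᵥ f) := by
      simp only [hN, sub_dotProduct, smul_dotProduct, smul_eq_mul]
    rw [hcontr, e2, dotProduct, Fin.sum_univ_two, e1, e1]
    ring
  rw [hdiff, abs_neg]
  refine abs_le_of_sq_le_sq ?_ (by positivity)
  have ha0 := dotProduct_self_nonneg (N u₁)
  have hb0 := dotProduct_self_nonneg (N u₂)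
  have hNw2 : N w ⬝ᵥ N w ≤ 2 * (N u₁ ⬝ᵥ N u₁ + N u₂ ⬝ᵥ N u₂) / (c * n) ^ 2 := by
    have e1 : N w ⬝ᵥ N w ≤ 2 * (1 / X ^ 2 * (N u₁ ⬝ᵥ N u₁) + 1 / Y ^ 2 * (N u₂ ⬝ᵥ N u₂)) := by
      have := dotProduct_self_nonneg ((1 / X) • N u₁ + (1 / Y) • N u₂)
      rw [hNw]
      simp only [dotProduct_sub, sub_dotProduct, dotProduct_add, add_dotProduct, smul_dotProduct,
        dotProduct_smul, smul_eq_mul] at this ⊢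
      have e2 : 1 / X ^ 2 = 1 / X * (1 / X) := by field_simp
      have e3 : 1 / Y ^ 2 = 1 / Y * (1 / Y) := by field_simp
      rw [e2, e3]
      linarith
    refine e1.trans ?_
    calc _ ≤ 2 * (1 / (c * n) ^ 2 * (N u₁ ⬝ᵥ N u₁) + 1 / (c * n) ^ 2 * (N u₂ ⬝ᵥ N u₂)) := by gcongr
      _ = _ := by ring
  have hsS : √S ^ 2 = S := Real.sq_sqrt hS0
  have hsl : √lam ^ 2 = lam := Real.sq_sqrt hlam.le
  have hslpos : 0 < √lam := Real.sqrt_pos.2 hlam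
  calc (N w ⬝ᵥ f / 2) ^ 2 = (N w ⬝ᵥ f) ^ 2 / 4 := by ring
    _ ≤ (N w ⬝ᵥ N w) * (f ⬝ᵥ f) / 4 := by gcongr; exact sq_dotProduct_le _ _
    _ ≤ (2 * (8 * S * n / (c₀ ^ 2 * c ^ 2 * lam)) / (c * n) ^ 2) * n / 4 := by
        rw [hff]
        gcongr
        refine hNw2.trans ?_
        gcongr
    _ = (2 * √S / (c₀ * c ^ 2) / √lam) ^ 2 := by
        have e : (2 * √S / (c₀ * c ^ 2) / √lam) ^ 2 = 2 ^ 2 * S / (c₀ * c ^ 2) ^ 2 / lam := by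
          rw [div_pow _ √lam, div_pow _ (c₀ * c ^ 2), mul_pow 2 √S, hsS, hsl]
        rw [e]
        clear_value c₀
        field_simp
        ring

end SBM

/-! ### The stochastic block model: means, community sizes, constants. -/

namespace SBM

section Model

variable {n : ℕ} {Ω : Type*} [MeasurableSpace Ω] {μ : Measure Ω}
  {A : Ω → Matrix (Fin n) (Fin n) ℝ} {π₁ r ω lam : ℝ} {loops : Bool}

lemma IsAdjacency.expectation_apply (h : IsAdjacency π₁ r ω lam loops μ A) (i j : Fin n) :
    expectation μ A i j =
      if i = j ∧ loops = false then 0 else edgeProb π₁ r ω lam n i j := by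
  rw [← h.prob i j]
  have h1 : ∀ x, A x i j = Set.indicator {x | A x i j = 1} 1 x := fun x => by
    rcases h.zero_or_one x i j with h | h <;> simp [Set.indicator, h]
  simp only [expectation, Matrix.of_apply]
  rw [integral_congr_ae (ae_of_all _ h1), integral_indicator_one]
  exact h.measurable i j (measurableSet_singleton 1)

/-- The expected adjacency matrix differs from the block matrix on the diagonal only. -/
lemma IsAdjacency.exists_expectation_eq (h : IsAdjacency π₁ r ω lam loops μ A) (hr : 0 ≤ r)
    (hω : 0 ≤ ω) (hlam : 0 ≤ lam) :
    ∃ d : Fin n → ℝ, (∀ i, 0 ≤ d i) ∧ (∀ i, d i ≤ (1 + r + ω) * lam / n) ∧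
      (∀ i j : Fin n, ((i : ℕ) < size₁ π₁ n ↔ (j : ℕ) < size₁ π₁ n) → d i = d j) ∧
      expectation μ A = blockMatrix π₁ r ω lam n - Matrix.diagonal d := by
  refine ⟨fun i => if loops = false then edgeProb π₁ r ω lam n i i else 0, fun i => ?_, fun i => ?_,
    fun i j hij => ?_, ?_⟩
  · dsimp only
    split_ifs
    · exact edgeProb_nonneg hr hω hlam i i
    · exact le_rfl
  · dsimp only
    split_ifs
    · exact edgeProb_le hr hω hlam i i
    · positivity
  · simp only [edgeProb, hij]
  · ext i j
    rw [h.expectation_apply, Matrix.sub_apply, Matrix.diagonal_apply, blockMatrix, Matrix.of_apply]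
    by_cases hij : i = j
    · subst hij
      by_cases hl : loops = false <;> simp [hl]
    · simp [hij]

lemma IsAdjacency.isBernoulli (h : IsAdjacency π₁ r ω lam loops μ A) (hr : 0 ≤ r)
    (hω : 0 ≤ ω) (hlam : 0 ≤ lam) : IsBernoulli μ A ((1 + r + ω) * lam / n) where
  measurable := h.measurable
  zero_or_one := h.zero_or_one
  symm := h.symm
  indep := h.indep
  mean_le i j := by
    rw [h.expectation_apply]
    split_ifs
    · positivity
    · exact edgeProb_le hr hω hlam i j

/-- An edge inside community 1 has probability lam / n, which cannot exceed 1. Two nodes there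
provide an off-diagonal pair, unaffected by the convention on loops. -/
lemma IsAdjacency.lam_le [IsProbabilityMeasure μ] (h : IsAdjacency π₁ r ω lam loops μ A) (hn : 2 ≤ n)
    (hs : 2 ≤ size₁ π₁ n) : lam ≤ n := by
  have h1 := h.prob ⟨0, by omega⟩ ⟨1, by omega⟩
  rw [if_neg (by simp)] at h1
  have h2 : edgeProb π₁ r ω lam n ⟨0, by omega⟩ ⟨1, by omega⟩ ≤ 1 := h1 ▸ measureReal_le_one
  have h3 : (0 : ℕ) < size₁ π₁ n := by omega
  have h4 : (1 : ℕ) < size₁ π₁ n := by omega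
  simp only [edgeProb, h3, h4, if_true, mul_one] at h2
  have hn' : (0 : ℝ) < n := by exact_mod_cast (by omega : 0 < n)
  rwa [div_le_one hn'] at h2

end Model

lemma card_comm₁ {π₁ : ℝ} (h1 : π₁ ≤ 1) (n : ℕ) : (comm₁ π₁ n).card = size₁ π₁ n := by
  have hle : size₁ π₁ n ≤ n := by
    refine Nat.floor_le_of_le ?_
    nlinarith [(Nat.cast_nonneg n : (0 : ℝ) ≤ n)]
  rw [comm₁, Fin.card_filter_val_lt, min_eq_right hle]

/-- Both communities have linear size. -/
lemma eventually_le_card_comm {π₁ : ℝ} (h0 : 0 < π₁) (h1 : π₁ < 1) :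
    ∀ᶠ n : ℕ in atTop, min (π₁ / 2) (1 - π₁) * n ≤ (comm₁ π₁ n).card ∧
      min (π₁ / 2) (1 - π₁) * n ≤ (comm₂ π₁ n).card := by
  -- Rounding down costs community 1 less than one node, which is at most π₁ n / 2 here; community 2
  -- only gains.
  filter_upwards [tendsto_natCast_atTop_atTop.eventually_ge_atTop (2 / π₁)] with n hn
  have hn0 : (0 : ℝ) ≤ n := Nat.cast_nonneg n
  rw [div_le_iff₀ h0] at hn
  have h2 := card_comm₁_add_card_comm₂ (n := n) π₁
  have h3 : (size₁ π₁ n : ℝ) ≤ π₁ * n := Nat.floor_le (by positivity)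
  have h4 : π₁ * n < size₁ π₁ n + 1 := Nat.lt_floor_add_one _
  rw [card_comm₁ h1.le] at h2 ⊢
  constructor
  · calc _ ≤ π₁ / 2 * n := by gcongr; exact min_le_left _ _
      _ ≤ _ := by linarith
  · calc _ ≤ (1 - π₁) * n := by gcongr; exact min_le_right _ _
      _ ≤ _ := by linarith

/-- Shows that the factor of contrast² in `modularity_blockMatrix` is of order n λ, against cut-norm
errors of order n √λ. -/
lemma le_contrast_factor {r ω lam c N X Y : ℝ} (hr : 0 ≤ r) (hω : r ^ 2 < ω) (hlam : 0 < lam)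
    (hN : 0 < N) (hc : 0 < c) (hX : c * N ≤ X) (hY : c * N ≤ Y) (hXY : X + Y = N) :
    c ^ 4 * (ω - r ^ 2) / (1 + 2 * r + ω) * (N * lam) ≤
      lam / N * (X ^ 2 * Y ^ 2 * (ω - r ^ 2) / (X ^ 2 + 2 * r * X * Y + ω * Y ^ 2)) := by
  have hω0 : 0 < ω := (sq_nonneg r).trans_lt hω
  have hd : 0 < ω - r ^ 2 := by linarith
  have hcN : 0 < c * N := by positivity
  have hX0 : 0 < X := hcN.trans_le hX
  have hY0 : 0 < Y := hcN.trans_le hY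
  have hXN : X ≤ N := by linarith
  have hYN : Y ≤ N := by linarith
  have hden : X ^ 2 + 2 * r * X * Y + ω * Y ^ 2 ≤ (1 + 2 * r + ω) * N ^ 2 := by
    calc X ^ 2 + 2 * r * X * Y + ω * Y ^ 2 ≤ N ^ 2 + 2 * r * N * N + ω * N ^ 2 := by gcongr
      _ = _ := by ring
  calc c ^ 4 * (ω - r ^ 2) / (1 + 2 * r + ω) * (N * lam) =
      lam / N * ((c * N) ^ 2 * (c * N) ^ 2 * (ω - r ^ 2) / ((1 + 2 * r + ω) * N ^ 2)) := by
        field_simp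
    _ ≤ _ := by gcongr

end SBM

/-! ### Assembling the error bounds on the good event. -/

namespace SBM

variable {n : ℕ}

lemma sum_sum_diagonal (d : Fin n → ℝ) (s t : Finset (Fin n)) :
    ∑ i ∈ s, ∑ j ∈ t, Matrix.diagonal d i j = ∑ i ∈ s, if i ∈ t then d i else 0 := by
  simp [Matrix.diagonal_apply]

/-- The error bounds hold on the event that the adjacency matrix is close to its mean in the
cut norm, the quadratic form and the community row sums. -/
lemma output_bounds {π₁ r ω lam c S : ℝ} (hr : 0 ≤ r) (hω : r ^ 2 < ω) (hlam : 1 ≤ lam)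
    (hlam_le : lam ≤ n) (hn : 2 < n) (hc : 0 < c) (h1 : c * n ≤ (comm₁ π₁ n).card)
    (h2 : c * n ≤ (comm₂ π₁ n).card) (hcn : 1 + r + ω < (ω - r ^ 2) / (1 + ω) * (c * n))
    {A E : Matrix (Fin n) (Fin n) ℝ} (hA : ∀ i j, A i j = A j i) (hA0 : ∀ i j, 0 ≤ A i j)
    {d : Fin n → ℝ} (hd0 : ∀ i, 0 ≤ d i) (hdC : ∀ i, d i ≤ (1 + r + ω) * lam / n)
    (hd : ∀ i j : Fin n, ((i : ℕ) < size₁ π₁ n ↔ (j : ℕ) < size₁ π₁ n) → d i = d j)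
    (hE : E = blockMatrix π₁ r ω lam n - Matrix.diagonal d)
    (hcut : ∀ s : Finset (Fin n),
      |∑ i ∈ s, ∑ j ∈ s, (A i j - E i j)| ≤ (1 + r + ω + 4) * (n * √lam))
    (hquad : ∀ v : Fin n → ℝ, v ⬝ᵥ (A - E).mulVec v ≤
      (ω - r ^ 2) / (1 + ω) * c / 2 * lam * (v ⬝ᵥ v))
    (hS₁ : ∑ i, (∑ j ∈ comm₁ π₁ n, (A i j - E i j)) ^ 2 ≤ S * (n * lam))
    (hS₂ : ∑ i, (∑ j ∈ comm₂ π₁ n, (A i j - E i j)) ^ 2 ≤ S * (n * lam))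
    {U : Matrix (Fin 2) (Fin n) ℝ} {e : Fin n → ℝ} (hout : IsOutput A U e) :
    (∀ V : Matrix (Fin 2) (Fin n) ℝ, IsLeading E V →
      1 / (n : ℝ) * sqDist (trueLabel π₁ n) e ≤ 16 * (1 / √(2 * c) * specNorm (U - V)) +
        52 * ((2 * (1 + r + ω) + 4) / (c ^ 4 * (ω - r ^ 2) / (1 + 2 * r + ω))) / √lam) ∧
    (IsLeading A U → 1 / (n : ℝ) * sqDist (trueLabel π₁ n) e ≤
      (16 * (2 * √(2 * S + 2 * (1 + r + ω) ^ 2) / ((ω - r ^ 2) / (1 + ω) * c ^ 2)) +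
        52 * ((2 * (1 + r + ω) + 4) / (c ^ 4 * (ω - r ^ 2) / (1 + 2 * r + ω)))) / √lam) := by
  have hn' : (0 : ℝ) < n := by exact_mod_cast (by omega : 0 < n)
  have hl : 0 < lam := by linarith
  have hω0 : 0 < ω := (sq_nonneg r).trans_lt hω
  have hd' : 0 < ω - r ^ 2 := by linarith
  have hX : 0 < ((comm₁ π₁ n).card : ℝ) := lt_of_lt_of_le (by positivity) h1
  have hY : 0 < ((comm₂ π₁ n).card : ℝ) := lt_of_lt_of_le (by positivity) h2
  set C := 1 + r + ω with hC
  have hC0 : 0 < C := by positivity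
  set k := c ^ 4 * (ω - r ^ 2) / (1 + 2 * r + ω) with hk
  have hk0 : 0 < k := by positivity
  have hsl : √lam ^ 2 = lam := Real.sq_sqrt hl.le
  have hsl1 : 1 ≤ √lam := Real.one_le_sqrt.2 hlam
  have hsl_le : √lam ≤ n := by nlinarith
  have hAP : ∀ i j, A i j - blockMatrix π₁ r ω lam n i j = (A i j - E i j) - Matrix.diagonal d i j :=
    fun i j => by rw [hE, Matrix.sub_apply]; ring
  -- The diagonal adds at most C lam, and √lam ≤ n makes this at most C n √lam.
  have hcutP : ∀ s : Finset (Fin n), |∑ i ∈ s, ∑ j ∈ s, (A i j - blockMatrix π₁ r ω lam n i j)| ≤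
      (2 * C + 4) * (n * √lam) := by
    intro s
    have e0 : ∑ i ∈ s, ∑ j ∈ s, (A i j - blockMatrix π₁ r ω lam n i j) =
        ∑ i ∈ s, ∑ j ∈ s, (A i j - E i j) - ∑ i ∈ s, (if i ∈ s then d i else 0) := by
      rw [← sum_sum_diagonal d s s, ← Finset.sum_sub_distrib]
      refine Finset.sum_congr rfl fun i _ => ?_
      rw [← Finset.sum_sub_distrib]
      exact Finset.sum_congr rfl fun j _ => hAP i j
    rw [e0]
    have e1 : |∑ i ∈ s, if i ∈ s then d i else 0| ≤ C * (n * √lam) := by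
      rw [abs_of_nonneg (Finset.sum_nonneg fun i _ => by split_ifs <;> simp [hd0])]
      calc ∑ i ∈ s, (if i ∈ s then d i else 0) ≤ ∑ i ∈ s, C * lam / n :=
            Finset.sum_le_sum fun i hi => by rw [if_pos hi]; exact hdC i
        _ = s.card * (C * lam / n) := by simp
        _ ≤ n * (C * lam / n) := by
            gcongr
            exact (Finset.card_le_univ s).trans (by simp)
        _ = C * (√lam * √lam) := by rw [← sq, hsl]; field_simp
        _ ≤ C * (n * √lam) := by gcongr
    refine (abs_sub _ _).trans ((add_le_add (hcut s) e1).trans (le_of_eq (by ring)))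
  -- Replacing `E` by the block matrix subtracts a nonnegative diagonal, which only helps a
  -- one-sided bound.
  have hquadP : ∀ v : Fin n → ℝ, v ⬝ᵥ (A - blockMatrix π₁ r ω lam n).mulVec v ≤
      (ω - r ^ 2) / (1 + ω) * c / 2 * lam * (v ⬝ᵥ v) := by
    intro v
    have e1 : A - blockMatrix π₁ r ω lam n = (A - E) - Matrix.diagonal d := by rw [hE]; abel
    have e2 : 0 ≤ v ⬝ᵥ (Matrix.diagonal d).mulVec v := by
      simp only [dotProduct, Matrix.mulVec_diagonal]
      exact Finset.sum_nonneg fun i _ => by nlinarith [hd0 i, mul_self_nonneg (v i)]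
    rw [e1, Matrix.sub_mulVec, dotProduct_sub]
    linarith [hquad v]
  have hrow : ∀ B : Finset (Fin n), ∑ i, (∑ j ∈ B, (A i j - E i j)) ^ 2 ≤ S * (n * lam) →
      ∑ i, (∑ j ∈ B, (A i j - blockMatrix π₁ r ω lam n i j)) ^ 2 ≤
        (2 * S + 2 * C ^ 2) * (n * lam) := by
    intro B hB
    have e1 : ∀ i, (∑ j ∈ B, (A i j - blockMatrix π₁ r ω lam n i j)) ^ 2 ≤
        2 * (∑ j ∈ B, (A i j - E i j)) ^ 2 + 2 * (C * lam / n) ^ 2 := by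
      intro i
      simp only [hAP]
      have e2 : ∑ j ∈ B, Matrix.diagonal d i j = if i ∈ B then d i else 0 := by
        simp [Matrix.diagonal_apply]
      rw [Finset.sum_sub_distrib, e2]
      have e3 : (if i ∈ B then d i else 0) ^ 2 ≤ (C * lam / n) ^ 2 := by
        split_ifs
        · exact pow_le_pow_left₀ (hd0 i) (hdC i) 2
        · simpa using sq_nonneg (C * lam / n)
      nlinarith [sq_nonneg (∑ j ∈ B, (A i j - E i j) + if i ∈ B then d i else 0)]
    have e4 : (lam / n) * lam ≤ 1 * (n * lam) := by
      have h3 : lam / n ≤ 1 := (div_le_one hn').2 hlam_le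
      have h4 : lam ≤ n * lam := by
        have : (1 : ℝ) ≤ n := hlam.trans hlam_le
        nlinarith
      exact mul_le_mul h3 h4 hl.le zero_le_one
    calc _ ≤ ∑ i, (2 * (∑ j ∈ B, (A i j - E i j)) ^ 2 + 2 * (C * lam / n) ^ 2) :=
          Finset.sum_le_sum fun i _ => e1 i
      _ = 2 * ∑ i, (∑ j ∈ B, (A i j - E i j)) ^ 2 + 2 * C ^ 2 * ((lam / n) * lam) := by
          rw [Finset.sum_add_distrib, ← Finset.mul_sum]
          simp only [Finset.sum_const, Finset.card_univ, Fintype.card_fin, nsmul_eq_mul]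
          field_simp
      _ ≤ 2 * (S * (n * lam)) + 2 * C ^ 2 * (1 * (n * lam)) := by gcongr
      _ = _ := by ring
  have hκle := le_contrast_factor hr hω hl hn' hc h1 h2 (card_comm₁_add_card_comm₂ π₁)
  rw [← hk] at hκle
  have hratio : 52 * ((2 * C + 4) * (n * √lam) / (k * (n * lam))) =
      52 * ((2 * C + 4) / k) / √lam := by
    nth_rewrite 2 [← hsl]
    field_simp
  have hmain : ∀ (q : Fin 2 → ℝ) (ε : ℝ), (∀ f : Fin n → ℝ, (∀ i, f i = 1 ∨ f i = -1) →
      |q ⬝ᵥ U.mulVec f - contrast π₁ n f| ≤ ε) → 1 / (n : ℝ) * sqDist (trueLabel π₁ n) e ≤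
        16 * ε + 52 * ((2 * C + 4) / k) / √lam := by
    intro q ε hq
    rw [← hratio]
    exact sqDist_le_of_isOutput hr hω hl hA hA0 hX hY (by positivity) hcutP hκle hout q hq
  refine ⟨fun V hV => ?_, fun hU => ?_⟩
  · rw [hE] at hV
    have hc₀ : 0 < (ω - r ^ 2) / (1 + ω) := by positivity
    obtain ⟨α, β, hαβ⟩ := exists_block_constant_of_isLeading hn hω hl hd0 hdC hd
      (hcn.trans_le (by gcongr)) (hcn.trans_le (by gcongr)) hV
    obtain ⟨q, hq⟩ := exists_dotProduct_near_contrast (by omega) hc h1 h2 hV.1 hαβ U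
    exact hmain q _ hq
  · obtain ⟨q, hq⟩ := exists_dotProduct_near_contrast_of_isLeading hω hl hn hc h1 h2 hA hU hquadP
      (hrow _ hS₁) (hrow _ hS₂)
    refine (hmain q _ hq).trans (le_of_eq ?_)
    ring

end SBM

theorem theorem4 (π₁ r ω δ : ℝ) (hπ₀ : 0 < π₁) (hπ₁ : π₁ < 1) (hr : 0 ≤ r) (hω : r ^ 2 < ω)
    (hδ₀ : 0 < δ) (hδ₁ : δ < 1) :
    ∃ M : ℝ, 0 < M ∧ ∀ (loops : Bool) (lam : ℕ → ℝ),
      (∃ a : ℝ, 0 < a ∧ ∀ᶠ n : ℕ in atTop, a * Real.log n ≤ lam n) →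
      ∀ᶠ n : ℕ in atTop, ∀ (Ω : Type*) [MeasurableSpace Ω] (μ : Measure Ω)
        [IsProbabilityMeasure μ] (A : Ω → Matrix (Fin n) (Fin n) ℝ),
        SBM.IsAdjacency π₁ r ω (lam n) loops μ A →
        1 - (n : ℝ) ^ (-δ) ≤ μ.real {x : Ω |
          (∀ (U V : Matrix (Fin 2) (Fin n) ℝ) (e : Fin n → ℝ),
            SBM.IsLeading (SBM.expectation μ A) V → SBM.IsOutput (A x) U e →
            1 / (n : ℝ) * SBM.sqDist (SBM.trueLabel π₁ n) e ≤
              M * (lam n ^ (-(1 / 2) : ℝ) + SBM.specNorm (U - V))) ∧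
          (∀ (U : Matrix (Fin 2) (Fin n) ℝ) (e : Fin n → ℝ),
            SBM.IsLeading (A x) U → SBM.IsOutput (A x) U e →
            SBM.misclustered (SBM.trueLabel π₁ n) e ≤ M / Real.sqrt (lam n))} := by
  have hω0 : 0 < ω := (sq_nonneg r).trans_lt hω
  have hd' : 0 < ω - r ^ 2 := by linarith
  set C := 1 + r + ω with hC
  have hC0 : 0 < C := by positivity
  set c := min (π₁ / 2) (1 - π₁) with hc
  have hc0 : 0 < c := lt_min (by linarith) (by linarith)
  set c₀ := (ω - r ^ 2) / (1 + ω) with hc₀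
  have hc₀pos : 0 < c₀ := by positivity
  set S := 4 * (2 + 48 * Real.exp C) with hS
  set k := c ^ 4 * (ω - r ^ 2) / (1 + 2 * r + ω) with hk
  have hk0 : 0 < k := by positivity
  set M₁ := 16 * (1 / √(2 * c)) with hM₁
  set M₂ := 52 * ((2 * C + 4) / k) with hM₂
  set M₃ := 16 * (2 * √(2 * S + 2 * C ^ 2) / (c₀ * c ^ 2)) with hM₃
  have hM₁0 : 0 < M₁ := by positivity
  have hM₂0 : 0 < M₂ := by positivity
  have hM₃0 : 0 ≤ M₃ := by positivity
  refine ⟨M₁ + M₂ + M₃, by positivity, ?_⟩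
  rintro loops lam ⟨a, ha, hlog⟩
  have hcast := tendsto_natCast_atTop_atTop (R := ℝ)
  filter_upwards [hlog, SBM.eventually_const_le_of_log_le a 1 ha,
    SBM.eventually_measureReal_quadForm_le hC0 ha (by positivity : 0 < c₀ * c / 2),
    SBM.eventually_le_card_comm hπ₀ hπ₁, eventually_gt_atTop 2,
    hcast.eventually_gt_atTop (C / (c₀ * c)), hcast.eventually_ge_atTop (2 / c),
    ((tendsto_rpow_atTop (by linarith : 0 < 1 - δ)).comp hcast).eventually_ge_atTop
      (6 + 192 * Real.exp C)] with n hlam hlam1 hquad hcard hn hcn hcn2 hprob Ω _ μ _ A hA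
  replace hlam1 := hlam1 _ hlam
  replace hquad := hquad _ hlam Ω μ A
  have hn' : (0 : ℝ) < n := by exact_mod_cast (by omega : 0 < n)
  have hl : 0 < lam n := by linarith
  rw [div_lt_iff₀ (by positivity)] at hcn
  rw [div_le_iff₀ hc0] at hcn2
  have hsize : 2 ≤ SBM.size₁ π₁ n := by
    rw [← SBM.card_comm₁ hπ₁.le]
    exact_mod_cast (show (2 : ℝ) ≤ (SBM.comm₁ π₁ n).card by linarith [hcard.1])
  have hlam_le := hA.lam_le (by omega) hsize
  have hB := hA.isBernoulli hr hω0.le hl.le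
  rw [← hC] at hB
  obtain ⟨d, hd0, hdC, hd, hE⟩ := hA.exists_expectation_eq hr hω0.le hl.le
  have p1 := hB.measureReal_cut_le hlam1 hC0.le (by omega) rfl
  have p2 := hquad hB
  have p3 := hB.measureReal_rowSum_le hC0.le hlam1 (by omega) (SBM.comm₁ π₁ n)
  have p4 := hB.measureReal_rowSum_le hC0.le hlam1 (by omega) (SBM.comm₂ π₁ n)
  have p1' : 2 * Real.exp (-(n : ℝ)) ≤ 2 / n := by
    calc 2 * Real.exp (-(n : ℝ)) ≤ 2 * (1 / n) := by
          gcongr; exact SBM.exp_neg_natCast_le (by omega)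
      _ = 2 / n := by ring
  set G : Set Ω := {x : Ω |
          (∀ (U V : Matrix (Fin 2) (Fin n) ℝ) (e : Fin n → ℝ),
            SBM.IsLeading (SBM.expectation μ A) V → SBM.IsOutput (A x) U e →
            1 / (n : ℝ) * SBM.sqDist (SBM.trueLabel π₁ n) e ≤
              (M₁ + M₂ + M₃) * (lam n ^ (-(1 / 2) : ℝ) + SBM.specNorm (U - V))) ∧
          (∀ (U : Matrix (Fin 2) (Fin n) ℝ) (e : Fin n → ℝ),
            SBM.IsLeading (A x) U → SBM.IsOutput (A x) U e →
            SBM.misclustered (SBM.trueLabel π₁ n) e ≤ (M₁ + M₂ + M₃) / Real.sqrt (lam n))}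
    with hG
  have hbad : μ.real Gᶜ ≤ 2 / n + 4 / n + 96 * Real.exp C / n + 96 * Real.exp C / n := by
    refine le_trans (measureReal_mono (fun x hx => ?_) (measure_ne_top _ _))
      ((measureReal_union_le _ _).trans (add_le_add ((measureReal_union_le _ _).trans
        (add_le_add ((measureReal_union_le _ _).trans (add_le_add (p1.trans p1') p2)) p3)) p4))
    by_contra hcon
    simp only [Set.mem_union, Set.mem_ofPred_eq, not_or, not_exists, not_le, not_lt] at hcon
    obtain ⟨⟨⟨b1, b2⟩, b3⟩, b4⟩ := hcon
    refine hx ?_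
    have key := fun (U : Matrix (Fin 2) (Fin n) ℝ) (e : Fin n → ℝ)
        (hout : SBM.IsOutput (A x) U e) =>
      SBM.output_bounds hr hω hlam1 hlam_le hn hc0 hcard.1 hcard.2 (by linarith) (hA.symm x)
        (hB.nonneg x) hd0 hdC hd hE (fun s => (b1 s).le) b2 b3.le b4.le hout
    have hsl : 0 < √(lam n) := Real.sqrt_pos.2 hl
    refine ⟨fun U V e hV hout => ?_, fun U e hU hout => ?_⟩
    · refine ((key U e hout).1 V hV).trans ?_
      have e1 : lam n ^ (-(1 / 2) : ℝ) = 1 / √(lam n) := by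
        rw [Real.rpow_neg hl.le, ← Real.sqrt_eq_rpow, inv_eq_one_div]
      have e2 := SBM.specNorm_nonneg (U - V)
      have e3 : 0 < 1 / √(lam n) := by positivity
      rw [e1]
      calc _ = M₁ * SBM.specNorm (U - V) + M₂ * (1 / √(lam n)) := by rw [hM₁, hM₂]; ring
        _ ≤ (M₁ + M₂ + M₃) * SBM.specNorm (U - V) + (M₁ + M₂ + M₃) * (1 / √(lam n)) := by
            gcongr <;> linarith
        _ = _ := by ring
    · rw [SBM.misclustered_trueLabel π₁ hout.1.1]
      have h5 := (key U e hout).2 hU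
      calc _ ≤ 1 / 4 * ((M₃ + M₂) / √(lam n)) := by gcongr
        _ = 1 / 4 * (M₃ + M₂) / √(lam n) := by ring
        _ ≤ _ := by gcongr; linarith
  -- The four failure probabilities add up to (6 + 192 exp C) / n, and n^(1 - δ) eventually exceeds
  -- the numerator.
  have hfinal : 2 / n + 4 / n + 96 * Real.exp C / n + 96 * Real.exp C / n ≤ (n : ℝ) ^ (-δ) := by
    have e1 : (n : ℝ) ^ (-δ) = (n : ℝ) ^ (1 - δ) / n := by
      rw [sub_eq_add_neg, Real.rpow_add hn', Real.rpow_one]; field_simp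
    rw [e1]
    calc _ = (6 + 192 * Real.exp C) / n := by ring
      _ ≤ _ := by gcongr; exact hprob
  -- `G` quantifies over uncountably many matrices and is not shown to be measurable; subadditivity
  -- is enough here.
  have hcover : (1 : ℝ) ≤ μ.real G + μ.real Gᶜ := by
    have h6 := measureReal_union_le (μ := μ) G Gᶜ
    rwa [Set.union_compl_self, probReal_univ] at h6
  linarith
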